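/- Let $S$ be a string of length $n$ over an alphabet $\Sigma$, with characters indexed from $1$. Write $A\subseteq B$ if $A$ is a (not necessarily contiguous) subsequence of $B$, $S[a,b]$ for the substring $S[a]\cdots S[b]$ (empty if $b<a$), $S[a,b)=S[a,b-1]$ and $S(a,b]=S[a+1,b]$. A *square subsequence* of $S$ is a string $X\subseteq S$ of the form $X=YY$; it is *maximal* if it is not properly contained, as a subsequence, in another square subsequence of $S$. The string $X=YY$ is *right-extendable* (*left-extendable*) if $YyYy\subseteq S$ ($yYyY\subseteq S$) for some letter $y$, and *inner-extendable* if $Y_1yY_2Y_1yY_2\subseteq S$ for some letter $y$ and some non-empty $Y_1,Y_2$ with $Y=Y_1Y_2$. For a common subsequence $C$ of two strings $A,B$, let $MCS(A,B,C)$ stand for the answer of a subroutine that returns some maximal common subsequence of $A$ and $B$ containing $C$. Let $\sigma$ be a letter that occurs $\ell\ge 2$ times in $S$, at the positions $i_1<\dots<i_\ell$, and put $e=\lfloor \ell/2\rfloor$. For a string $Y$, the leftmost anchor of $Y$ with position $i_t$ is the least $j_t$ with $Y\subseteq S[i_t,j_t]$. *Algorithm 1.* Let $Y=MCS(S[i_1,i_{e+1}),\,S[i_{e+1},n],\,\sigma^e)$.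 If $\ell$ is odd and $Y\subseteq S[i_{e+2},n]$, replace $Y$ by $MCS(S[i_1,i_{e+2}),\,S[i_{e+2},n],\,Y)$. Return $X_1=YY$. *Algorithm 2.* Given $X_1=YY$, let $j_1$ be the leftmost anchor of $Y$ with position $i_1$ and let $Z=MCS(S[1,j_1],\,S(j_1,n],\,Y)$. If $\ell$ is odd, let $j_2$ be the leftmost anchor of $Y$ with position $i_2$, and if $Z\subseteq S(j_2,n]$, replace $Z$ by $MCS(S[1,j_2],\,S(j_2,n],\,Z)$. Return $X_2=ZZ$. **Theorem.** 1. Let $S$ be any string and $\sigma$ any letter that occurs $\ell\ge2$ times in $S$. Whatever answers the $MCS$ subroutine gives, Algorithms 1 and 2 run without failure: all positions and anchors that they use exist, and in each call $MCS(A,B,C)$ the string $C$ is a common subsequence of $A$ and $B$. They have at least one possible run, they make at most four calls of $MCS$, and every possible output $X_2=ZZ$ contains $\sigma^{2\lfloor \ell/2\rfloor}$, is a maximal square subsequence of $S$, and is neither right-, nor left-, nor inner-extendable. 2. This can be computed in $O(n\log n)$ time. More precisely, there are a program $P$ for the unit-cost random access machine, a constant $C$ and a function $T(n)=O(n\log n)$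 such that for every string $S$ of length $n$ and every letter $\sigma$, with letters encoded as integers in $\{0,\dots,M\}$, the program $P$ on the input $(S,\sigma)$ halts after at most $T(n)$ steps, never handles a number larger than $C\,(n+M+1)$, and outputs a maximal square subsequence of $S$. If moreover $\sigma$ occurs at least twice in $S$, the output of $P$ is a possible output $X_2$ of Algorithms 1 and 2 for $S$ and $\sigma$. Here the time for computing the answers of $MCS$ is included. -/

import Mathlib

namespace MaxSq

section Strings

variable {α : Type*}

/-- A square subsequence of `S`: a subsequence of `S` of the form `Y Y`
(`<+` is the, not necessarily contiguous, subsequence relation). -/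
def IsSquareSubseq (S X : List α) : Prop :=
  (∃ Y : List α, X = Y ++ Y) ∧ X.Sublist S

/-- A square subsequence of `S` that is not properly contained, as a subsequence, in another
square subsequence of `S`. -/
def IsMaximalSquareSubseq (S X : List α) : Prop :=
  IsSquareSubseq S X ∧ ∀ Z : List α, IsSquareSubseq S Z → X.Sublist Z → Z = X

/-- `X = Y Y` and `Y y Y y` is a subsequence of `S` for some letter `y`. -/
def RightExtendable (S X : List α) : Prop :=
  ∃ (Y : List α) (y : α), X = Y ++ Y ∧ ((Y ++ [y]) ++ (Y ++ [y])).Sublist S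

/-- `X = Y Y` and `y Y y Y` is a subsequence of `S` for some letter `y`. -/
def LeftExtendable (S X : List α) : Prop :=
  ∃ (Y : List α) (y : α), X = Y ++ Y ∧ (([y] ++ Y) ++ ([y] ++ Y)).Sublist S

/-- `X = Y Y`, `Y = Y₁ Y₂` with `Y₁`, `Y₂` non-empty, and `Y₁ y Y₂ Y₁ y Y₂` is a subsequence
of `S` for some letter `y`. -/
def InnerExtendable (S X : List α) : Prop :=
  ∃ (Y₁ Y₂ : List α) (y : α), Y₁ ≠ [] ∧ Y₂ ≠ [] ∧
    X = (Y₁ ++ Y₂) ++ (Y₁ ++ Y₂) ∧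
    ((Y₁ ++ [y] ++ Y₂) ++ (Y₁ ++ [y] ++ Y₂)).Sublist S

/-- `R` is a maximal common subsequence of `A` and `B` that contains `C`. -/
def IsMCSContaining (A B C R : List α) : Prop :=
  R.Sublist A ∧ R.Sublist B ∧ C.Sublist R ∧
    ∀ R' : List α, R'.Sublist A → R'.Sublist B → R.Sublist R' → R' = R

/-- The substring `S[a, b]`, with 1-based inclusive bounds (empty if `b < a`). -/
def substr (S : List α) (a b : ℕ) : List α := (S.take b).drop (a - 1)

/-- `i_t`: the 1-based position in `S` of the `t`-th occurrence (`t ≥ 1`) of `σ`, if any. -/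
def occPos [DecidableEq α] (S : List α) (σ : α) (t : ℕ) : Option ℕ :=
  ((List.range' 1 S.length).filter (fun i => decide (S[i - 1]? = some σ)))[t - 1]?

/-- The leftmost anchor of `Y` with position `i`: the smallest index `j ≤ |S|` such that `Y` is a
subsequence of `S[i, j]`, if any. -/
def anchor [DecidableEq α] (S : List α) (i : ℕ) (Y : List α) : Option ℕ :=
  (List.range (S.length + 1)).find? (fun j => decide (Y.Sublist (substr S i j)))

end Strings

section Algorithm

variable {α : Type*}

/-- Algorithms with calls to a subroutine for constrained maximal common subsequences:
`halt X` returns `X`; `stuck` is a failure (a position that does not exist was asked for);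
`call A B C k` calls `MCS(A, B, C)` and goes on with `k R`, where `R` is the answer. -/
inductive Alg (α : Type*) where
  | halt (X : List α) : Alg α
  | stuck : Alg α
  | call (A B C : List α) (k : List α → Alg α) : Alg α

/-- Run the first algorithm, then the second one on its result. -/
def Alg.bind : Alg α → (List α → Alg α) → Alg α
  | .halt X, f => f X
  | .stuck, _ => .stuck
  | .call A B C k, f => .call A B C (fun R => (k R).bind f)

/-- Look up a position; fail if it does not exist. -/
def Alg.lookup : Option ℕ → (ℕ → Alg α) → Alg α
  | none, _ => .stuck
  | some i, f => f i

/-- The algorithm can return `X` after exactly `m` calls, where each call to `MCS(A, B, C)` is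
answered by some maximal common subsequence of `A` and `B` that contains `C`. -/
def Alg.Returns : Alg α → List α → ℕ → Prop
  | .halt X, Z, m => Z = X ∧ m = 0
  | .stuck, _, _ => False
  | .call A B C k, Z, m =>
      ∃ (R : List α) (m' : ℕ), IsMCSContaining A B C R ∧ (k R).Returns Z m' ∧ m = m' + 1

/-- However the calls are answered, the algorithm never fails, and every call `MCS(A, B, C)` that
it makes is legitimate: `C` is a common subsequence of `A` and `B`. -/
def Alg.Safe : Alg α → Prop
  | .halt _ => True
  | .stuck => False
  | .call A B C k => C.Sublist A ∧ C.Sublist B ∧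
      ∀ R : List α, IsMCSContaining A B C R → (k R).Safe

variable [DecidableEq α]

/-- The first algorithm: from `S` and a letter `σ` compute `X₁ = Y Y`. -/
def alg1 (S : List α) (σ : α) : Alg α :=
  let n := S.length
  let ℓ := S.count σ
  let e := ℓ / 2
  Alg.lookup (occPos S σ 1) fun i₁ =>
  Alg.lookup (occPos S σ (e + 1)) fun p =>
  .call (substr S i₁ (p - 1)) (substr S p n) (List.replicate e σ) fun Y =>
  if Odd ℓ then
    Alg.lookup (occPos S σ (e + 2)) fun q =>
    if Y.Sublist (substr S q n) then
      .call (substr S i₁ (q - 1)) (substr S q n) Y fun Y' => .halt (Y' ++ Y')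
    else .halt (Y ++ Y)
  else .halt (Y ++ Y)

/-- The second algorithm: from `S`, `σ` and `X₁ = Y Y` compute `X₂ = Z Z`. -/
def alg2 (S : List α) (σ : α) (X₁ : List α) : Alg α :=
  let n := S.length
  let ℓ := S.count σ
  let Y := X₁.take (X₁.length / 2)
  Alg.lookup (occPos S σ 1) fun i₁ =>
  Alg.lookup (anchor S i₁ Y) fun j₁ =>
  .call (substr S 1 j₁) (substr S (j₁ + 1) n) Y fun Z =>
  if Odd ℓ then
    Alg.lookup (occPos S σ 2) fun i₂ =>
    Alg.lookup (anchor S i₂ Y) fun j₂ =>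
    if Z.Sublist (substr S (j₂ + 1) n) then
      .call (substr S 1 j₂) (substr S (j₂ + 1) n) Z fun Z' => .halt (Z' ++ Z')
    else .halt (Z ++ Z)
  else .halt (Z ++ Z)

/-- Both algorithms, one after the other. -/
def maximalSquareAlg (S : List α) (σ : α) : Alg α :=
  (alg1 S σ).bind (alg2 S σ)

end Algorithm

section Machine

/-! A unit-cost random access machine with a word-size bound. The memory consists of registers and
arrays, both numbered; a program mentions only finitely many of them. -/

structure MState where
  reg : ℕ → ℕ
  arr : ℕ → ℕ → ℕ

def MState.setReg (s : MState) (x v : ℕ) : MState where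
  reg := Function.update s.reg x v
  arr := s.arr

def MState.setArr (s : MState) (a i v : ℕ) : MState where
  reg := s.reg
  arr := Function.update s.arr a (Function.update (s.arr a) i v)

inductive BinOp where
  | add | sub | mul | div | lt | eq

/-- Subtraction is truncated, division rounds down, comparisons give `1` or `0`. -/
def BinOp.apply : BinOp → ℕ → ℕ → ℕ
  | .add, a, b => a + b
  | .sub, a, b => a - b
  | .mul, a, b => a * b
  | .div, a, b => a / b
  | .lt, a, b => if a < b then 1 else 0
  | .eq, a, b => if a = b then 1 else 0

inductive RExpr where
  | num (c : ℕ)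
  | reg (x : ℕ)
  | arr (a : ℕ) (i : RExpr)
  | op (o : BinOp) (u v : RExpr)

def RExpr.val (s : MState) : RExpr → ℕ
  | .num c => c
  | .reg x => s.reg x
  | .arr a i => s.arr a (i.val s)
  | .op o u v => o.apply (u.val s) (v.val s)

/-- The number of elementary operations in an expression. -/
def RExpr.cost : RExpr → ℕ
  | .num _ => 1
  | .reg _ => 1
  | .arr _ i => i.cost + 1
  | .op _ u v => u.cost + v.cost + 1

/-- No number that occurs in the evaluation exceeds `W`. -/
def RExpr.Fits (W : ℕ) (s : MState) : RExpr → Prop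
  | .num c => c ≤ W
  | .reg x => s.reg x ≤ W
  | .arr a i => i.Fits W s ∧ s.arr a (i.val s) ≤ W
  | .op o u v => u.Fits W s ∧ v.Fits W s ∧ o.apply (u.val s) (v.val s) ≤ W

inductive RStmt where
  | skip
  | assign (x : ℕ) (u : RExpr)
  | store (a : ℕ) (i u : RExpr)
  | seq (p q : RStmt)
  | ite (b : RExpr) (p q : RStmt)
  | loop (b : RExpr) (p : RStmt)

/-- `Exec W p s s' t`: on a machine with words in `{0, …, W}`, the program `p` started in the
state `s` halts in the state `s'` after `t` steps. A number above `W` blocks the machine. -/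
inductive Exec (W : ℕ) : RStmt → MState → MState → ℕ → Prop where
  | skip (s : MState) : Exec W .skip s s 1
  | assign (x : ℕ) (u : RExpr) (s : MState) (hu : u.Fits W s) :
      Exec W (.assign x u) s (s.setReg x (u.val s)) (u.cost + 1)
  | store (a : ℕ) (i u : RExpr) (s : MState) (hi : i.Fits W s) (hu : u.Fits W s) :
      Exec W (.store a i u) s
        (s.setArr a (i.val s) (u.val s))
        (i.cost + u.cost + 1)
  | seq {p q : RStmt} {s s' s'' : MState} {t t' : ℕ} (hp : Exec W p s s' t)
      (hq : Exec W q s' s'' t') : Exec W (.seq p q) s s'' (t + t' + 1)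
  | iteTrue {b : RExpr} {p q : RStmt} {s s' : MState} {t : ℕ} (hb : b.Fits W s)
      (h : b.val s ≠ 0) (hp : Exec W p s s' t) : Exec W (.ite b p q) s s' (b.cost + t + 1)
  | iteFalse {b : RExpr} {p q : RStmt} {s s' : MState} {t : ℕ} (hb : b.Fits W s)
      (h : b.val s = 0) (hq : Exec W q s s' t) : Exec W (.ite b p q) s s' (b.cost + t + 1)
  | whileTrue {b : RExpr} {p : RStmt} {s s' s'' : MState} {t t' : ℕ} (hb : b.Fits W s)
      (h : b.val s ≠ 0) (hp : Exec W p s s' t) (hw : Exec W (.loop b p) s' s'' t') :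
      Exec W (.loop b p) s s'' (b.cost + t + t' + 1)
  | whileFalse {b : RExpr} {p : RStmt} {s : MState} (hb : b.Fits W s) (h : b.val s = 0) :
      Exec W (.loop b p) s s (b.cost + 1)

/-- The input: `n = |S|` in register `0`, the letter `σ` in register `1`, the string `S` in the
first `n` cells of array `0`; everything else is `0`. -/
def inputState (S : List ℕ) (σ : ℕ) : MState where
  reg := fun x => if x = 0 then S.length else if x = 1 then σ else 0
  arr := fun a i => if a = 0 then S.getD i 0 else 0

/-- The output: a string whose length is in register `0` and whose letters are in array `0`. -/
def outputOf (s : MState) : List ℕ := (List.range (s.reg 0)).map (s.arr 0)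

end Machine

end MaxSq

namespace MaxSq

/-! ### Half-open segments, neighbouring occurrences, maximality and anchors -/

section Segments

variable {α : Type*}

/-- The letters of `S` at the 0-based positions `i` with `a ≤ i < b`. -/
def seg (S : List α) (a b : ℕ) : List α := (S.take b).drop a

theorem seg_zero (S : List α) (b : ℕ) : seg S 0 b = S.take b := by simp [seg]

theorem seg_append (S : List α) {a m b : ℕ} (h₁ : a ≤ m) (h₂ : m ≤ b) :
    seg S a m ++ seg S m b = seg S a b := by
  have h : S.take m = (S.take b).take m := by rw [List.take_take, min_eq_left h₂]
  unfold seg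
  rw [h, List.drop_take]
  conv_lhs => rw [← Nat.add_sub_cancel' h₁, ← List.drop_drop]
  rw [Nat.add_sub_cancel_left, List.take_append_drop]

theorem seg_mono (S : List α) {a a' b b' : ℕ} (h₁ : a' ≤ a) (h₂ : b ≤ b') :
    (seg S a b).Sublist (seg S a' b') := by
  unfold seg
  refine (List.drop_sublist_drop_left _ h₁).trans (List.Sublist.drop ?_ _)
  rw [← min_eq_left h₂, ← List.take_take]
  exact List.take_sublist _ _

theorem mem_seg {S : List α} {a b : ℕ} {c : α} :
    c ∈ seg S a b ↔ ∃ y, a ≤ y ∧ y < b ∧ S[y]? = some c := by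
  unfold seg
  rw [List.mem_iff_getElem?]
  constructor
  · rintro ⟨i, hi⟩
    rw [List.getElem?_drop, List.getElem?_take] at hi
    split_ifs at hi with h
    exact ⟨a + i, by omega, h, hi⟩
  · rintro ⟨y, h₁, h₂, h₃⟩
    refine ⟨y - a, ?_⟩
    rw [List.getElem?_drop, List.getElem?_take, Nat.add_sub_cancel' h₁, if_pos h₂, h₃]

theorem seg_cons {S : List α} {y b : ℕ} {c : α} (h : S[y]? = some c) (hb : y < b) :
    seg S y b = c :: seg S (y + 1) b := by
  have h' : (S.take b)[y]? = some c := by rw [List.getElem?_take, if_pos hb, h]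
  unfold seg
  obtain ⟨hy, rfl⟩ := List.getElem?_eq_some_iff.1 h'
  exact List.drop_eq_getElem_cons hy

theorem seg_succ {S : List α} {a y : ℕ} {c : α} (h : S[y]? = some c) (ha : a ≤ y) :
    seg S a (y + 1) = seg S a y ++ [c] := by
  rw [← seg_append S ha (Nat.le_succ y), seg_cons h (Nat.lt_succ_self y)]
  simp [seg]

theorem seg_eq_nil {S : List α} {a b : ℕ} (h : b ≤ a) : seg S a b = [] := by
  simp only [seg, List.drop_eq_nil_iff, List.length_take]
  omega

theorem length_seg_le (S : List α) (a b : ℕ) : (seg S a b).length ≤ S.length - a := by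
  simp only [seg, List.length_drop, List.length_take]
  omega

theorem cons_sublist_of_not_mem {c : α} {Q l₁ l₂ : List α} (hc : c ∉ l₁)
    (h : (c :: Q).Sublist (l₁ ++ l₂)) : (c :: Q).Sublist l₂ := by
  induction l₁ with
  | nil => exact h
  | cons x l ih =>
    rw [List.mem_cons, not_or] at hc
    rw [List.cons_append, List.cons_sublist_cons'] at h
    rcases h with h | h
    · exact ih hc.2 h
    · exact absurd h.1 hc.1

theorem sublist_of_append_singleton_not_mem {c : α} {Q l₁ l₂ : List α} (hc : c ∉ l₂)
    (h : (Q ++ [c]).Sublist (l₁ ++ l₂)) : (Q ++ [c]).Sublist l₁ := by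
  have h' := h.reverse
  rw [List.reverse_append, List.reverse_append] at h'
  have := cons_sublist_of_not_mem (by simpa using hc) h'
  simpa using this.reverse

/-- `y` is the first position from `x` on that carries `c`. -/
def NextOcc (S : List α) (c : α) (x y : ℕ) : Prop :=
  x ≤ y ∧ S[y]? = some c ∧ c ∉ seg S x y

/-- `y` is the last position before `x` that carries `c`. -/
def PrevOcc (S : List α) (c : α) (x y : ℕ) : Prop :=
  y < x ∧ S[y]? = some c ∧ c ∉ seg S (y + 1) x

/-- The exchange argument behind leftmost embeddings: whichever occurrence an embedding uses for
`c`, the first one leaves at least as much room for `Q`. -/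
theorem NextOcc.of_cons_sublist {S : List α} {c : α} {x y e : ℕ} {Q : List α}
    (hy : NextOcc S c x y) (h : (c :: Q).Sublist (seg S x e)) :
    y < e ∧ Q.Sublist (seg S (y + 1) e) := by
  obtain ⟨h₁, h₂, h₃⟩ := hy
  have hlt : y < e := by
    by_contra hle
    exact h₃ ((seg_mono S le_rfl (not_lt.1 hle)).subset (h.subset List.mem_cons_self))
  refine ⟨hlt, ?_⟩
  rw [← seg_append S h₁ hlt.le] at h
  have := cons_sublist_of_not_mem h₃ h
  rwa [seg_cons h₂ hlt, List.cons_sublist_cons] at this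

theorem PrevOcc.of_append_sublist {S : List α} {c : α} {f x y : ℕ} {Q : List α}
    (hy : PrevOcc S c x y) (h : (Q ++ [c]).Sublist (seg S f x)) :
    f ≤ y ∧ Q.Sublist (seg S f y) := by
  obtain ⟨h₁, h₂, h₃⟩ := hy
  have hle : f ≤ y := by
    by_contra hlt
    exact h₃ ((seg_mono S (not_le.1 hlt) le_rfl).subset (h.subset (by simp)))
  refine ⟨hle, ?_⟩
  rw [← seg_append S (hle.trans (Nat.le_succ y)) h₁, seg_succ h₂ hle] at h
  exact (List.append_sublist_append_right [c]).1 (sublist_of_append_singleton_not_mem h₃ h)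

/-- Reduces maximality to single insertions: a common subsequence is maximal as soon as no one
letter can be inserted at any place. -/
theorem exists_insert_of_sublist {C R : List α} (h : C.Sublist R) (hne : R ≠ C) :
    ∃ (P Q : List α) (c : α), C = P ++ Q ∧ (P ++ c :: Q).Sublist R := by
  induction h with
  | slnil => exact absurd rfl hne
  | @cons l₁ l₂ a h _ => exact ⟨[], l₁, a, rfl, h.cons_cons a⟩
  | @cons_cons l₁ l₂ a h ih =>
    obtain ⟨P, Q, c, rfl, h'⟩ := ih (fun e => hne (by rw [e]))
    exact ⟨a :: P, Q, c, rfl, h'.cons_cons a⟩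

/-- Proper extensions are longer, and `A` bounds the length, so extending must stop. This is what
guarantees that a safe algorithm has a run. -/
theorem exists_isMCSContaining {A B C : List α} (hA : C.Sublist A) (hB : C.Sublist B) :
    ∃ R, IsMCSContaining A B C R := by
  induction hk : A.length - C.length using Nat.strong_induction_on generalizing C with
  | _ k ih =>
    by_cases hmax : ∀ R' : List α, R'.Sublist A → R'.Sublist B → C.Sublist R' → R' = C
    · exact ⟨C, hA, hB, List.Sublist.refl _, hmax⟩
    · push Not at hmax
      obtain ⟨D, hDA, hDB, hCD, hne⟩ := hmax
      have hlt : C.length < D.length :=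
        lt_of_le_of_ne hCD.length_le (fun e => hne (hCD.eq_of_length e).symm)
      have := hDA.length_le
      obtain ⟨R, h₁, h₂, h₃, h₄⟩ := ih _ (by omega) hDA hDB rfl
      exact ⟨R, h₁, h₂, hCD.trans h₃, h₄⟩

/-- The border between the two copies of `Z` cuts at most one of the two copies of `Y`; the other
one lies within a single copy of `Z`. Hence squares can be compared through their halves. -/
theorem sublist_of_square_sublist {Y Z : List α} (h : (Y ++ Y).Sublist (Z ++ Z)) :
    Y.Sublist Z := by
  obtain ⟨P, Q, hPQ, hP, hQ⟩ := List.sublist_append_iff.1 h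
  rcases List.append_eq_append_iff.1 hPQ with ⟨T, h₁, h₂⟩ | ⟨T, h₁, h₂⟩
  · rw [h₁] at hP
    exact (List.sublist_append_left Y T).trans hP
  · rw [h₂] at hQ
    exact (List.sublist_append_right T Y).trans hQ

theorem isMaximalSquareSubseq_of_forall {S Z : List α} (hZ : (Z ++ Z).Sublist S)
    (h : ∀ W : List α, (W ++ W).Sublist S → Z.Sublist W → W = Z) :
    IsMaximalSquareSubseq S (Z ++ Z) := by
  refine ⟨⟨⟨Z, rfl⟩, hZ⟩, ?_⟩
  rintro _ ⟨⟨W, rfl⟩, hW⟩ hs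
  rw [h W hW (sublist_of_square_sublist hs)]

theorem IsMaximalSquareSubseq.eq_of_sublist {S Y Z : List α}
    (h : IsMaximalSquareSubseq S (Y ++ Y)) (hZ : (Z ++ Z).Sublist S) (hs : Y.Sublist Z) :
    Z.length = Y.length := by
  have := congrArg List.length (h.2 (Z ++ Z) ⟨⟨Z, rfl⟩, hZ⟩ (hs.append hs))
  simp only [List.length_append] at this
  omega

theorem IsMaximalSquareSubseq.not_rightExtendable {S X : List α}
    (h : IsMaximalSquareSubseq S X) : ¬ RightExtendable S X := by
  rintro ⟨Y, y, rfl, hs⟩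
  simpa using h.eq_of_sublist hs (List.sublist_append_left Y [y])

theorem IsMaximalSquareSubseq.not_leftExtendable {S X : List α}
    (h : IsMaximalSquareSubseq S X) : ¬ LeftExtendable S X := by
  rintro ⟨Y, y, rfl, hs⟩
  simpa using h.eq_of_sublist hs (List.sublist_append_right [y] Y)

theorem IsMaximalSquareSubseq.not_innerExtendable {S X : List α}
    (h : IsMaximalSquareSubseq S X) : ¬ InnerExtendable S X := by
  rintro ⟨Y₁, Y₂, y, -, -, rfl, hs⟩
  have := h.eq_of_sublist hs ((List.sublist_append_left Y₁ [y]).append (List.Sublist.refl Y₂))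
  simp only [List.length_append, List.length_singleton] at this
  omega

/-- `j` is the least number with `Y ⊆ S[i, j)`. -/
def IsAnchor (S : List α) (i : ℕ) (Y : List α) (j : ℕ) : Prop :=
  Y.Sublist (seg S i j) ∧ ∀ j', Y.Sublist (seg S i j') → j ≤ j'

theorem IsAnchor.le_length {S : List α} {i j : ℕ} {Y : List α} (h : IsAnchor S i Y j) :
    j ≤ S.length := by
  by_contra hlt
  have h1 := h.1
  have : seg S i j = seg S i S.length := by
    rw [seg, seg, List.take_of_length_le (not_le.1 hlt).le, List.take_length]
  rw [this] at h1
  exact hlt (h.2 _ h1)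

theorem exists_isAnchor {S : List α} {i b : ℕ} {Y : List α} (h : Y.Sublist (seg S i b)) :
    ∃ j, IsAnchor S i Y j := by
  classical
  have hex : ∃ j, Y.Sublist (seg S i j) := ⟨b, h⟩
  exact ⟨Nat.find hex, Nat.find_spec hex, fun j' hj' => Nat.find_min' hex hj'⟩

end Segments

/-! ### Numbering the occurrences of a letter -/

section Occurrences

variable {α : Type*} [DecidableEq α]

/-- `y` carries `c`, and `k` earlier positions do. -/
def IsOcc (S : List α) (c : α) (k y : ℕ) : Prop :=
  S[y]? = some c ∧ (S.take y).count c = k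

theorem count_take_add_count_seg (S : List α) (c : α) {a b : ℕ} (h : a ≤ b) :
    (S.take a).count c + (seg S a b).count c = (S.take b).count c := by
  rw [← seg_zero, ← seg_zero, ← List.count_append, seg_append S (Nat.zero_le a) h]

theorem count_take_mono (S : List α) (c : α) {a b : ℕ} (h : a ≤ b) :
    (S.take a).count c ≤ (S.take b).count c := by
  have := count_take_add_count_seg S c h
  omega

theorem count_take_le (S : List α) (c : α) (a : ℕ) : (S.take a).count c ≤ S.count c :=
  (List.take_sublist a S).count_le c

theorem count_take_succ (S : List α) (y : ℕ) {c x : α} (h : S[y]? = some x) :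
    (S.take (y + 1)).count c = (S.take y).count c + if x = c then 1 else 0 := by
  rw [List.take_add_one, h]
  simp [List.count_append, List.count_singleton]

theorem IsOcc.lt_of_lt {S : List α} {c : α} {k k' y y' : ℕ} (h : IsOcc S c k y)
    (h' : IsOcc S c k' y') (hlt : k < k') : y < y' := by
  by_contra hle
  have := count_take_mono S c (not_lt.1 hle)
  rw [h.2, h'.2] at this
  omega

theorem IsOcc.count_take_succ {S : List α} {c : α} {k y : ℕ} (h : IsOcc S c k y) :
    (S.take (y + 1)).count c = k + 1 := by
  rw [MaxSq.count_take_succ S y h.1, h.2, if_pos rfl]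

theorem IsOcc.unique {S : List α} {c : α} {k y y' : ℕ} (h : IsOcc S c k y)
    (h' : IsOcc S c k y') : y = y' := by
  have key : ∀ {y y' : ℕ}, IsOcc S c k y → IsOcc S c k y' → ¬ y < y' := by
    intro y y' h h' hlt
    have := count_take_mono S c (Nat.succ_le_of_lt hlt)
    rw [h.count_take_succ, h'.2] at this
    omega
  exact le_antisymm (not_lt.1 (key h' h)) (not_lt.1 (key h h'))

theorem IsOcc.lt_length {S : List α} {c : α} {k y : ℕ} (h : IsOcc S c k y) : y < S.length :=
  (List.getElem?_eq_some_iff.1 h.1).1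

theorem IsOcc.lt_count {S : List α} {c : α} {k y : ℕ} (h : IsOcc S c k y) : k < S.count c := by
  have := count_take_le S c (y + 1)
  rw [h.count_take_succ] at this
  omega

theorem exists_isOcc {S : List α} {c : α} {k : ℕ} (h : k < S.count c) : ∃ y, IsOcc S c k y := by
  have hex : ∃ x, k < (S.take x).count c := ⟨S.length, by rwa [List.take_length]⟩
  classical
  have hx := Nat.find_spec hex
  have hmin := fun m => Nat.find_min hex (m := m)
  set x := Nat.find hex
  obtain _ | y := x
  · simp at hx
  · have hy := hmin y (Nat.lt_succ_self y)
    rcases hs : S[y]? with _ | b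
    · rw [List.take_add_one, hs] at hx
      simp at hx
      omega
    · rw [count_take_succ S y hs] at hx
      refine ⟨y, ?_, ?_⟩
      · split_ifs at hx with hb
        · rw [hs, hb]
        · omega
      · split_ifs at hx <;> omega

/-- The algorithms number positions and occurrences from 1, the proof numbers both from 0; hence the
two shifts. The positions before `y` contribute exactly `k` entries to the filtered list. -/
theorem occPos_eq_some {S : List α} {c : α} {k y : ℕ} (h : IsOcc S c k y) :
    occPos S c (k + 1) = some (y + 1) := by
  have hlen : ∀ x, x ≤ S.length →
      ((List.range' 1 x).filter (fun i => decide (S[i - 1]? = some c))).length =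
        (S.take x).count c := by
    intro x hx
    induction x with
    | zero => simp
    | succ x ih =>
      have hs : S[x]? = some S[x] := List.getElem?_eq_getElem (by omega)
      rw [List.range'_concat, List.filter_append, List.length_append, ih (by omega),
        count_take_succ S x hs]
      simp only [Nat.one_mul, Nat.add_sub_cancel_left, List.filter_cons, List.filter_nil, hs,
        Option.some.injEq, decide_eq_true_eq]
      split_ifs <;> rfl
  have hn := h.lt_length
  have hsplit : List.range' 1 S.length =
      List.range' 1 y ++ (y + 1) :: List.range' (y + 2) (S.length - y - 1) := by
    obtain ⟨r, hr⟩ := Nat.exists_eq_add_of_lt hn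
    rw [hr, show y + r + 1 - y - 1 = r by omega, Nat.add_assoc, ← List.range'_append_1,
      Nat.add_comm 1 y, List.range'_succ]
  unfold occPos
  rw [hsplit, List.filter_append, List.filter_cons_of_pos (by simpa using h.1),
    Nat.add_sub_cancel, List.getElem?_append_right (by rw [hlen y hn.le, h.2]),
    hlen y hn.le, h.2]
  simp

/-- Only the start is shifted: an inclusive end counted from 1 and an exclusive end counted from 0
are the same number. -/
theorem anchor_eq_some {S : List α} {i j : ℕ} {Y : List α} (h : IsAnchor S i Y j) :
    anchor S (i + 1) Y = some j := by
  unfold anchor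
  rw [List.find?_range_eq_some]
  refine ⟨by simpa [substr, seg] using h.1, by simpa using Nat.lt_succ_of_le h.le_length, ?_⟩
  intro j' hj'
  have : ¬ Y.Sublist (seg S i j') := fun hs => absurd (h.2 j' hs) (by omega)
  simpa [substr, seg] using this

end Occurrences

/-! ### Weakest preconditions for algorithms with nondeterministic answers -/

section Runs

variable {α : Type*}

/-- The algorithm is safe, and whatever it returns after `m` calls satisfies `Q`. -/
def Alg.Wp : Alg α → (List α → ℕ → Prop) → Prop
  | .halt X, Q => Q X 0
  | .stuck, _ => False
  | .call A B C k, Q => C.Sublist A ∧ C.Sublist B ∧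
      ∀ R, IsMCSContaining A B C R → (k R).Wp (fun X m => Q X (m + 1))

theorem Alg.Wp.safe {x : Alg α} {Q : List α → ℕ → Prop} (h : x.Wp Q) : x.Safe := by
  induction x generalizing Q with
  | halt X => trivial
  | stuck => exact h
  | call A B C k ih => exact ⟨h.1, h.2.1, fun R hR => ih R (h.2.2 R hR)⟩

theorem Alg.Wp.of_returns {x : Alg α} {Q : List α → ℕ → Prop} (h : x.Wp Q) {X : List α} {m : ℕ}
    (hX : x.Returns X m) : Q X m := by
  induction x generalizing Q m with
  | halt Y =>
    obtain ⟨rfl, rfl⟩ := hX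
    exact h
  | stuck => exact h.elim
  | call A B C k ih =>
    obtain ⟨R, m', hR, hX, rfl⟩ := hX
    exact ih R (h.2.2 R hR) hX

theorem Alg.Safe.exists_returns {x : Alg α} (h : x.Safe) : ∃ X m, x.Returns X m := by
  induction x with
  | halt X => exact ⟨X, 0, rfl, rfl⟩
  | stuck => exact h.elim
  | call A B C k ih =>
    obtain ⟨R, hR⟩ := exists_isMCSContaining h.1 h.2.1
    obtain ⟨X, m, hX⟩ := ih R (h.2.2 R hR)
    exact ⟨X, m + 1, R, m, hR, hX, rfl⟩

theorem Alg.Wp.mono {x : Alg α} {Q Q' : List α → ℕ → Prop} (h : x.Wp Q)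
    (hQ : ∀ X m, Q X m → Q' X m) : x.Wp Q' := by
  induction x generalizing Q Q' with
  | halt X => exact hQ _ _ h
  | stuck => exact h
  | call A B C k ih =>
    exact ⟨h.1, h.2.1, fun R hR => ih R (h.2.2 R hR) (fun X m => hQ X (m + 1))⟩

theorem Alg.Wp.bind {x : Alg α} {f : List α → Alg α} {Q : List α → ℕ → Prop}
    (h : x.Wp (fun X m => (f X).Wp (fun Z m' => Q Z (m + m')))) : (x.bind f).Wp Q := by
  induction x generalizing Q with
  | halt X => simpa [Alg.Wp, Alg.bind] using h
  | stuck => exact h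
  | call A B C k ih =>
    refine ⟨h.1, h.2.1, fun R hR => ih R ((h.2.2 R hR).mono ?_)⟩
    intro X m hX
    exact hX.mono (fun Z m' hZ => by rwa [show m + m' + 1 = m + 1 + m' by omega])

theorem Alg.Returns.bind {x : Alg α} {f : List α → Alg α} {X Z : List α} {m m' : ℕ}
    (h : x.Returns X m) (h' : (f X).Returns Z m') : (x.bind f).Returns Z (m + m') := by
  induction x generalizing m with
  | halt Y =>
    obtain ⟨rfl, rfl⟩ := h
    simpa [Alg.bind] using h'
  | stuck => exact h.elim
  | call A B C k ih =>
    obtain ⟨R, m₁, hR, hX, rfl⟩ := h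
    exact ⟨R, m₁ + m', hR, ih R hX, by omega⟩

/-- A maximal common subsequence of two strings that start with `σ` starts with `σ`. -/
theorem IsMCSContaining.exists_cons {A B C R : List α} {c : α}
    (h : IsMCSContaining (c :: A) (c :: B) C R) : ∃ R', R = c :: R' := by
  obtain ⟨hA, hB, -, hmax⟩ := h
  rcases List.sublist_cons_iff.1 hA with h₁ | ⟨r, rfl, -⟩
  · rcases List.sublist_cons_iff.1 hB with h₂ | ⟨r, rfl, -⟩
    · have := hmax (c :: R) (h₁.cons_cons c) (h₂.cons_cons c) (List.sublist_cons_self c R)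
      simpa using congrArg List.length this
    · exact ⟨r, rfl⟩
  · exact ⟨r, rfl⟩

end Runs

/-! ### Correctness of the two algorithms -/

section Correctness

variable {α : Type*} [DecidableEq α]

/-- The 0-based positions that the algorithms look up: the occurrences of `σ` with (0-based)
numbers `0`, `1` and `e = ⌊ℓ / 2⌋`, and, if `ℓ` is odd, `e + 1`. -/
structure Marks (S : List α) (σ : α) (q₁ q₂ qa qb : ℕ) : Prop where
  two_le : 2 ≤ S.count σ
  first : IsOcc S σ 0 q₁
  second : IsOcc S σ 1 q₂
  middle : IsOcc S σ (S.count σ / 2) qa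
  next : Odd (S.count σ) → IsOcc S σ (S.count σ / 2 + 1) qb

/-- `Y` can be the string for which the first algorithm returns `Y Y`. -/
def FirstResult (S : List α) (σ : α) (q₁ qa qb : ℕ) (Y : List α) : Prop :=
  ∃ Y₀, IsMCSContaining (seg S q₁ qa) (seg S qa S.length)
      (List.replicate (S.count σ / 2) σ) Y₀ ∧
    if Odd (S.count σ) ∧ Y₀.Sublist (seg S qb S.length) then
      IsMCSContaining (seg S q₁ qb) (seg S qb S.length) Y₀ Y
    else Y = Y₀

/-- `Z` can be the string for which the second algorithm returns `Z Z`, given `Y Y` and the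
leftmost anchors `j₁`, `j₂` of `Y`. -/
def SecondResult (S : List α) (σ : α) (j₁ j₂ : ℕ) (Y Z : List α) : Prop :=
  ∃ Z₀, IsMCSContaining (seg S 0 j₁) (seg S j₁ S.length) Y Z₀ ∧
    if Odd (S.count σ) ∧ Z₀.Sublist (seg S j₂ S.length) then
      IsMCSContaining (seg S 0 j₂) (seg S j₂ S.length) Z₀ Z
    else Z = Z₀

variable {S : List α} {σ : α} {q₁ q₂ qa qb : ℕ}

theorem exists_marks (h : 2 ≤ S.count σ) : ∃ q₁ q₂ qa qb, Marks S σ q₁ q₂ qa qb := by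
  obtain ⟨q₁, h₁⟩ := exists_isOcc (S := S) (c := σ) (k := 0) (by omega)
  obtain ⟨q₂, h₂⟩ := exists_isOcc (S := S) (c := σ) (k := 1) (by omega)
  obtain ⟨qa, ha⟩ := exists_isOcc (S := S) (c := σ) (k := S.count σ / 2) (by omega)
  by_cases hodd : Odd (S.count σ)
  · obtain ⟨qb, hb⟩ := exists_isOcc (S := S) (c := σ) (k := S.count σ / 2 + 1)
      (by obtain ⟨k, hk⟩ := hodd; omega)
    exact ⟨q₁, q₂, qa, qb, h, h₁, h₂, ha, fun _ => hb⟩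
  -- For even ℓ the last mark is never looked up, so its value 0 is a dummy.
  · exact ⟨q₁, q₂, qa, 0, h, h₁, h₂, ha, fun hb => absurd hb hodd⟩

theorem Marks.q₁_lt_qa (h : Marks S σ q₁ q₂ qa qb) : q₁ < qa :=
  h.first.lt_of_lt h.middle (by have := h.two_le; omega)

theorem Marks.q₂_le_qa (h : Marks S σ q₁ q₂ qa qb) : q₂ ≤ qa := by
  rcases Nat.lt_or_ge 1 (S.count σ / 2) with h₁ | h₁
  · exact (h.second.lt_of_lt h.middle h₁).le
  · have h₂ : S.count σ / 2 = 1 := by have := h.two_le; omega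
    have := h.middle
    rw [h₂] at this
    exact (h.second.unique this).le

theorem Marks.q₁_lt_q₂ (h : Marks S σ q₁ q₂ qa qb) : q₁ < q₂ :=
  h.first.lt_of_lt h.second one_pos

theorem Marks.qa_lt_qb (h : Marks S σ q₁ q₂ qa qb) (ho : Odd (S.count σ)) : qa < qb :=
  h.middle.lt_of_lt (h.next ho) (Nat.lt_succ_self _)

theorem Marks.replicate_sublist_left (h : Marks S σ q₁ q₂ qa qb) :
    (List.replicate (S.count σ / 2) σ).Sublist (seg S q₁ qa) := by
  rw [List.replicate_sublist_iff]
  have := count_take_add_count_seg S σ h.q₁_lt_qa.le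
  rw [h.first.2, h.middle.2] at this
  omega

theorem Marks.replicate_sublist_right (h : Marks S σ q₁ q₂ qa qb) :
    (List.replicate (S.count σ / 2) σ).Sublist (seg S qa S.length) := by
  rw [List.replicate_sublist_iff]
  have := count_take_add_count_seg S σ h.middle.lt_length.le
  rw [h.middle.2, List.take_length] at this
  omega

theorem FirstResult.replicate_sublist {Y : List α} (hY : FirstResult S σ q₁ qa qb Y) :
    (List.replicate (S.count σ / 2) σ).Sublist Y := by
  obtain ⟨Y₀, h₀, h⟩ := hY
  split_ifs at h
  · exact h₀.2.2.1.trans h.2.2.1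
  · rw [h]
    exact h₀.2.2.1

/-- Here it matters that Algorithm 1 starts and cuts at occurrences of `σ`: both strings of every
call begin with `σ`. -/
theorem FirstResult.exists_cons (hm : Marks S σ q₁ q₂ qa qb) {Y : List α}
    (hY : FirstResult S σ q₁ qa qb Y) : ∃ Y', Y = σ :: Y' := by
  obtain ⟨Y₀, h₀, h⟩ := hY
  split_ifs at h with hc
  · have hlt := hm.qa_lt_qb hc.1
    rw [seg_cons hm.first.1 (hm.q₁_lt_qa.trans hlt),
      seg_cons (hm.next hc.1).1 (hm.next hc.1).lt_length] at h
    exact h.exists_cons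
  · rw [seg_cons hm.first.1 hm.q₁_lt_qa, seg_cons hm.middle.1 hm.middle.lt_length] at h₀
    rw [h]
    exact h₀.exists_cons

theorem FirstResult.exists_split (hm : Marks S σ q₁ q₂ qa qb) {Y : List α}
    (hY : FirstResult S σ q₁ qa qb Y) :
    ∃ h, qa ≤ h ∧ Y.Sublist (seg S q₁ h) ∧ Y.Sublist (seg S h S.length) := by
  obtain ⟨Y₀, h₀, h⟩ := hY
  split_ifs at h with hc
  · exact ⟨qb, (hm.qa_lt_qb hc.1).le, h.1, h.2.1⟩
  · rw [h]
    exact ⟨qa, le_rfl, h₀.1, h₀.2.1⟩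

/-- How a square `W W` with `e` letters `σ` in `W` can be embedded in `S`. -/
theorem Marks.exists_embedding (hm : Marks S σ q₁ q₂ qa qb) {u v : List α} (hu : σ ∉ u)
    (hW : ((u ++ σ :: v) ++ (u ++ σ :: v)).Sublist S)
    (hc : S.count σ / 2 ≤ (u ++ σ :: v).count σ) :
    ∃ z z' h, (z = q₁ ∧ z' = qa ∨ Odd (S.count σ) ∧ (z = q₁ ∧ z' = qb ∨ z = q₂ ∧ z' = qb)) ∧
      h ≤ z' ∧ u.Sublist (seg S 0 z) ∧ (σ :: v).Sublist (seg S z h) ∧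
      (σ :: v).Sublist (seg S z' S.length) ∧ (u ++ σ :: v).Sublist (seg S h S.length) := by
  have hfirst : ∀ {a b : ℕ}, (u ++ σ :: v).Sublist (seg S a b) → b ≤ S.length →
      ∃ z, a ≤ z ∧ z ≤ b ∧ S[z]? = some σ ∧ u.Sublist (seg S a z) ∧
        (σ :: v).Sublist (seg S z b) := by
    intro a b hs hb
    obtain ⟨l₁, l₂, he, h₁, h₂⟩ := List.append_sublist_iff.1 hs
    have hab : a < b := by
      by_contra hle
      rw [seg_eq_nil (not_lt.1 hle)] at hs
      simpa using hs.length_le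
    have hl : l₁ = seg S a (a + l₁.length) ∧ l₂ = seg S (a + l₁.length) b ∧
        a + l₁.length ≤ b := by
      have hlen : (seg S a b).length = b - a := by
        simp only [seg, List.length_drop, List.length_take]
        omega
      have hle : a + l₁.length ≤ b := by
        rw [he, List.length_append] at hlen
        omega
      have hlen' : (seg S a (a + l₁.length)).length = l₁.length := by
        simp only [seg, List.length_drop, List.length_take]
        omega
      have := seg_append S (Nat.le_add_right a l₁.length) hle
      rw [he] at this
      obtain ⟨h₃, h₄⟩ := List.append_inj this hlen'
      exact ⟨h₃.symm, h₄.symm, hle⟩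
    rw [hl.1] at h₁
    rw [hl.2.1] at h₂
    classical
    obtain ⟨y, hy₁, hy₂, hy₃⟩ := mem_seg.1 (h₂.subset List.mem_cons_self)
    -- `z` is the first `σ` behind the part used for `u`. That part may contain occurrences of `σ`
    -- although `u` does not; this is why z = q₂ can happen.
    have hex : ∃ z, a + l₁.length ≤ z ∧ S[z]? = some σ := ⟨y, hy₁, hy₃⟩
    have hz : NextOcc S σ (a + l₁.length) (Nat.find hex) := by
      refine ⟨(Nat.find_spec hex).1, (Nat.find_spec hex).2, fun hmem => ?_⟩
      obtain ⟨x, hx₁, hx₂, hx₃⟩ := mem_seg.1 hmem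
      exact Nat.find_min hex hx₂ ⟨hx₁, hx₃⟩
    obtain ⟨h₃, h₄⟩ := hz.of_cons_sublist h₂
    refine ⟨Nat.find hex, by have := hz.1; omega, h₃.le, hz.2.1,
      h₁.trans (seg_mono S le_rfl hz.1), ?_⟩
    rw [seg_cons hz.2.1 h₃]
    exact h₄.cons_cons σ
  obtain ⟨l₁, l₂, he, h₁, h₂⟩ := List.append_sublist_iff.1 hW
  have hl₁ : l₁ = seg S 0 l₁.length := by rw [seg_zero, he, List.take_left]
  have hl₂ : l₂ = seg S l₁.length S.length := by
    rw [seg, List.take_length]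
    conv_rhs => rw [he]
    rw [List.drop_left]
  have hh : l₁.length ≤ S.length := by rw [he]; simp
  set h := l₁.length
  rw [hl₁] at h₁
  rw [hl₂] at h₂
  obtain ⟨z, -, hzh, hz, hu₁, hv₁⟩ := hfirst h₁ hh
  obtain ⟨z', hzh', hzn', hz', -, hv₂⟩ := hfirst h₂ le_rfl
  refine ⟨z, z', h, ?_, hzh', hu₁, hv₁, hv₂, h₂⟩
  have hc' : S.count σ / 2 ≤ (σ :: v).count σ := by
    rwa [List.count_append, List.count_eq_zero_of_not_mem hu, Nat.zero_add] at hc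
  have e₁ := count_take_add_count_seg S σ hzh
  have e₂ := count_take_add_count_seg S σ hzn'
  have e₃ := count_take_mono S σ hzh'
  have c₁ := hv₁.count_le σ
  have c₂ := hv₂.count_le σ
  rw [List.take_length] at e₂
  have two := hm.two_le
  have o : IsOcc S σ _ z := ⟨hz, rfl⟩
  have o' : IsOcc S σ _ z' := ⟨hz', rfl⟩
  generalize hr : (S.take z).count σ = r at *
  generalize hr' : (S.take z').count σ = r' at *
  -- With e = ⌊ℓ/2⌋, the copy of σv between `z` and `h ≤ z'` gives r + e ≤ r', and the copy from
  -- `z'` on gives r' + e ≤ ℓ ≤ 2e + 1.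
  have cases : r = 0 ∧ r' = S.count σ / 2 ∨ Odd (S.count σ) ∧
      (r = 0 ∧ r' = S.count σ / 2 + 1 ∨ r = 1 ∧ r' = S.count σ / 2 + 1) := by
    rw [Nat.odd_iff]
    omega
  rcases cases with ⟨rfl, rfl⟩ | ⟨hodd, ⟨rfl, rfl⟩ | ⟨rfl, rfl⟩⟩
  · exact Or.inl ⟨o.unique hm.first, o'.unique hm.middle⟩
  · exact Or.inr ⟨hodd, Or.inl ⟨o.unique hm.first, o'.unique (hm.next hodd)⟩⟩
  · exact Or.inr ⟨hodd, Or.inr ⟨o.unique hm.second, o'.unique (hm.next hodd)⟩⟩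

/-- As q₁ ≤ z and h ≤ z', `V` is a common subsequence for the cut at z'. For z' = qa the first call
forces V = Y₀, and Y₀ ⊆ Y ⊆ V closes the case. For z' = qb either the second call was made and
forces V = Y, or it was skipped because Y₀ does not fit behind qb, and then V ⊇ Y₀ cannot fit there
either. -/
theorem FirstResult.eq_of_embedding (hm : Marks S σ q₁ q₂ qa qb) {Y V : List α}
    (hY : FirstResult S σ q₁ qa qb Y) {z z' h : ℕ}
    (hz : z = q₁ ∧ z' = qa ∨ Odd (S.count σ) ∧ (z = q₁ ∧ z' = qb ∨ z = q₂ ∧ z' = qb))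
    (hh : h ≤ z') (h₁ : V.Sublist (seg S z h)) (h₂ : V.Sublist (seg S z' S.length))
    (hs : Y.Sublist V) : V = Y := by
  obtain ⟨Y₀, h₀, hY⟩ := hY
  have h₁' : V.Sublist (seg S q₁ z') := by
    refine h₁.trans (seg_mono S ?_ hh)
    have := hm.q₁_lt_q₂
    rcases hz with ⟨rfl, -⟩ | ⟨-, ⟨rfl, -⟩ | ⟨rfl, -⟩⟩ <;> omega
  have hz' : z' = qa ∨ Odd (S.count σ) ∧ z' = qb := by tauto
  split_ifs at hY with hc
  · rcases hz' with rfl | ⟨-, rfl⟩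
    · have e := h₀.2.2.2 V h₁' h₂ (hY.2.2.1.trans hs)
      rw [e] at hs ⊢
      exact hY.2.2.1.antisymm hs
    · exact hY.2.2.2 V h₁' h₂ hs
  · subst hY
    rcases hz' with rfl | ⟨ho, rfl⟩
    · exact h₀.2.2.2 V h₁' h₂ hs
    · exact absurd ⟨ho, hs.trans h₂⟩ hc

theorem SecondResult.sublist {j₁ j₂ : ℕ} {Y Z : List α} (hZ : SecondResult S σ j₁ j₂ Y Z) :
    Y.Sublist Z ∧ (Z ++ Z).Sublist S := by
  have key : ∀ {j : ℕ} {Z : List α}, Z.Sublist (seg S 0 j) → Z.Sublist (seg S j S.length) →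
      (Z ++ Z).Sublist S := by
    intro j Z h₁ h₂
    have h := h₁.append h₂
    rwa [seg_zero, seg, List.take_length, List.take_append_drop] at h
  obtain ⟨Z₀, h₀, h⟩ := hZ
  split_ifs at h
  · exact ⟨h₀.2.2.1.trans h.2.2.1, key h.1 h.2.1⟩
  · rw [h]
    exact ⟨h₀.2.2.1, key h₀.1 h₀.2.1⟩

theorem SecondResult.isMaximalSquareSubseq (hm : Marks S σ q₁ q₂ qa qb) {Y Z : List α}
    (hY : FirstResult S σ q₁ qa qb Y) {j₁ j₂ : ℕ} (hj₁ : IsAnchor S q₁ Y j₁)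
    (hj₂ : Odd (S.count σ) → IsAnchor S q₂ Y j₂) (hZ : SecondResult S σ j₁ j₂ Y Z) :
    IsMaximalSquareSubseq S (Z ++ Z) := by
  refine isMaximalSquareSubseq_of_forall hZ.sublist.2 ?_
  intro W hW hZW
  have hYW := hZ.sublist.1.trans hZW
  have hcount : S.count σ / 2 ≤ W.count σ :=
    List.replicate_sublist_iff.1 (hY.replicate_sublist.trans hYW)
  have hmem : σ ∈ W := List.count_pos_iff.1 (by have := hm.two_le; omega)
  obtain ⟨u, v, rfl, hu⟩ := List.eq_append_cons_of_mem hmem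
  obtain ⟨z, z', h, hz, hh, h₁, h₂, h₃, h₄⟩ := hm.exists_embedding hu hW hcount
  -- `Y` starts with `σ`, which cannot be matched inside `u`.
  have hYv : Y.Sublist (σ :: v) := by
    obtain ⟨Y', rfl⟩ := hY.exists_cons hm
    exact cons_sublist_of_not_mem hu hYW
  have hV := hY.eq_of_embedding hm hz hh h₂ h₃ hYv
  have hfit : ∀ {q j}, z = q → IsAnchor S q Y j → (u ++ σ :: v).Sublist (seg S 0 j) ∧
      (u ++ σ :: v).Sublist (seg S j S.length) := by
    rintro q j rfl hj
    -- Now σv = Y, so `h` is a competitor for the anchor. Moving the cut from `h` down to `j` keeps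
    -- the first copy uY, since `Y` still fits before `j`, and only enlarges the room for the
    -- second.
    have hjh : j ≤ h := hj.2 h (hV ▸ h₂)
    refine ⟨?_, h₄.trans (seg_mono S hjh le_rfl)⟩
    have hzj : z ≤ j := by
      by_contra hlt
      have := hj.1
      rw [seg_eq_nil (not_le.1 hlt).le, ← hV] at this
      simpa using this.length_le
    rw [← seg_append S (Nat.zero_le z) hzj, hV]
    exact h₁.append hj.1
  obtain ⟨Z₀, h₀, hZ⟩ := hZ
  have hz' : z = q₁ ∨ Odd (S.count σ) ∧ z = q₂ := by tauto
  split_ifs at hZ with hc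
  · rcases hz' with hz | ⟨ho, hz⟩
    · obtain ⟨f₁, f₂⟩ := hfit hz hj₁
      have e := h₀.2.2.2 _ f₁ f₂ (hZ.2.2.1.trans hZW)
      rw [e] at hZW ⊢
      exact hZ.2.2.1.antisymm hZW
    · obtain ⟨f₁, f₂⟩ := hfit hz (hj₂ ho)
      exact hZ.2.2.2 _ f₁ f₂ hZW
  · subst hZ
    rcases hz' with hz | ⟨ho, hz⟩
    · obtain ⟨f₁, f₂⟩ := hfit hz hj₁
      exact h₀.2.2.2 _ f₁ f₂ hZW
    · obtain ⟨f₁, f₂⟩ := hfit hz (hj₂ ho)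
      exact absurd ⟨ho, hZW.trans f₂⟩ hc

/-- All calls of the second algorithm are legitimate. -/
theorem FirstResult.calls (hm : Marks S σ q₁ q₂ qa qb) {Y : List α}
    (hY : FirstResult S σ q₁ qa qb Y) :
    ∃ j₁ j₂, IsAnchor S q₁ Y j₁ ∧ IsAnchor S q₂ Y j₂ ∧ j₁ ≤ j₂ ∧
      Y.Sublist (seg S 0 j₁) ∧ Y.Sublist (seg S j₁ S.length) := by
  obtain ⟨h, hqa, h₁, h₂⟩ := hY.exists_split hm
  obtain ⟨j₁, hj₁⟩ := exists_isAnchor h₁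
  -- The copy of `Y` behind the cut lies behind q₂ ≤ qa ≤ h, so the second anchor exists for both
  -- parities.
  obtain ⟨j₂, hj₂⟩ := exists_isAnchor (h₂.trans (seg_mono S (hm.q₂_le_qa.trans hqa) le_rfl))
  exact ⟨j₁, j₂, hj₁, hj₂, hj₁.2 _ (hj₂.1.trans (seg_mono S hm.q₁_lt_q₂.le le_rfl)),
    hj₁.1.trans (seg_mono S (Nat.zero_le _) le_rfl),
    h₂.trans (seg_mono S (hj₁.2 _ h₁) le_rfl)⟩

theorem alg1_eq (hm : Marks S σ q₁ q₂ qa qb) : alg1 S σ =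
    .call (seg S q₁ qa) (seg S qa S.length) (List.replicate (S.count σ / 2) σ) fun Y =>
      if Odd (S.count σ) ∧ Y.Sublist (seg S qb S.length) then
        .call (seg S q₁ qb) (seg S qb S.length) Y fun Y' => .halt (Y' ++ Y')
      else .halt (Y ++ Y) := by
  have h₁ := occPos_eq_some hm.first
  have h₂ := occPos_eq_some hm.middle
  unfold alg1
  simp only [Nat.zero_add] at h₁
  simp only [h₁, h₂, Alg.lookup]
  by_cases ho : Odd (S.count σ)
  · simp only [ho, if_true, true_and, occPos_eq_some (hm.next ho)]
    rfl
  · simp only [ho, if_false, false_and]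
    rfl

theorem alg2_eq (hm : Marks S σ q₁ q₂ qa qb) {Y : List α} {j₁ j₂ : ℕ}
    (hj₁ : IsAnchor S q₁ Y j₁) (hj₂ : Odd (S.count σ) → IsAnchor S q₂ Y j₂) :
    alg2 S σ (Y ++ Y) = .call (seg S 0 j₁) (seg S j₁ S.length) Y fun Z =>
      if Odd (S.count σ) ∧ Z.Sublist (seg S j₂ S.length) then
        .call (seg S 0 j₂) (seg S j₂ S.length) Z fun Z' => .halt (Z' ++ Z')
      else .halt (Z ++ Z) := by
  have h₁ := occPos_eq_some hm.first
  have h₂ := occPos_eq_some hm.second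
  have hY : (Y ++ Y).take ((Y ++ Y).length / 2) = Y := by
    rw [List.length_append, show (Y.length + Y.length) / 2 = Y.length by omega, List.take_left]
  unfold alg2
  simp only [Nat.zero_add] at h₁
  simp only [h₁, hY, Alg.lookup, anchor_eq_some hj₁]
  by_cases ho : Odd (S.count σ)
  · simp only [ho, if_true, true_and, h₂, anchor_eq_some (hj₂ ho)]
    rfl
  · simp only [ho, if_false, false_and]
    rfl

theorem wp_alg1 (hm : Marks S σ q₁ q₂ qa qb) : (alg1 S σ).Wp (fun X m =>
    m ≤ 2 ∧ ∃ Y, X = Y ++ Y ∧ FirstResult S σ q₁ qa qb Y) := by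
  rw [alg1_eq hm]
  refine ⟨hm.replicate_sublist_left, hm.replicate_sublist_right, fun Y hY => ?_⟩
  beta_reduce
  split_ifs with hc
  · refine ⟨hY.1.trans (seg_mono S le_rfl (hm.qa_lt_qb hc.1).le), hc.2, fun Y' hY' => ?_⟩
    refine ⟨by omega, Y', rfl, Y, hY, ?_⟩
    rwa [if_pos hc]
  · refine ⟨by omega, Y, rfl, Y, hY, ?_⟩
    rw [if_neg hc]

theorem wp_alg2 (hm : Marks S σ q₁ q₂ qa qb) {Y : List α} (hY : FirstResult S σ q₁ qa qb Y) :
    (alg2 S σ (Y ++ Y)).Wp (fun X m => m ≤ 2 ∧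
      (List.replicate (2 * (S.count σ / 2)) σ).Sublist X ∧ IsMaximalSquareSubseq S X) := by
  obtain ⟨j₁, j₂, hj₁, hj₂, hle, h₁, h₂⟩ := hY.calls hm
  have final : ∀ {Z}, SecondResult S σ j₁ j₂ Y Z →
      (List.replicate (2 * (S.count σ / 2)) σ).Sublist (Z ++ Z) ∧
        IsMaximalSquareSubseq S (Z ++ Z) := by
    intro Z hZ
    refine ⟨?_, hZ.isMaximalSquareSubseq hm hY hj₁ fun _ => hj₂⟩
    have := hY.replicate_sublist.trans hZ.sublist.1
    rw [two_mul, List.replicate_add]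
    exact this.append this
  rw [alg2_eq hm hj₁ fun _ => hj₂]
  refine ⟨h₁, h₂, fun Z hZ => ?_⟩
  beta_reduce
  split_ifs with hc
  · refine ⟨hZ.1.trans (seg_mono S le_rfl hle), hc.2, fun Z' hZ' => ⟨by omega, final ?_⟩⟩
    exact ⟨Z, hZ, by rwa [if_pos hc]⟩
  · exact ⟨by omega, final ⟨Z, hZ, by rw [if_neg hc]⟩⟩

theorem wp_maximalSquareAlg (h : 2 ≤ S.count σ) : (maximalSquareAlg S σ).Wp (fun X m => m ≤ 4 ∧
    (List.replicate (2 * (S.count σ / 2)) σ).Sublist X ∧ IsMaximalSquareSubseq S X) := by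
  obtain ⟨q₁, q₂, qa, qb, hm⟩ := exists_marks h
  refine Alg.Wp.bind ((wp_alg1 hm).mono ?_)
  rintro _ m ⟨hle, Y, rfl, hY⟩
  refine (wp_alg2 hm hY).mono ?_
  rintro Z m' ⟨hle', hZ⟩
  exact ⟨by omega, hZ⟩

/-- The converse direction, needed for the machine: what the program computes is described by
`FirstResult` and `SecondResult`, and such data always come from an actual run. -/
theorem exists_returns_of_results (hm : Marks S σ q₁ q₂ qa qb) {Y Z : List α}
    (hY : FirstResult S σ q₁ qa qb Y) {j₁ j₂ : ℕ} (hj₁ : IsAnchor S q₁ Y j₁)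
    (hj₂ : Odd (S.count σ) → IsAnchor S q₂ Y j₂) (hZ : SecondResult S σ j₁ j₂ Y Z) :
    ∃ m, (maximalSquareAlg S σ).Returns (Z ++ Z) m := by
  have h₁ : ∃ m, (alg1 S σ).Returns (Y ++ Y) m := by
    obtain ⟨Y₀, h₀, h⟩ := hY
    rw [alg1_eq hm]
    split_ifs at h with hc
    · exact ⟨_, Y₀, _, h₀, by simp only [if_pos hc]; exact ⟨Y, 0, h, ⟨rfl, rfl⟩, rfl⟩, rfl⟩
    · subst h
      exact ⟨_, Y, _, h₀, by simp only [if_neg hc]; exact ⟨rfl, rfl⟩, rfl⟩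
  have h₂ : ∃ m, (alg2 S σ (Y ++ Y)).Returns (Z ++ Z) m := by
    obtain ⟨Z₀, h₀, h⟩ := hZ
    rw [alg2_eq hm hj₁ hj₂]
    split_ifs at h with hc
    · exact ⟨_, Z₀, _, h₀, by simp only [if_pos hc]; exact ⟨Z, 0, h, ⟨rfl, rfl⟩, rfl⟩, rfl⟩
    · subst h
      exact ⟨_, Z, _, h₀, by simp only [if_neg hc]; exact ⟨rfl, rfl⟩, rfl⟩
  obtain ⟨m₁, h₁⟩ := h₁
  obtain ⟨m₂, h₂⟩ := h₂
  exact ⟨m₁ + m₂, h₁.bind h₂⟩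

end Correctness

/-! ### The two-sided greedy method for maximal common subsequences -/

section GreedyEmbeddings

variable {α : Type*}

/-- The leftmost embedding of `P` into `S[f, …)` ends at `a`. -/
structure LeftEnd (S : List α) (f : ℕ) (P : List α) (a : ℕ) : Prop where
  le : f ≤ a
  sublist : P.Sublist (seg S f a)
  of_append : ∀ Q e, (P ++ Q).Sublist (seg S f e) → Q.Sublist (seg S a e)

theorem LeftEnd.nil (S : List α) (f : ℕ) : LeftEnd S f [] f :=
  ⟨le_rfl, List.nil_sublist _, fun _ _ h => h⟩

theorem LeftEnd.snoc {S : List α} {f a y : ℕ} {P : List α} {c : α} (h : LeftEnd S f P a)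
    (hy : NextOcc S c a y) : LeftEnd S f (P ++ [c]) (y + 1) := by
  refine ⟨h.le.trans (hy.1.trans (Nat.le_succ y)), ?_, fun Q e hQ => ?_⟩
  · rw [seg_succ hy.2.1 (h.le.trans hy.1)]
    exact (h.sublist.trans (seg_mono S le_rfl hy.1)).append (List.Sublist.refl _)
  · rw [List.append_assoc] at hQ
    exact (hy.of_cons_sublist (h.of_append _ e hQ)).2

/-- The rightmost embedding of `R` into `S[…, hi)`: the letter that is followed by `k` others
is at position `f (k + 1)`. -/
def RightStack (S : List α) (hi : ℕ) (f : ℕ → ℕ) : List α → Prop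
  | [] => f 0 = hi
  | c :: R => RightStack S hi f R ∧ PrevOcc S c (f R.length) (f (R.length + 1))

/-- Only the entries up to the height of the stack matter; stale values above it, left behind by
earlier pops, are harmless. -/
theorem RightStack.congr {S : List α} {hi : ℕ} {f g : ℕ → ℕ} {R : List α}
    (h : RightStack S hi f R) (hfg : ∀ k ≤ R.length, g k = f k) : RightStack S hi g R := by
  induction R with
  | nil => exact (hfg 0 le_rfl).trans h
  | cons c R ih =>
    refine ⟨ih h.1 fun k hk => hfg k (hk.trans (Nat.le_succ _)), ?_⟩
    rw [hfg (R.length + 1) le_rfl, hfg _ (Nat.le_succ _)]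
    exact h.2

theorem RightStack.push {S : List α} {hi : ℕ} {f g : ℕ → ℕ} {R : List α} {c : α}
    (h : RightStack S hi f R) (hfg : ∀ k ≤ R.length, g k = f k)
    (hc : PrevOcc S c (f R.length) (g (R.length + 1))) : RightStack S hi g (c :: R) :=
  ⟨h.congr hfg, by rwa [hfg _ le_rfl]⟩

theorem RightStack.sublist {S : List α} {hi : ℕ} {f : ℕ → ℕ} {R : List α}
    (h : RightStack S hi f R) : f R.length ≤ hi ∧ R.Sublist (seg S (f R.length) hi) := by
  induction R with
  | nil => exact ⟨le_of_eq h, List.nil_sublist _⟩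
  | cons c R ih =>
    obtain ⟨h₁, h₂, h₃, -⟩ := h
    obtain ⟨h₄, h₅⟩ := ih h₁
    rw [List.length_cons]
    refine ⟨h₂.le.trans h₄, ?_⟩
    rw [seg_cons h₃ (h₂.trans_le h₄)]
    exact (h₅.trans (seg_mono S h₂ le_rfl)).cons_cons c

theorem RightStack.of_append {S : List α} {hi lo : ℕ} {f : ℕ → ℕ} {R Q : List α}
    (h : RightStack S hi f R) (hQ : (Q ++ R).Sublist (seg S lo hi)) :
    Q.Sublist (seg S lo (f R.length)) := by
  induction R generalizing Q with
  | nil => rwa [List.append_nil, ← (show f 0 = hi from h)] at hQ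
  | cons c R ih =>
    exact (h.2.of_append_sublist (ih h.1 (by simpa using hQ))).2

variable {S : List α} {lo mid hi : ℕ}

/-- No letter can be inserted between `P` and `R` in the common subsequence `P R` of `S[lo, mid)`
and `S[mid, hi)`. -/
def Blocked (S : List α) (lo mid hi : ℕ) (P R : List α) : Prop :=
  ∀ c, ¬ ((P ++ c :: R).Sublist (seg S lo mid) ∧ (P ++ c :: R).Sublist (seg S mid hi))

/-- The state of the computation of a maximal common subsequence of `S[lo, mid)` and `S[mid, hi)`:
no letter can be inserted into the prefix `P` of the common subsequence `P R`, whose leftmost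
embeddings end at `a` and `b`, `f` and `g` are the rightmost embeddings of the suffix `R`, and the
first `d` letters in each of the two gaps are known not to occur in the other gap. -/
structure MCSState (S : List α) (lo mid hi : ℕ) (C P R : List α) (f g : ℕ → ℕ)
    (a b d : ℕ) : Prop where
  left₁ : LeftEnd S lo P a
  left₂ : LeftEnd S mid P b
  right₁ : RightStack S mid f R
  right₂ : RightStack S hi g R
  le₁ : a + d ≤ f R.length
  le₂ : b + d ≤ g R.length
  scan₁ : ∀ i < d, ∀ c, S[a + i]? = some c → c ∉ seg S b (g R.length)
  scan₂ : ∀ i < d, ∀ c, S[b + i]? = some c → c ∉ seg S a (f R.length)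
  blocked : ∀ P₁ c P₂, P = P₁ ++ c :: P₂ → Blocked S lo mid hi P₁ (c :: P₂ ++ R)
  contains : C.Sublist (P ++ R)

variable {C P R : List α} {f g : ℕ → ℕ} {a b d : ℕ}

theorem MCSState.sublist₁ (h : MCSState S lo mid hi C P R f g a b d) :
    (P ++ R).Sublist (seg S lo mid) := by
  have h₁ := h.le₁
  obtain ⟨h₂, h₃⟩ := h.right₁.sublist
  rw [← seg_append S h.left₁.le (show a ≤ mid by omega)]
  exact h.left₁.sublist.append (h₃.trans (seg_mono S (by omega) le_rfl))

theorem MCSState.sublist₂ (h : MCSState S lo mid hi C P R f g a b d) :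
    (P ++ R).Sublist (seg S mid hi) := by
  have h₁ := h.le₂
  obtain ⟨h₂, h₃⟩ := h.right₂.sublist
  rw [← seg_append S h.left₂.le (show b ≤ hi by omega)]
  exact h.left₂.sublist.append (h₃.trans (seg_mono S (by omega) le_rfl))

/-- The scanned letters stay inside the shrunken gaps: if the new end of one gap lay among the first
`d` letters, a scanned letter, namely `c`, would occur in the other gap. A place inside `P` that is
blocked for `R` stays blocked for the longer suffix. -/
theorem MCSState.push {c : α} {f' g' : ℕ → ℕ} (h : MCSState S lo mid hi C P R f g a b d)
    (hf : ∀ k ≤ R.length, f' k = f k) (hg : ∀ k ≤ R.length, g' k = g k)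
    (hcf : PrevOcc S c (f R.length) (f' (R.length + 1)))
    (hcg : PrevOcc S c (g R.length) (g' (R.length + 1)))
    (ha : a ≤ f' (R.length + 1)) (hb : b ≤ g' (R.length + 1)) :
    MCSState S lo mid hi C P (c :: R) f' g' a b d where
  left₁ := h.left₁
  left₂ := h.left₂
  right₁ := h.right₁.push hf hcf
  right₂ := h.right₂.push hg hcg
  le₁ := by
    by_contra hlt
    rw [List.length_cons] at hlt
    refine h.scan₁ (f' (R.length + 1) - a) (by omega) c ?_
      (mem_seg.2 ⟨_, hb, hcg.1, hcg.2.1⟩)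
    rw [Nat.add_sub_cancel' ha, hcf.2.1]
  le₂ := by
    by_contra hlt
    rw [List.length_cons] at hlt
    refine h.scan₂ (g' (R.length + 1) - b) (by omega) c ?_
      (mem_seg.2 ⟨_, ha, hcf.1, hcf.2.1⟩)
    rw [Nat.add_sub_cancel' hb, hcg.2.1]
  scan₁ := fun i hi x hx hmem => h.scan₁ i hi x hx ((seg_mono S le_rfl hcg.1.le).subset hmem)
  scan₂ := fun i hi x hx hmem => h.scan₂ i hi x hx ((seg_mono S le_rfl hcf.1.le).subset hmem)
  blocked := by
    intro P₁ x P₂ hP y hy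
    have hs : (P₁ ++ y :: (x :: P₂ ++ R)).Sublist (P₁ ++ y :: (x :: P₂ ++ c :: R)) :=
      (List.Sublist.refl P₁).append
        (((List.Sublist.refl (x :: P₂)).append (List.sublist_cons_self c R)).cons_cons y)
    exact h.blocked P₁ x P₂ hP y ⟨hs.trans hy.1, hs.trans hy.2⟩
  contains := h.contains.trans ((List.Sublist.refl P).append (List.sublist_cons_self c R))

theorem MCSState.scan (h : MCSState S lo mid hi C P R f g a b d)
    (ha : a + d < f R.length) (hb : b + d < g R.length)
    (h₁ : ∀ c, S[a + d]? = some c → ¬ (c ∈ seg S a (f R.length) ∧ c ∈ seg S b (g R.length)))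
    (h₂ : ∀ c, S[b + d]? = some c → ¬ (c ∈ seg S a (f R.length) ∧ c ∈ seg S b (g R.length))) :
    MCSState S lo mid hi C P R f g a b (d + 1) :=
  { h with
    le₁ := ha
    le₂ := hb
    scan₁ := fun i hi c hc hmem => by
      rcases Nat.lt_succ_iff_lt_or_eq.1 hi with hi | rfl
      · exact h.scan₁ i hi c hc hmem
      · exact h₁ c hc ⟨mem_seg.2 ⟨_, Nat.le_add_right _ _, ha, hc⟩, hmem⟩
    scan₂ := fun i hi c hc hmem => by
      rcases Nat.lt_succ_iff_lt_or_eq.1 hi with hi | rfl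
      · exact h.scan₂ i hi c hc hmem
      · exact h₂ c hc ⟨hmem, mem_seg.2 ⟨_, Nat.le_add_right _ _, hb, hc⟩⟩ }

/-- It is enough that one of the gaps is exhausted: then each of its letters is known to be missing
from the other gap. -/
theorem MCSState.disjoint (h : MCSState S lo mid hi C P R f g a b d)
    (hd : f R.length ≤ a + d ∨ g R.length ≤ b + d) (c : α) :
    ¬ (c ∈ seg S a (f R.length) ∧ c ∈ seg S b (g R.length)) := by
  rintro ⟨h₁, h₂⟩
  obtain ⟨y, hy₁, hy₂, hy₃⟩ := mem_seg.1 h₁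
  obtain ⟨z, hz₁, hz₂, hz₃⟩ := mem_seg.1 h₂
  rcases hd with hd | hd
  · exact h.scan₁ (y - a) (by omega) c (by rwa [Nat.add_sub_cancel' hy₁]) h₂
  · exact h.scan₂ (z - b) (by omega) c (by rwa [Nat.add_sub_cancel' hz₁]) h₁

/-- The embeddings of `P` and `R` are extremal, so in any embedding of `P c R` the letter `c` can be
assumed to lie in the gap. Disjoint gaps therefore block the insertion. -/
theorem MCSState.blocked_gap (h : MCSState S lo mid hi C P R f g a b d)
    (hd : f R.length ≤ a + d ∨ g R.length ≤ b + d) : Blocked S lo mid hi P R := by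
  rintro c ⟨h₁, h₂⟩
  refine h.disjoint hd c ⟨?_, ?_⟩
  · exact List.singleton_sublist.1 (h.right₁.of_append (Q := [c]) (h.left₁.of_append _ _ h₁))
  · exact List.singleton_sublist.1 (h.right₂.of_append (Q := [c]) (h.left₂.of_append _ _ h₂))

theorem NextOcc.le_of_getElem? {c : α} {x y z : ℕ} (h : NextOcc S c x y)
    (hz : S[z]? = some c) (hx : x ≤ z) : y ≤ z := by
  by_contra hlt
  exact h.2.2 (mem_seg.2 ⟨z, hx, not_le.1 hlt, hz⟩)

/-- The last claim drives the amortization. The leftmost `c` cannot lie inside both gaps, as these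
share no letter; so in one string it is the top of the stack, at distance at least `d` from the old
end of `P`. The growth of the two prefix ends pays for the reset of `d` to 0. -/
theorem MCSState.advance {c : α} {ya yb : ℕ} (h : MCSState S lo mid hi C P (c :: R) f g a b d)
    (hd : f (R.length + 1) ≤ a + d ∨ g (R.length + 1) ≤ b + d)
    (ha : NextOcc S c a ya) (hb : NextOcc S c b yb) :
    MCSState S lo mid hi C (P ++ [c]) R f g (ya + 1) (yb + 1) 0 ∧
      a + b + d < (ya + 1) + (yb + 1) := by
  have hle₁ := h.le₁
  have hle₂ := h.le₂
  have hf := h.right₁.2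
  have hg := h.right₂.2
  rw [List.length_cons] at hle₁ hle₂
  have hya := ha.le_of_getElem? hf.2.1 (by omega)
  have hyb := hb.le_of_getElem? hg.2.1 (by omega)
  constructor
  · refine ⟨h.left₁.snoc ha, h.left₂.snoc hb, h.right₁.1, h.right₂.1, ?_, ?_,
      fun i hi => absurd hi (Nat.not_lt_zero i), fun i hi => absurd hi (Nat.not_lt_zero i), ?_, ?_⟩
    · have := hf.1
      omega
    · have := hg.1
      omega
    · intro P₁ x P₂ hP
      -- Directly before the new last letter `c` the insertion place is the gap just exhausted; all
      -- earlier places were blocked before.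
      rcases List.eq_nil_or_concat P₂ with rfl | ⟨P₂, y, rfl⟩
      · obtain ⟨rfl, hx⟩ := List.append_inj' hP rfl
        rw [List.cons.injEq] at hx
        rw [← hx.1]
        exact h.blocked_gap (by simpa using hd)
      · rw [List.concat_eq_append, ← List.cons_append, ← List.append_assoc] at hP
        obtain ⟨rfl, hx⟩ := List.append_inj' hP rfl
        rw [List.cons.injEq] at hx
        rw [← hx.1]
        simpa using h.blocked P₁ x P₂ rfl
    · simpa using h.contains
  · have hlt : ¬ (ya < f (R.length + 1) ∧ yb < g (R.length + 1)) := fun hlt =>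
      h.disjoint (by simpa using hd) c
        ⟨mem_seg.2 ⟨ya, ha.1, by simpa using hlt.1, ha.2.1⟩,
          mem_seg.2 ⟨yb, hb.1, by simpa using hlt.2, hb.2.1⟩⟩
    have := ha.1
    have := hb.1
    omega

/-- With an empty suffix, the places inside `P` are blocked by the invariant and the place behind
`P` by the exhausted gap; no other insertion is possible. -/
theorem MCSState.isMCSContaining (h : MCSState S lo mid hi C P [] f g a b d)
    (hd : f 0 ≤ a + d ∨ g 0 ≤ b + d) :
    IsMCSContaining (seg S lo mid) (seg S mid hi) C P := by
  refine ⟨by simpa using h.sublist₁, by simpa using h.sublist₂, by simpa using h.contains, ?_⟩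
  intro D h₁ h₂ hs
  by_contra hne
  obtain ⟨P₁, P₂, c, rfl, hc⟩ := exists_insert_of_sublist hs hne
  have hc' := And.intro (hc.trans h₁) (hc.trans h₂)
  rcases P₂ with _ | ⟨x, P₂⟩
  · exact (h.blocked_gap hd) c (by simpa using hc')
  · exact h.blocked P₁ x P₂ rfl c (by simpa using hc')

theorem MCSState.init (hf : RightStack S mid f C) (hg : RightStack S hi g C)
    (ha : lo ≤ f C.length) (hb : mid ≤ g C.length) :
    MCSState S lo mid hi C [] C f g lo mid 0 :=
  ⟨LeftEnd.nil S lo, LeftEnd.nil S mid, hf, hg, ha, hb,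
    fun i hi => absurd hi (Nat.not_lt_zero i), fun i hi => absurd hi (Nat.not_lt_zero i),
    fun P₁ c P₂ h => by simp at h, List.Sublist.refl C⟩

end GreedyEmbeddings

/-! ### Evaluating machine expressions by simplification -/

section Expressions

instance : Add RExpr := ⟨.op .add⟩
instance : Sub RExpr := ⟨.op .sub⟩
instance : Mul RExpr := ⟨.op .mul⟩
instance : Div RExpr := ⟨.op .div⟩

/-- `1` if `a < b`, and `0` otherwise. -/
def ltNat (a b : ℕ) : ℕ := if a < b then 1 else 0

theorem ltNat_eq_zero {a b : ℕ} : ltNat a b = 0 ↔ b ≤ a := by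
  simp [ltNat]

/-- As simplification rules, these turn the word-size conditions for comparisons into linear
arithmetic that `omega` can settle. -/
theorem ltNat_le {a b W : ℕ} : ltNat a b ≤ W ↔ (a < b → 1 ≤ W) := by
  unfold ltNat
  split_ifs <;> omega

theorem ltNat_mul_le {a b c d W : ℕ} :
    ltNat a b * ltNat c d ≤ W ↔ (a < b → c < d → 1 ≤ W) := by
  unfold ltNat
  split_ifs <;> omega

attribute [simp] ltNat_eq_zero ltNat_le ltNat_mul_le

/-- Comparison. -/
def RExpr.lt (u v : RExpr) : RExpr := .op .lt u v

variable (W : ℕ) (s : MState) (u v : RExpr) (c x a i y b j w : ℕ)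

@[simp] theorem RExpr.val_num : (RExpr.num c).val s = c := rfl
@[simp] theorem RExpr.val_reg : (RExpr.reg x).val s = s.reg x := rfl
@[simp] theorem RExpr.val_arr : (RExpr.arr a u).val s = s.arr a (u.val s) := rfl
@[simp] theorem RExpr.val_add : (u + v).val s = u.val s + v.val s := rfl
@[simp] theorem RExpr.val_sub : (u - v).val s = u.val s - v.val s := rfl
@[simp] theorem RExpr.val_mul : (u * v).val s = u.val s * v.val s := rfl
@[simp] theorem RExpr.val_div : (u / v).val s = u.val s / v.val s := rfl
@[simp] theorem RExpr.val_lt : (u.lt v).val s = ltNat (u.val s) (v.val s) := rfl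

@[simp] theorem RExpr.fits_num : (RExpr.num c).Fits W s ↔ c ≤ W := Iff.rfl
@[simp] theorem RExpr.fits_reg : (RExpr.reg x).Fits W s ↔ s.reg x ≤ W := Iff.rfl
@[simp] theorem RExpr.fits_arr :
    (RExpr.arr a u).Fits W s ↔ u.Fits W s ∧ s.arr a (u.val s) ≤ W := Iff.rfl
@[simp] theorem RExpr.fits_add :
    (u + v).Fits W s ↔ u.Fits W s ∧ v.Fits W s ∧ u.val s + v.val s ≤ W := Iff.rfl
@[simp] theorem RExpr.fits_sub :
    (u - v).Fits W s ↔ u.Fits W s ∧ v.Fits W s ∧ u.val s - v.val s ≤ W := Iff.rfl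
@[simp] theorem RExpr.fits_mul :
    (u * v).Fits W s ↔ u.Fits W s ∧ v.Fits W s ∧ u.val s * v.val s ≤ W := Iff.rfl
@[simp] theorem RExpr.fits_div :
    (u / v).Fits W s ↔ u.Fits W s ∧ v.Fits W s ∧ u.val s / v.val s ≤ W := Iff.rfl
@[simp] theorem RExpr.fits_lt :
    (u.lt v).Fits W s ↔
      u.Fits W s ∧ v.Fits W s ∧ ltNat (u.val s) (v.val s) ≤ W := Iff.rfl

@[simp] theorem RExpr.cost_num : (RExpr.num c).cost = 1 := rfl
@[simp] theorem RExpr.cost_reg : (RExpr.reg x).cost = 1 := rfl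
@[simp] theorem RExpr.cost_arr : (RExpr.arr a u).cost = u.cost + 1 := rfl
@[simp] theorem RExpr.cost_add : (u + v).cost = u.cost + v.cost + 1 := rfl
@[simp] theorem RExpr.cost_sub : (u - v).cost = u.cost + v.cost + 1 := rfl
@[simp] theorem RExpr.cost_mul : (u * v).cost = u.cost + v.cost + 1 := rfl
@[simp] theorem RExpr.cost_div : (u / v).cost = u.cost + v.cost + 1 := rfl
@[simp] theorem RExpr.cost_lt : (u.lt v).cost = u.cost + v.cost + 1 := rfl

@[simp] theorem MState.setReg_reg :
    (s.setReg x w).reg y = if y = x then w else s.reg y := by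
  simp [MState.setReg, Function.update_apply]
@[simp] theorem MState.setReg_arr : (s.setReg x w).arr = s.arr := rfl
@[simp] theorem MState.setArr_reg : (s.setArr a i w).reg = s.reg := rfl
@[simp] theorem MState.setArr_arr :
    (s.setArr a i w).arr b j = if b = a ∧ j = i then w else s.arr b j := by
  by_cases h : b = a
  · subst h
    simp [MState.setArr, Function.update_apply]
  · simp [MState.setArr, h]

end Expressions

/-! ### Total correctness rules with step counts -/

section Execution

/-- Started in the state `s`, the program `p` halts in a state `s'` after `t` steps
such that `Q s' t`. -/
def Run (W : ℕ) (p : RStmt) (s : MState) (Q : MState → ℕ → Prop) : Prop :=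
  ∃ s' t, Exec W p s s' t ∧ Q s' t

/-- Sequential composition of a list of programs. -/
def RStmt.block : List RStmt → RStmt
  | [] => .skip
  | p :: ps => .seq p (block ps)

variable {W : ℕ} {p q : RStmt} {ps : List RStmt} {s : MState} {Q Q' : MState → ℕ → Prop}

theorem Run.mono (h : Run W p s Q) (hQ : ∀ s' t, Q s' t → Q' s' t) : Run W p s Q' := by
  obtain ⟨s', t, he, hq⟩ := h
  exact ⟨s', t, he, hQ s' t hq⟩

theorem Run.skip (h : Q s 1) : Run W .skip s Q := ⟨s, 1, .skip s, h⟩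

theorem Run.assign {x : ℕ} {u : RExpr} (hu : u.Fits W s)
    (h : Q (s.setReg x (u.val s)) (u.cost + 1)) : Run W (.assign x u) s Q :=
  ⟨_, _, .assign x u s hu, h⟩

theorem Run.store {a : ℕ} {i u : RExpr} (hi : i.Fits W s) (hu : u.Fits W s)
    (h : Q (s.setArr a (i.val s) (u.val s)) (i.cost + u.cost + 1)) :
    Run W (.store a i u) s Q :=
  ⟨_, _, .store a i u s hi hu, h⟩

theorem Run.nil (h : Q s 1) : Run W (.block []) s Q := Run.skip h

theorem Run.cons (h : Run W p s fun s' t => Run W (.block ps) s' fun s'' t' => Q s'' (t + t' + 1)) :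
    Run W (.block (p :: ps)) s Q := by
  obtain ⟨s', t, he, s'', t', he', hq⟩ := h
  exact ⟨s'', _, .seq he he', hq⟩

theorem Run.ite {b : RExpr} (hb : b.Fits W s)
    (h₁ : b.val s ≠ 0 → Run W p s fun s' t => Q s' (b.cost + t + 1))
    (h₂ : b.val s = 0 → Run W q s fun s' t => Q s' (b.cost + t + 1)) :
    Run W (.ite b p q) s Q := by
  by_cases h : b.val s = 0
  · obtain ⟨s', t, he, hq⟩ := h₂ h
    exact ⟨s', _, .iteFalse hb h he, hq⟩
  · obtain ⟨s', t, he, hq⟩ := h₁ h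
    exact ⟨s', _, .iteTrue hb h he, hq⟩

/-- A loop with an invariant that mentions the number of steps that may still be made. -/
theorem Run.loop {b : RExpr} (I : MState → ℕ → Prop) {k : ℕ} (hI : I s k)
    (hb : ∀ s k, I s k → b.Fits W s)
    (hstep : ∀ s k, I s k → b.val s ≠ 0 →
      Run W p s fun s' t => ∃ k', I s' k' ∧ k' + t + b.cost + 1 ≤ k)
    (hend : ∀ s k, I s k → b.val s = 0 → b.cost + 1 ≤ k)
    (hQ : ∀ s' t k', I s' k' → b.val s' = 0 → t ≤ k → Q s' t) : Run W (.loop b p) s Q := by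
  suffices h : ∃ s' t, Exec W (.loop b p) s s' t ∧ b.val s' = 0 ∧ t ≤ k ∧ ∃ k', I s' k' by
    obtain ⟨s', t, he, h₀, hle, k', hk'⟩ := h
    exact ⟨s', t, he, hQ s' t k' hk' h₀ hle⟩
  clear hQ
  -- A round consumes at least one step, so the remaining budget `k` also serves as the termination
  -- measure.
  induction k using Nat.strong_induction_on generalizing s with
  | _ k ih =>
    by_cases h : b.val s = 0
    · exact ⟨s, _, .whileFalse (hb s k hI) h, h, hend s k hI h, k, hI⟩
    · obtain ⟨s₁, t₁, he₁, k₁, hk₁, hle₁⟩ := hstep s k hI h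
      obtain ⟨s₂, t₂, he₂, h₂, hle₂, hk₂⟩ := ih k₁ (by omega) hk₁
      exact ⟨s₂, _, .whileTrue (hb s k hI) h he₁ he₂, h₂, by omega, hk₂⟩

end Execution

/-! ### Next and previous occurrences by binary search -/

section Queries

/-- The string `S` of length `n` is in array `0`, the number of occurrences of each letter in
array `1`; array `3` has, for each letter `c` of `S`, a block with its positions, which starts at
the index in cell `c` of array `2`. -/
structure Indexed (W : ℕ) (S : List ℕ) (s : MState) : Prop where
  length : s.reg 0 = S.length
  bound : 4 * S.length + 10 ≤ W
  letters : ∀ c ∈ S, c ≤ W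
  str : ∀ i c, S[i]? = some c → s.arr 0 i = c
  count : ∀ c, s.arr 1 c = S.count c
  start : ∀ c ∈ S, s.arr 2 c + S.count c ≤ S.length
  occ : ∀ c k x, IsOcc S c k x → s.arr 3 (s.arr 2 c + k) = x

variable {W : ℕ} {S : List ℕ} {s s' : MState}

theorem Indexed.congr (h : Indexed W S s) (h₀ : s'.reg 0 = s.reg 0)
    (ha : ∀ a < 4, s'.arr a = s.arr a) : Indexed W S s' where
  length := h₀.trans h.length
  bound := h.bound
  letters := h.letters
  str := by rw [ha 0 (by norm_num)]; exact h.str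
  count := by rw [ha 1 (by norm_num)]; exact h.count
  start := by rw [ha 2 (by norm_num)]; exact h.start
  occ := by rw [ha 2 (by norm_num), ha 3 (by norm_num)]; exact h.occ

/-- Compute in register `52` how often the letter in register `50` occurs before the position
in register `51`. -/
def rankProg : RStmt := .block [
  .assign 52 (.num 0),
  .assign 53 (.arr 1 (.reg 50)),
  .loop (.lt (.reg 52) (.reg 53)) (.block [
    .assign 54 ((.reg 52 + .reg 53) / .num 2),
    .ite (.lt (.arr 3 (.arr 2 (.reg 50) + .reg 54)) (.reg 51))
      (.assign 52 (.reg 54 + .num 1))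
      (.assign 53 (.reg 54))])]

/-- The number of steps of a binary search in a list of length at most `n`, up to a factor. -/
def lg (n : ℕ) : ℕ := Nat.log 2 n + 1

theorem run_rank (h : Indexed W S s) (hc : s.reg 50 ∈ S) (hx : s.reg 51 ≤ W) :
    Run W rankProg s fun s' t => s'.arr = s.arr ∧ (∀ y < 52, s'.reg y = s.reg y) ∧
      s'.reg 52 = (S.take (s.reg 51)).count (s.reg 50) ∧ t ≤ 60 * lg S.length := by
  have hW := h.bound
  have hcW := h.letters _ hc
  have hcnt := h.count (s.reg 50)
  have hcn : S.count (s.reg 50) ≤ S.length := List.count_le_length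
  have hst := h.start _ hc
  have hR := count_take_le S (s.reg 50) (s.reg 51)
  refine Run.cons (Run.assign (by simp) (Run.cons (Run.assign (by simp; omega) (Run.cons ?_))))
  -- The rank lies between registers 52 and 53, whose distance is below 2 ^ j, so at most `j`
  -- halvings remain. A halving costs at most 30 steps and the last test costs 4; initially `j` is
  -- `lg` of the length.
  refine Run.loop (k := 30 * lg S.length + 4) (fun s' k => s'.arr = s.arr ∧
    (∀ y < 52, s'.reg y = s.reg y) ∧
    s'.reg 52 ≤ (S.take (s.reg 51)).count (s.reg 50) ∧
    (S.take (s.reg 51)).count (s.reg 50) ≤ s'.reg 53 ∧ s'.reg 53 ≤ S.count (s.reg 50) ∧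
    ∃ j, s'.reg 53 - s'.reg 52 < 2 ^ j ∧ k = 30 * j + 4) ?_ ?_ ?_ ?_ ?_
  · refine ⟨rfl, ?_, ?_⟩
    · intro y hy
      have h₁ : y ≠ 52 := by omega
      have h₂ : y ≠ 53 := by omega
      simp [h₁, h₂]
    · have := Nat.lt_pow_succ_log_self (b := 2) (by norm_num) S.length
      have h' : S.count (s.reg 50) < 2 ^ lg S.length := by unfold lg; omega
      simp [hcnt, hR]
      exact h'
  · rintro s' k ⟨-, -, h₁, h₂, h₃, -⟩
    simp
    omega
  · rintro s' k ⟨ha, hf, h₁, h₂, h₃, j, hj, rfl⟩ hlt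
    have hlt : s'.reg 52 < s'.reg 53 := by simpa using hlt
    obtain ⟨y, hy⟩ := exists_isOcc (S := S) (c := s.reg 50)
      (k := (s'.reg 52 + s'.reg 53) / 2) (by omega)
    have hocc := h.occ _ _ _ hy
    have hyn := hy.lt_length
    have e₀ := hf 50 (by norm_num)
    have e₁ := hf 51 (by norm_num)
    obtain _ | j := j
    · omega
    have hj' : 2 ^ (j + 1) = 2 * 2 ^ j := by ring
    refine Run.cons (Run.assign (by simp; omega) (Run.cons (Run.ite ?_ ?_ ?_)))
    · simp [ha, e₀, e₁, hocc]
      omega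
    · intro hb
      have hb : y < s.reg 51 := by simpa [ha, e₀, e₁, hocc] using hb
      have hm := count_take_mono S (s.reg 50) (Nat.succ_le_of_lt hb)
      rw [hy.count_take_succ] at hm
      refine Run.assign (by simp; omega) (Run.nil ⟨30 * j + 4, ⟨ha, ?_, ?_⟩, ?_⟩)
      · intro y hy
        have h₁ : y ≠ 52 := by omega
        have h₂ : y ≠ 54 := by omega
        simpa [h₁, h₂] using hf y hy
      · simp
        exact ⟨hm, h₂, h₃, by omega⟩
      · simp
        omega
    · intro hb
      have hb : s.reg 51 ≤ y := by simpa [ha, e₀, e₁, hocc] using hb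
      have hm := count_take_mono S (s.reg 50) hb
      rw [hy.2] at hm
      refine Run.assign (by simp; omega) (Run.nil ⟨30 * j + 4, ⟨ha, ?_, ?_⟩, ?_⟩)
      · intro y hy
        have h₁ : y ≠ 53 := by omega
        have h₂ : y ≠ 54 := by omega
        simpa [h₁, h₂] using hf y hy
      · simp
        exact ⟨h₁, hm, by omega, by omega⟩
      · simp
        omega
  · rintro s' k ⟨-, -, -, -, -, j, -, rfl⟩ -
    simp
  · rintro s' t k ⟨ha, hf, h₁, h₂, h₃, -⟩ hb ht
    have hb : s'.reg 53 ≤ s'.reg 52 := by simpa using hb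
    refine Run.nil ⟨ha, hf, by omega, ?_⟩
    have : 1 ≤ lg S.length := Nat.le_add_left 1 _
    simp
    omega

/-- Compute in register `52` the successor of the last position before the one in register `51`
that carries the letter in register `50`; the result is `0` if there is none. -/
def prevProg : RStmt := .block [
  rankProg,
  .ite (.lt (.num 0) (.reg 52))
    (.assign 52 (.arr 3 (.arr 2 (.reg 50) + (.reg 52 - .num 1)) + .num 1))
    .skip]

/-- Compute in register `52` the successor of the first position from the one in register `51` on
that carries the letter in register `50`; the result is `n + 1` if there is none. -/
def nextProg : RStmt := .block [
  rankProg,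
  .ite (.lt (.reg 52) (.arr 1 (.reg 50)))
    (.assign 52 (.arr 3 (.arr 2 (.reg 50) + .reg 52) + .num 1))
    (.assign 52 (.reg 0 + .num 1))]

theorem IsOcc.prevOcc {c : ℕ} {k x y : ℕ} (h : IsOcc S c k y)
    (hx : (S.take x).count c = k + 1) : PrevOcc S c x y := by
  have hlt : y < x := by
    by_contra hle
    have := count_take_mono S c (not_lt.1 hle)
    rw [h.2] at this
    omega
  refine ⟨hlt, h.1, List.count_eq_zero.1 ?_⟩
  have := count_take_add_count_seg S c (Nat.succ_le_of_lt hlt)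
  rw [Nat.succ_eq_add_one, h.count_take_succ] at this
  omega

theorem IsOcc.nextOcc {c : ℕ} {k x y : ℕ} (h : IsOcc S c k y)
    (hx : (S.take x).count c = k) : NextOcc S c x y := by
  have hle : x ≤ y := by
    by_contra hlt
    have := count_take_mono S c (Nat.succ_le_of_lt (not_le.1 hlt))
    rw [h.count_take_succ] at this
    omega
  refine ⟨hle, h.1, List.count_eq_zero.1 ?_⟩
  have := count_take_add_count_seg S c hle
  rw [h.2] at this
  omega

/-- The result of `prevProg`. -/
def PrevResult (S : List ℕ) (c x r : ℕ) : Prop :=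
  r = 0 ∧ c ∉ seg S 0 x ∨ ∃ y, r = y + 1 ∧ PrevOcc S c x y

/-- The result of `nextProg`. -/
def NextResult (S : List ℕ) (c x r : ℕ) : Prop :=
  r = S.length + 1 ∧ c ∉ seg S x S.length ∨ ∃ y, r = y + 1 ∧ NextOcc S c x y

theorem PrevResult.le {c x r : ℕ} (h : PrevResult S c x r) : r ≤ x := by
  rcases h with ⟨rfl, -⟩ | ⟨y, rfl, h⟩
  · exact Nat.zero_le x
  · exact h.1

/-- The point of returning successors, with 0 for absence: one comparison decides whether the letter
occurs in the gap from `a` to `x`. -/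
theorem PrevResult.lt_iff {a c x r : ℕ} (h : PrevResult S c x r) : a < r ↔ c ∈ seg S a x := by
  rcases h with ⟨rfl, h⟩ | ⟨y, rfl, h₁, h₂, h₃⟩
  · exact iff_of_false (Nat.not_lt_zero a)
      fun hm => h ((seg_mono S (Nat.zero_le a) le_rfl).subset hm)
  · rw [Nat.lt_succ_iff]
    constructor
    · exact fun ha => mem_seg.2 ⟨y, ha, h₁, h₂⟩
    · intro hm
      by_contra hlt
      exact h₃ ((seg_mono S (not_le.1 hlt) le_rfl).subset hm)

theorem PrevResult.prevOcc {a c x r : ℕ} (h : PrevResult S c x r) (ha : a < r) :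
    PrevOcc S c x (r - 1) := by
  rcases h with ⟨rfl, -⟩ | ⟨y, rfl, h⟩
  · exact absurd ha (Nat.not_lt_zero a)
  · exact h

theorem run_prev (h : Indexed W S s) (hc : s.reg 50 ∈ S) (hx : s.reg 51 ≤ W) :
    Run W prevProg s fun s' t => s'.arr = s.arr ∧ (∀ y < 52, s'.reg y = s.reg y) ∧
      PrevResult S (s.reg 50) (s.reg 51) (s'.reg 52) ∧ t ≤ 80 * lg S.length := by
  have hW := h.bound
  have hcW := h.letters _ hc
  have hst := h.start _ hc
  have hR := count_take_le S (s.reg 50) (s.reg 51)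
  have hlg : 1 ≤ lg S.length := Nat.le_add_left 1 _
  refine Run.cons ((run_rank h hc hx).mono ?_)
  rintro s₁ t₁ ⟨ha, hf, hr, ht⟩
  have e₀ := hf 50 (by norm_num)
  refine Run.cons (Run.ite ?_ ?_ ?_)
  · simp
    omega
  · intro hb
    have hb : 0 < s₁.reg 52 := Nat.pos_of_ne_zero (by simpa using hb)
    obtain ⟨y, hy⟩ := exists_isOcc (S := S) (c := s.reg 50) (k := s₁.reg 52 - 1) (by omega)
    have hocc := h.occ _ _ _ hy
    have hyn := hy.lt_length
    refine Run.assign ?_ (Run.nil ⟨ha, ?_, Or.inr ⟨y, ?_, ?_⟩, ?_⟩)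
    · simp [ha, e₀, hocc]
      omega
    · intro y hy
      have h₁ : y ≠ 52 := by omega
      simpa [h₁] using hf y hy
    · simp [ha, e₀, hocc]
    · exact hy.prevOcc (by omega)
    · simp
      omega
  · intro hb
    have hb : s₁.reg 52 = 0 := by simpa using hb
    refine Run.skip (Run.nil ⟨ha, hf, Or.inl ⟨hb, ?_⟩, ?_⟩)
    · rw [seg_zero]
      exact List.count_eq_zero.1 (by omega)
    · simp
      omega

theorem run_next (h : Indexed W S s) (hc : s.reg 50 ∈ S) (hx : s.reg 51 ≤ W) :
    Run W nextProg s fun s' t => s'.arr = s.arr ∧ (∀ y < 52, s'.reg y = s.reg y) ∧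
      NextResult S (s.reg 50) (s.reg 51) (s'.reg 52) ∧ t ≤ 80 * lg S.length := by
  have hW := h.bound
  have hcW := h.letters _ hc
  have hst := h.start _ hc
  have hcnt := h.count (s.reg 50)
  have hn := h.length
  have hR := count_take_le S (s.reg 50) (s.reg 51)
  have hlg : 1 ≤ lg S.length := Nat.le_add_left 1 _
  refine Run.cons ((run_rank h hc hx).mono ?_)
  rintro s₁ t₁ ⟨ha, hf, hr, ht⟩
  have e₀ := hf 50 (by norm_num)
  have e₁ := hf 0 (by norm_num)
  refine Run.cons (Run.ite ?_ ?_ ?_)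
  · simp [ha, e₀, hcnt]
    omega
  · intro hb
    have hb : s₁.reg 52 < S.count (s.reg 50) := by simpa [ha, e₀, hcnt] using hb
    obtain ⟨y, hy⟩ := exists_isOcc hb
    have hocc := h.occ _ _ _ hy
    have hyn := hy.lt_length
    refine Run.assign ?_ (Run.nil ⟨ha, ?_, Or.inr ⟨y, ?_, ?_⟩, ?_⟩)
    · simp [ha, e₀, hocc]
      omega
    · intro y hy
      have h₁ : y ≠ 52 := by omega
      simpa [h₁] using hf y hy
    · simp [ha, e₀, hocc]
    · exact hy.nextOcc hr.symm
    · simp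
      omega
  · intro hb
    have hb : S.count (s.reg 50) ≤ s₁.reg 52 := by simpa [ha, e₀, hcnt] using hb
    refine Run.assign ?_ (Run.nil ⟨ha, ?_, Or.inl ⟨?_, ?_⟩, ?_⟩)
    · simp [e₁]
      omega
    · intro y hy
      have h₁ : y ≠ 52 := by omega
      simpa [h₁] using hf y hy
    · simp [e₁, hn]
    · rcases Nat.lt_or_ge S.length (s.reg 51) with hlt | hle
      · simp [seg_eq_nil hlt.le]
      · have := count_take_add_count_seg S (s.reg 50) hle
        rw [List.take_length] at this
        exact List.count_eq_zero.1 (by omega)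
    · simp
      omega

end Queries

/-! ### One round of the greedy method on the machine -/

section MaximalCommonSubsequence

theorem ltNat_mul_ne_zero {a b c d : ℕ} : ltNat a b * ltNat c d ≠ 0 ↔ a < b ∧ c < d := by
  simp [ltNat_eq_zero]

theorem MState.setArr_arr_of_ne (s : MState) {a b : ℕ} (i w : ℕ) (h : b ≠ a) :
    (s.setArr a i w).arr b = s.arr b := by
  simp [MState.setArr, h]

/-- With a letter in register `18`, the successors of its last positions before those in the
registers `16` and `17` are written into the registers `19` and `20`. -/
def tryProg : RStmt := .block [
  .assign 50 (.reg 18),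
  .assign 51 (.reg 16),
  prevProg,
  .assign 19 (.reg 52),
  .assign 51 (.reg 17),
  prevProg,
  .assign 20 (.reg 52)]

/-- Push the results of `tryProg` on the stack of rightmost embeddings (arrays `6` and `7`). -/
def pushProg : RStmt := .block [
  .assign 14 (.reg 14 + .num 1),
  .store 6 (.reg 14) (.reg 19 - .num 1),
  .store 7 (.reg 14) (.reg 20 - .num 1)]

/-- Load the top of the stack into the registers `16` and `17`. -/
def loadProg : RStmt := .block [
  .assign 16 (.arr 6 (.reg 14)),
  .assign 17 (.arr 7 (.reg 14))]

/-- Is the letter of the last `tryProg` in both gaps? -/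
def foundExpr : RExpr := .lt (.reg 10) (.reg 19) * .lt (.reg 13) (.reg 20)

/-- Try the next letters of the two gaps. -/
def findProg : RStmt := .block [
  .assign 18 (.arr 0 (.reg 10 + .reg 15)),
  tryProg,
  .ite foundExpr .skip (.block [
    .assign 18 (.arr 0 (.reg 13 + .reg 15)),
    tryProg])]

/-- Move the first letter of the suffix to the prefix. -/
def advanceProg : RStmt := .block [
  .assign 18 (.arr 0 (.reg 16)),
  .assign 14 (.reg 14 - .num 1),
  .store 5 (.reg 12) (.reg 18),
  .assign 12 (.reg 12 + .num 1),
  .assign 50 (.reg 18),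
  .assign 51 (.reg 10),
  nextProg,
  .assign 10 (.reg 52),
  .assign 51 (.reg 13),
  nextProg,
  .assign 13 (.reg 52),
  .assign 15 (.num 0)]

/-- One round of the computation of a maximal common subsequence. -/
def roundProg : RStmt := .block [
  loadProg,
  .ite (.lt (.reg 10 + .reg 15) (.reg 16) * .lt (.reg 13 + .reg 15) (.reg 17))
    (.block [
      findProg,
      .ite foundExpr pushProg (.assign 15 (.reg 15 + .num 1))])
    (.ite (.lt (.num 0) (.reg 14))
      advanceProg
      (.assign 21 (.num 0)))]

/-- Compute the rightmost embeddings of the string of length `reg 12` in array `5`. -/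
def embedProg : RStmt := .block [
  .assign 13 (.reg 11),
  .assign 14 (.num 0),
  .store 6 (.num 0) (.reg 11),
  .store 7 (.num 0) (.reg 0),
  .assign 22 (.reg 12),
  .loop (.lt (.num 0) (.reg 22)) (.block [
    .assign 22 (.reg 22 - .num 1),
    .assign 18 (.arr 5 (.reg 22)),
    loadProg,
    tryProg,
    pushProg])]

/-- Replace the string of length `reg 12` in array `5` by a maximal common subsequence of
`S[reg 10, reg 11)` and `S[reg 11, n)` that contains it. -/
def mcsProg : RStmt := .block [
  embedProg,
  .assign 12 (.num 0),
  .assign 15 (.num 0),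
  .assign 21 (.num 1),
  .loop (.reg 21) roundProg]

variable {W : ℕ} {S : List ℕ} {s s' : MState}

theorem one_le_lg (n : ℕ) : 1 ≤ lg n := Nat.le_add_left 1 _

theorem run_try (h : Indexed W S s) (hc : s.reg 18 ∈ S) (h₁ : s.reg 16 ≤ S.length)
    (h₂ : s.reg 17 ≤ S.length) :
    Run W tryProg s fun s' t => s'.arr = s.arr ∧
      (∀ y < 50, y ≠ 19 → y ≠ 20 → s'.reg y = s.reg y) ∧
      PrevResult S (s.reg 18) (s.reg 16) (s'.reg 19) ∧
      PrevResult S (s.reg 18) (s.reg 17) (s'.reg 20) ∧ t ≤ 200 * lg S.length := by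
  have hW := h.bound
  have hcW := h.letters _ hc
  have hlg := one_le_lg S.length
  refine Run.cons (Run.assign (by simpa) (Run.cons (Run.assign (by simp; omega) (Run.cons ?_))))
  refine (run_prev (h.congr (by simp) (by simp)) (by simpa) (by simp; omega)).mono ?_
  rintro s₁ t₁ ⟨ha, hf, hr, ht⟩
  simp at ha hr
  have hle := hr.le
  have e₁ := hf 17 (by norm_num)
  have e₂ := hf 50 (by norm_num)
  simp at e₁ e₂
  refine Run.cons (Run.assign (by simp; omega)
    (Run.cons (Run.assign (by simp; omega) (Run.cons ?_))))
  refine (run_prev ((h.congr (s' := s₁) (by simpa using hf 0 (by norm_num)) (by simp [ha])).congr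
    (by simp) (by simp)) (by simpa [e₂]) (by simp; omega)).mono ?_
  rintro s₂ t₂ ⟨ha', hf', hr', ht'⟩
  simp [e₁, e₂] at ha' hr'
  have hle' := hr'.le
  refine Run.cons (Run.assign (by simp; omega) (Run.nil ⟨by simp [ha', ha], ?_, ?_, ?_, ?_⟩))
  · intro y hy h₁₉ h₂₀
    have e₃ := hf y (by omega)
    have e₄ := hf' y (by omega)
    have y₁ : y ≠ 50 := by omega
    have y₂ : y ≠ 51 := by omega
    simp [h₁₉, y₁, y₂] at e₃ e₄
    simp [h₂₀, e₃, e₄]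
  · have e₄ := hf' 19 (by norm_num)
    simp at e₄
    simpa [e₄] using hr
  · simpa using hr'
  · simp
    omega

theorem run_push (hW : s.reg 14 + 1 ≤ W) (h₁ : s.reg 19 ≤ W) (h₂ : s.reg 20 ≤ W) :
    Run W pushProg s fun s' t => (∀ y, y ≠ 14 → s'.reg y = s.reg y) ∧
      s'.reg 14 = s.reg 14 + 1 ∧ (∀ a < 6, s'.arr a = s.arr a) ∧
      (∀ k ≤ s.reg 14, s'.arr 6 k = s.arr 6 k) ∧ (∀ k ≤ s.reg 14, s'.arr 7 k = s.arr 7 k) ∧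
      s'.arr 6 (s.reg 14 + 1) = s.reg 19 - 1 ∧ s'.arr 7 (s.reg 14 + 1) = s.reg 20 - 1 ∧
      t ≤ 20 := by
  refine Run.cons (Run.assign (by simp; omega) (Run.cons (Run.store (by simp; omega)
    (by simp; omega) (Run.cons (Run.store (by simp; omega) (by simp; omega) (Run.nil ?_))))))
  refine ⟨?_, by simp, ?_, ?_, ?_, by simp, by simp, by simp⟩
  · intro y hy
    simp [hy]
  · intro a ha
    rw [MState.setArr_arr_of_ne _ _ _ (by omega), MState.setArr_arr_of_ne _ _ _ (by omega),
      MState.setReg_arr]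
  · intro k hk
    have : k ≠ s.reg 14 + 1 := by omega
    simp [this]
  · intro k hk
    have : k ≠ s.reg 14 + 1 := by omega
    simp [this]

theorem run_load (hW : s.reg 14 ≤ W) (h₁ : s.arr 6 (s.reg 14) ≤ W)
    (h₂ : s.arr 7 (s.reg 14) ≤ W) :
    Run W loadProg s fun s' t => s'.arr = s.arr ∧
      (∀ y, y ≠ 16 → y ≠ 17 → s'.reg y = s.reg y) ∧ s'.reg 16 = s.arr 6 (s.reg 14) ∧
      s'.reg 17 = s.arr 7 (s.reg 14) ∧ t ≤ 10 := by
  refine Run.cons (Run.assign (by simp; omega) (Run.cons (Run.assign (by simp; omega)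
    (Run.nil ⟨rfl, ?_, by simp, by simp, by simp⟩))))
  intro y h₁ h₂
  simp [h₁, h₂]

/-- The string `L` is in array `5` and its length in register `12`. -/
def Holds (s : MState) (L : List ℕ) : Prop :=
  s.reg 12 = L.length ∧ ∀ i c, L[i]? = some c → s.arr 5 i = c

/-- The invariant of the computation, started in the state `s₀`, of a maximal common
subsequence. -/
structure MCSInv (W : ℕ) (S : List ℕ) (lo mid : ℕ) (C : List ℕ) (s₀ s : MState)
    (P R : List ℕ) : Prop where
  indexed : Indexed W S s
  mid_le : mid ≤ S.length
  frame : ∀ y < 10, s.reg y = s₀.reg y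
  frame_arr : ∀ a < 5, s.arr a = s₀.arr a
  top : s.reg 14 = R.length
  holds : Holds s P
  state : MCSState S lo mid S.length C P R (s.arr 6) (s.arr 7) (s.reg 10) (s.reg 13) (s.reg 15)

variable {lo mid : ℕ} {C P R : List ℕ} {s₀ : MState}

theorem MCSInv.congr (h : MCSInv W S lo mid C s₀ s P R) (hr : ∀ y < 16, s'.reg y = s.reg y)
    (ha : s'.arr = s.arr) : MCSInv W S lo mid C s₀ s' P R where
  indexed := h.indexed.congr (hr 0 (by norm_num)) fun a _ => by rw [ha]
  mid_le := h.mid_le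
  frame := fun y hy => (hr y (by omega)).trans (h.frame y hy)
  frame_arr := fun a ha' => by rw [ha, h.frame_arr a ha']
  top := (hr 14 (by norm_num)).trans h.top
  holds := ⟨(hr 12 (by norm_num)).trans h.holds.1, by rw [ha]; exact h.holds.2⟩
  state := by
    rw [hr 10 (by norm_num), hr 13 (by norm_num), hr 15 (by norm_num), ha]
    exact h.state

theorem MCSInv.bounds (h : MCSInv W S lo mid C s₀ s P R) :
    s.reg 10 + s.reg 15 ≤ s.arr 6 R.length ∧ s.reg 13 + s.reg 15 ≤ s.arr 7 R.length ∧
      s.arr 6 R.length ≤ S.length ∧ s.arr 7 R.length ≤ S.length ∧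
      P.length + R.length ≤ S.length := by
  have h₁ := h.state.sublist₁.length_le
  have h₂ := length_seg_le S lo mid
  rw [List.length_append] at h₁
  exact ⟨h.state.le₁, h.state.le₂, h.state.right₁.sublist.1.trans h.mid_le,
    h.state.right₂.sublist.1, by omega⟩

theorem MCSInv.arr_eq (h : MCSInv W S lo mid C s₀ s P R) {x : ℕ} (hx : x < S.length) :
    s.arr 0 x ∈ S ∧ S[x]? = some (s.arr 0 x) := by
  have e := List.getElem?_eq_getElem hx
  rw [h.indexed.str x _ e]
  exact ⟨List.getElem_mem hx, e⟩

/-- A bound for the number of rounds that are left. -/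
def mcsRank (S P R : List ℕ) (s : MState) : ℕ :=
  (S.length - P.length - R.length) + (2 * S.length - s.reg 10 - s.reg 13 - s.reg 15)

/-- `c` is the letter tried last: the next one of the first gap if that succeeds, otherwise the next
one of the second gap. If both fail, the facts obtained are those that `MCSState.scan` needs. -/
theorem run_find (h : MCSInv W S lo mid C s₀ s P R)
    (h₁₆ : s.reg 16 = s.arr 6 R.length) (h₁₇ : s.reg 17 = s.arr 7 R.length)
    (ha : s.reg 10 + s.reg 15 < s.reg 16) (hb : s.reg 13 + s.reg 15 < s.reg 17) :
    Run W findProg s fun s' t => s'.arr = s.arr ∧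
      (∀ y < 18, s'.reg y = s.reg y) ∧ s'.reg 21 = s.reg 21 ∧ t ≤ 450 * lg S.length ∧
      ∃ c, PrevResult S c (s.reg 16) (s'.reg 19) ∧ PrevResult S c (s.reg 17) (s'.reg 20) ∧
        (¬ (s.reg 10 < s'.reg 19 ∧ s.reg 13 < s'.reg 20) →
          (∀ c, S[s.reg 10 + s.reg 15]? = some c →
            ¬ (c ∈ seg S (s.reg 10) (s.reg 16) ∧ c ∈ seg S (s.reg 13) (s.reg 17))) ∧
          (∀ c, S[s.reg 13 + s.reg 15]? = some c →
            ¬ (c ∈ seg S (s.reg 10) (s.reg 16) ∧ c ∈ seg S (s.reg 13) (s.reg 17)))) := by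
  obtain ⟨b₁, b₂, b₃, b₄, b₅⟩ := h.bounds
  have hW := h.indexed.bound
  have hlg := one_le_lg S.length
  obtain ⟨m₁, e₁⟩ := h.arr_eq (x := s.reg 10 + s.reg 15) (by omega)
  obtain ⟨m₂, e₂⟩ := h.arr_eq (x := s.reg 13 + s.reg 15) (by omega)
  have l₁ := h.indexed.letters _ m₁
  have l₂ := h.indexed.letters _ m₂
  refine Run.cons (Run.assign (by simp; omega) (Run.cons ?_))
  refine (run_try (h.indexed.congr (by simp) (by simp)) (by simpa) (by simp; omega)
    (by simp; omega)).mono ?_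
  rintro s₁ t₁ ⟨ha₁, hf₁, p₁, q₁, ht₁⟩
  simp at ha₁ p₁ q₁
  have f₁₀ := hf₁ 10 (by norm_num) (by norm_num) (by norm_num)
  have f₁₃ := hf₁ 13 (by norm_num) (by norm_num) (by norm_num)
  have f₁₅ := hf₁ 15 (by norm_num) (by norm_num) (by norm_num)
  have f₁₆ := hf₁ 16 (by norm_num) (by norm_num) (by norm_num)
  have f₁₇ := hf₁ 17 (by norm_num) (by norm_num) (by norm_num)
  have f₂₁ := hf₁ 21 (by norm_num) (by norm_num) (by norm_num)
  have f₀ := hf₁ 0 (by norm_num) (by norm_num) (by norm_num)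
  simp at f₀ f₁₀ f₁₃ f₁₅ f₁₆ f₁₇ f₂₁
  have r₁ := p₁.le
  have r₂ := q₁.le
  refine Run.cons (Run.ite (by simp [foundExpr]; omega) ?_ ?_)
  · intro hfound
    have hfound := ltNat_mul_ne_zero.1 hfound
    simp [f₁₀, f₁₃] at hfound
    refine Run.skip (Run.nil ⟨ha₁, ?_, f₂₁, ?_, _, p₁, q₁, fun hn => absurd hfound hn⟩)
    · intro y hy
      have y₁ : y ≠ 18 := by omega
      simpa [y₁] using hf₁ y (by omega) (by omega) (by omega)
    · simp [foundExpr]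
      omega
  · intro hfound
    have hfound := mt ltNat_mul_ne_zero.2 (not_not_intro hfound)
    simp only [RExpr.val_reg, f₁₀, f₁₃] at hfound
    refine Run.cons (Run.assign (by simp [ha₁, f₁₃, f₁₅]; omega) (Run.cons ?_))
    refine (run_try (h.indexed.congr (by simpa using f₀) (by simp [ha₁]))
      (by simpa [ha₁, f₁₃, f₁₅]) (by simp; omega) (by simp; omega)).mono ?_
    rintro s₂ t₂ ⟨ha₂, hf₂, p₂, q₂, ht₂⟩
    simp [ha₁, f₁₃, f₁₅, f₁₆, f₁₇] at ha₂ p₂ q₂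
    refine Run.nil (Run.nil ⟨ha₂, ?_, ?_, ?_, _, p₂, q₂, fun hn => ⟨?_, ?_⟩⟩)
    · intro y hy
      have y₁ : y ≠ 18 := by omega
      have g₁ := hf₁ y (by omega) (by omega) (by omega)
      have g₂ := hf₂ y (by omega) (by omega) (by omega)
      simp [y₁] at g₁ g₂
      rw [g₂, g₁]
    · have g₂ := hf₂ 21 (by norm_num) (by norm_num) (by norm_num)
      simp at g₂
      rw [g₂, f₂₁]
    · simp [foundExpr]
      omega
    · intro c hc
      obtain rfl := Option.some_injective _ (e₁.symm.trans hc)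
      rwa [← p₁.lt_iff, ← q₁.lt_iff]
    · intro c hc
      obtain rfl := Option.some_injective _ (e₂.symm.trans hc)
      rwa [← p₂.lt_iff, ← q₂.lt_iff]

theorem run_advance {c : ℕ} (h : MCSInv W S lo mid C s₀ s P (c :: R))
    (h₁₆ : s.reg 16 = s.arr 6 (R.length + 1))
    (hd : s.arr 6 (R.length + 1) ≤ s.reg 10 + s.reg 15 ∨
      s.arr 7 (R.length + 1) ≤ s.reg 13 + s.reg 15) :
    Run W advanceProg s fun s' t => MCSInv W S lo mid C s₀ s' (P ++ [c]) R ∧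
      s'.reg 21 = s.reg 21 ∧ mcsRank S (P ++ [c]) R s' < mcsRank S P (c :: R) s ∧
      t ≤ 300 * lg S.length := by
  obtain ⟨b₁, b₂, b₃, b₄, b₅⟩ := h.bounds
  have hW := h.indexed.bound
  have hlg := one_le_lg S.length
  have htop := h.top
  obtain ⟨hP, hP'⟩ := h.holds
  have hf := h.state.right₁.2
  have hg := h.state.right₂.2
  rw [List.length_cons] at b₁ b₂ b₃ b₄ b₅ htop
  have hfn : s.arr 6 (R.length + 1) < S.length := (List.getElem?_eq_some_iff.1 hf.2.1).1
  have hgn : s.arr 7 (R.length + 1) < S.length := (List.getElem?_eq_some_iff.1 hg.2.1).1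
  have hS := h.indexed.str _ _ hf.2.1
  have hcS : c ∈ S := List.mem_of_getElem? hf.2.1
  have hcW := h.indexed.letters c hcS
  refine Run.cons (Run.assign (by simp [h₁₆, hS]; omega) (Run.cons (Run.assign (by simp; omega)
    (Run.cons (Run.store (by simp; omega) (by simpa [h₁₆, hS]) (Run.cons (Run.assign
    (by simp; omega) (Run.cons (Run.assign (by simpa [h₁₆, hS]) (Run.cons (Run.assign
    (by simp; omega) (Run.cons ?_))))))))))))
  simp only [RExpr.val_arr, RExpr.val_reg, RExpr.val_sub, RExpr.val_num, RExpr.val_add,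
    MState.setReg_reg, MState.setArr_reg, h₁₆, hS]
  simp only [Nat.reduceEqDiff, if_true, if_false]
  refine (run_next (h.indexed.congr (by simp) fun a ha => by
    simp [MState.setArr_arr_of_ne _ _ _ (show a ≠ 5 by omega)]) (by simpa)
    (by simp; omega)).mono ?_
  rintro s₁ t₁ ⟨ha₁, hf₁, r₁, ht₁⟩
  simp at ha₁ r₁
  have f₀ := hf₁ 0 (by norm_num)
  have f₁₃ := hf₁ 13 (by norm_num)
  have f₅₀ := hf₁ 50 (by norm_num)
  simp at f₀ f₁₃ f₅₀
  -- The query cannot fail, because `c` occurs at the top of the stack, which is not before the end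
  -- of the prefix.
  rcases r₁ with ⟨-, hno⟩ | ⟨ya, hya, oa⟩
  · exact absurd (mem_seg.2 ⟨_, by omega, hfn, hf.2.1⟩) hno
  have hyan : ya < S.length := (List.getElem?_eq_some_iff.1 oa.2.1).1
  refine Run.cons (Run.assign (by simp; omega) (Run.cons (Run.assign (by simp; omega)
    (Run.cons ?_))))
  refine (run_next ((h.indexed.congr (s' := s₁) f₀ fun a ha => by
    simp [ha₁, MState.setArr_arr_of_ne _ _ _ (show a ≠ 5 by omega)]).congr (by simp) (by simp))
    (by simpa [f₅₀]) (by simp; omega)).mono ?_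
  rintro s₂ t₂ ⟨ha₂, hf₂, r₂, ht₂⟩
  simp [f₅₀, f₁₃] at ha₂ r₂
  rw [ha₁] at ha₂
  rcases r₂ with ⟨-, hno⟩ | ⟨yb, hyb, ob⟩
  · exact absurd (mem_seg.2 ⟨_, by omega, hgn, hg.2.1⟩) hno
  have hybn : yb < S.length := (List.getElem?_eq_some_iff.1 ob.2.1).1
  have f₁₀ := hf₂ 10 (by norm_num)
  simp [hya] at f₁₀
  have low : ∀ y < 22, y ≠ 10 → s₂.reg y =
      if y = 12 then s.reg 12 + 1 else if y = 14 then s.reg 14 - 1 else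
        if y = 18 then c else s.reg y := by
    intro y hy hy'
    have g₁ := hf₁ y (by omega)
    have g₂ := hf₂ y (by omega)
    simp [hy', show y ≠ 50 by omega, show y ≠ 51 by omega] at g₁ g₂
    rw [g₂, g₁]
  have h₆ : s₂.arr 6 = s.arr 6 := by
    rw [ha₂, MState.setArr_arr_of_ne _ _ _ (by norm_num)]
    rfl
  have h₇ : s₂.arr 7 = s.arr 7 := by
    rw [ha₂, MState.setArr_arr_of_ne _ _ _ (by norm_num)]
    rfl
  have h₅ : ∀ i, s₂.arr 5 i = if i = P.length then c else s.arr 5 i := by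
    intro i
    rw [ha₂]
    simp [hP]
  have hlow : ∀ a < 5, s₂.arr a = s.arr a := by
    intro a ha
    rw [ha₂, MState.setArr_arr_of_ne _ _ _ (by omega)]
    rfl
  obtain ⟨hstate, hlt⟩ := h.state.advance hd oa ob
  refine Run.cons (Run.assign (by simp; omega) (Run.cons (Run.assign (by simp) (Run.nil
    ⟨⟨h.indexed.congr (by simpa using low 0) fun a ha => ?_, h.mid_le, fun y hy => ?_,
      fun a ha => ?_, ?_, ⟨?_, fun i x hi => ?_⟩, ?_⟩, ?_, ?_, ?_⟩))))
  · simpa using hlow a (by omega)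
  · simp [low y (by omega) (by omega), show y ≠ 15 by omega, show y ≠ 13 by omega,
      show y ≠ 12 by omega, show y ≠ 14 by omega, show y ≠ 18 by omega, h.frame y hy]
  · simpa [hlow a ha] using h.frame_arr a ha
  · simp [low, htop]
  · simp [low, hP]
  · have hi' := hi
    simp only [MState.setReg_arr, h₅]
    rcases Nat.lt_trichotomy i P.length with hlt | rfl | hlt
    · rw [List.getElem?_append_left hlt] at hi
      rw [if_neg hlt.ne, hP' i x hi]
    · simpa using hi
    · rw [List.getElem?_eq_none (by simp; omega)] at hi
      simp at hi
  · simp [h₆, h₇, f₁₀, hyb]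
    exact hstate
  · simp [low]
  · simp [mcsRank, f₁₀, hyb]
    omega
  · simp
    omega

/-- There are four cases: a common letter is pushed, the scan moves on, an exhausted gap moves a
letter to the prefix, or the suffix is empty and the round stops. The first lowers the first summand
of `mcsRank`; the next two lower the sum, where the advance may leave the first summand unchanged.
-/
theorem run_round (h : MCSInv W S lo mid C s₀ s P R) (hgo : s.reg 21 = 1) :
    Run W roundProg s fun s' t => t ≤ 600 * lg S.length ∧ ∃ P' R',
      MCSInv W S lo mid C s₀ s' P' R' ∧
      (s'.reg 21 = 1 ∧ mcsRank S P' R' s' < mcsRank S P R s ∨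
        s'.reg 21 = 0 ∧ IsMCSContaining (seg S lo mid) (seg S mid S.length) C P') := by
  obtain ⟨b₁, b₂, b₃, b₄, b₅⟩ := h.bounds
  have hW := h.indexed.bound
  have hlg := one_le_lg S.length
  have htop := h.top
  refine Run.cons ((run_load (by omega) (by rw [htop]; omega) (by rw [htop]; omega)).mono ?_)
  rintro s₁ t₁ ⟨ha₁, hf₁, h₁₆, h₁₇, ht₁⟩
  have h₁ : MCSInv W S lo mid C s₀ s₁ P R :=
    h.congr (fun y hy => hf₁ y (by omega) (by omega)) ha₁
  rw [htop, ← ha₁] at h₁₆ h₁₇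
  have f₁₀ := hf₁ 10 (by norm_num) (by norm_num)
  have f₁₃ := hf₁ 13 (by norm_num) (by norm_num)
  have f₁₄ := hf₁ 14 (by norm_num) (by norm_num)
  have f₁₅ := hf₁ 15 (by norm_num) (by norm_num)
  have f₂₁ := hf₁ 21 (by norm_num) (by norm_num)
  have hrank : mcsRank S P R s₁ = mcsRank S P R s := by simp [mcsRank, f₁₀, f₁₃, f₁₅]
  have htop₁ := h₁.top
  rw [← hrank]
  rw [hgo] at f₂₁
  obtain ⟨b₁, b₂, b₃, b₄, b₅⟩ := h₁.bounds
  clear hrank f₁₀ f₁₃ f₁₄ f₁₅ hf₁ ha₁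
  refine Run.cons (Run.ite (by simp; omega) ?_ ?_)
  · intro hb
    have hb := ltNat_mul_ne_zero.1 hb
    simp at hb
    refine Run.cons ((run_find h₁ h₁₆ h₁₇ hb.1 hb.2).mono ?_)
    rintro s₂ t₂ ⟨ha₂, hf₂, hgo₂, ht₂, c, hp, hq, hno⟩
    have h₂ : MCSInv W S lo mid C s₀ s₂ P R := h₁.congr (fun y hy => hf₂ y (by omega)) ha₂
    have g₁₀ := hf₂ 10 (by norm_num)
    have g₁₃ := hf₂ 13 (by norm_num)
    have g₁₄ := hf₂ 14 (by norm_num)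
    have g₁₅ := hf₂ 15 (by norm_num)
    have r₁ := hp.le
    have r₂ := hq.le
    refine Run.cons (Run.ite (by simp [foundExpr]; omega) ?_ ?_)
    · intro hb'
      have hb' := ltNat_mul_ne_zero.1 hb'
      simp [g₁₀, g₁₃] at hb'
      refine (run_push (by omega) (by omega) (by omega)).mono ?_
      rintro s₃ t₃ ⟨hf₃, k₁₄, hlow, c₆, c₇, k₆, k₇, ht₃⟩
      rw [h₂.top] at k₁₄ c₆ c₇ k₆ k₇
      have i₁₀ := hf₃ 10 (by norm_num)
      have i₁₃ := hf₃ 13 (by norm_num)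
      have i₁₅ := hf₃ 15 (by norm_num)
      have hcf := hp.prevOcc hb'.1
      have hcg := hq.prevOcc hb'.2
      rw [h₁₆, ← ha₂, ← k₆] at hcf
      rw [h₁₇, ← ha₂, ← k₇] at hcg
      have hst := h₂.state.push c₆ c₇ hcf hcg (by omega) (by omega)
      have h₃ : MCSInv W S lo mid C s₀ s₃ P (c :: R) :=
        ⟨h₂.indexed.congr (hf₃ 0 (by norm_num)) fun a ha => hlow a (by omega), h.mid_le,
          fun y hy => (hf₃ y (by omega)).trans (h₂.frame y hy),
          fun a ha => (hlow a (by omega)).trans (h₂.frame_arr a ha), k₁₄,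
          ⟨(hf₃ 12 (by norm_num)).trans h₂.holds.1, by
            rw [hlow 5 (by norm_num)]; exact h₂.holds.2⟩,
          by rw [i₁₀, i₁₃, i₁₅]; exact hst⟩
      refine Run.nil (Run.nil ⟨?_, P, c :: R, h₃, Or.inl ⟨?_, ?_⟩⟩)
      · simp [foundExpr]
        omega
      · rw [hf₃ 21 (by norm_num), hgo₂, f₂₁]
      · have := h₃.bounds.2.2.2.2
        simp only [List.length_cons] at this
        simp only [mcsRank, List.length_cons, i₁₀, i₁₃, i₁₅, g₁₀, g₁₃, g₁₅]
        omega
    · intro hb'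
      have hb' := mt ltNat_mul_ne_zero.2 (not_not_intro hb')
      simp only [RExpr.val_reg, g₁₀, g₁₃] at hb'
      obtain ⟨n₁, n₂⟩ := hno hb'
      rw [h₁₆, h₁₇] at n₁ n₂
      have hst := h₁.state.scan (by omega) (by omega) n₁ n₂
      refine Run.assign (by simp; omega) (Run.nil (Run.nil ⟨?_, P, R,
        ⟨h₂.indexed.congr (by simp) (by simp), h.mid_le, fun y hy => ?_, ?_, ?_, ⟨?_, ?_⟩, ?_⟩,
          Or.inl ⟨?_, ?_⟩⟩))
      · simp [foundExpr]
        omega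
      · simpa [show y ≠ 15 by omega] using h₂.frame y hy
      · simpa using h₂.frame_arr
      · simpa using h₂.top
      · simpa using h₂.holds.1
      · simpa using h₂.holds.2
      · simp [ha₂, g₁₀, g₁₃, g₁₅]
        exact hst
      · simp [hgo₂, f₂₁]
      · simp [mcsRank, g₁₀, g₁₃, g₁₅]
        omega
  · intro hb
    have hb := mt ltNat_mul_ne_zero.2 (not_not_intro hb)
    simp only [RExpr.val_reg, RExpr.val_add] at hb
    have hd : s₁.arr 6 R.length ≤ s₁.reg 10 + s₁.reg 15 ∨
      s₁.arr 7 R.length ≤ s₁.reg 13 + s₁.reg 15 := by omega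
    refine Run.ite (by simp; omega) ?_ ?_
    · intro hpos
      have hpos : 0 < s₁.reg 14 := Nat.pos_of_ne_zero (by simpa using hpos)
      obtain _ | ⟨c, R⟩ := R
      · rw [htop₁] at hpos
        exact absurd hpos (lt_irrefl 0)
      refine (run_advance h₁ (by simpa using h₁₆) (by simpa using hd)).mono ?_
      rintro s₂ t₂ ⟨h₂, hgo₂, hlt, ht₂⟩
      refine Run.nil ⟨?_, P ++ [c], R, h₂, Or.inl ⟨by rw [hgo₂, f₂₁], hlt⟩⟩
      simp
      omega
    · intro hzero
      have hzero : s₁.reg 14 = 0 := by simpa using hzero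
      obtain rfl : R = [] := List.length_eq_zero_iff.1 (by omega)
      refine Run.assign (by simp) (Run.nil ⟨?_, P, [],
        ⟨h₁.indexed.congr (by simp) (by simp), h.mid_le, fun y hy => ?_, ?_, ?_, ⟨?_, ?_⟩, ?_⟩,
          Or.inr ⟨by simp, h₁.state.isMCSContaining hd⟩⟩)
      · simp
        omega
      · simpa [show y ≠ 21 by omega] using h₁.frame y hy
      · simpa using h₁.frame_arr
      · simpa using h₁.top
      · simpa using h₁.holds.1
      · simpa using h₁.holds.2
      · simpa using h₁.state

end MaximalCommonSubsequence

/-! ### Complete calls of the subroutine, matching and the two-call stage -/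

section Stages

variable {W : ℕ} {S : List ℕ} {s : MState} {lo mid : ℕ} {C : List ℕ}

theorem mem_of_mem_seg {α : Type*} {S : List α} {a b : ℕ} {c : α} (h : c ∈ seg S a b) : c ∈ S :=
  (List.take_subset _ _) ((List.drop_subset _ _) h)

theorem run_embed (h : Indexed W S s) (hlo : lo ≤ mid) (hmid : mid ≤ S.length)
    (h₁₁ : s.reg 11 = mid) (hC : Holds s C)
    (h₁ : C.Sublist (seg S lo mid)) (h₂ : C.Sublist (seg S mid S.length)) :
    Run W embedProg s fun s' t => (∀ y < 13, s'.reg y = s.reg y) ∧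
      (∀ a < 6, s'.arr a = s.arr a) ∧ s'.reg 13 = mid ∧ s'.reg 14 = C.length ∧
      RightStack S mid (s'.arr 6) C ∧ RightStack S S.length (s'.arr 7) C ∧
      lo ≤ s'.arr 6 C.length ∧ mid ≤ s'.arr 7 C.length ∧
      t ≤ 300 * (S.length + 1) * lg S.length := by
  have hW := h.bound
  have hn := h.length
  have hlg := one_le_lg S.length
  have hCn : C.length ≤ S.length := (h₁.length_le.trans (length_seg_le S lo mid)).trans (by omega)
  obtain ⟨hC₁, hC₂⟩ := hC
  refine Run.cons (Run.assign (by simp; omega) (Run.cons (Run.assign (by simp) (Run.cons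
    (Run.store (by simp) (by simp; omega) (Run.cons (Run.store (by simp) (by simp; omega)
    (Run.cons (Run.assign (by simp; omega) (Run.cons ?_))))))))))
  refine Run.loop (k := 260 * lg S.length * C.length + 4) (fun s' k =>
    (∀ y < 13, s'.reg y = s.reg y) ∧ (∀ a < 6, s'.arr a = s.arr a) ∧ s'.reg 13 = mid ∧
    ∃ C₁ C₂, C = C₁ ++ C₂ ∧ s'.reg 22 = C₁.length ∧ s'.reg 14 = C₂.length ∧
      RightStack S mid (s'.arr 6) C₂ ∧ RightStack S S.length (s'.arr 7) C₂ ∧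
      lo ≤ s'.arr 6 C₂.length ∧ mid ≤ s'.arr 7 C₂.length ∧
      k = 260 * lg S.length * C₁.length + 4) ?_ ?_ ?_ ?_ ?_
  · refine ⟨fun y hy => ?_, fun a ha => ?_, by simpa, C, [], by simp, by simpa, by simp,
      ?_, ?_, ?_, ?_, rfl⟩
    · simp [show y ≠ 22 by omega, show y ≠ 14 by omega, show y ≠ 13 by omega]
    · simp [MState.setArr_arr_of_ne _ _ _ (show a ≠ 6 by omega),
        MState.setArr_arr_of_ne _ _ _ (show a ≠ 7 by omega)]
    · simp [RightStack, h₁₁]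
    · simp [RightStack, hn]
    · simpa [h₁₁]
    · simpa [hn]
  · rintro s' k ⟨hf, ha, h₁₃, C₁, C₂, hCC, h₂₂, -⟩
    have : C₁.length ≤ C.length := by simp [hCC]
    simp
    omega
  · rintro s' k ⟨hf, ha, h₁₃, C₁, C₂, hCC, h₂₂, h₁₄, hr₁, hr₂, hl₁, hl₂, rfl⟩ hb
    have hb : 0 < s'.reg 22 := Nat.pos_of_ne_zero (by simpa using hb)
    have hlen : C.length = C₁.length + C₂.length := by simp [hCC]
    obtain rfl | ⟨C₁, c, rfl⟩ := List.eq_nil_or_concat C₁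
    · simp at h₂₂
      omega
    simp only [List.concat_eq_append, List.length_append, List.length_singleton] at *
    -- Since `C` is a common subsequence, the rightmost embeddings of its suffix leave room for the
    -- rest. So the queries always succeed, and the stack never falls below `lo` or `mid`.
    have s₁ := hr₁.of_append (lo := lo) (hCC ▸ h₁)
    have s₂ := hr₂.of_append (lo := mid) (hCC ▸ h₂)
    have m₁ := s₁.subset (show c ∈ C₁ ++ [c] by simp)
    have m₂ := s₂.subset (show c ∈ C₁ ++ [c] by simp)
    have hcS := mem_of_mem_seg m₁
    have hcW := h.letters c hcS
    have hi : Indexed W S s' := h.congr (hf 0 (by norm_num)) fun a ha' => ha a (by omega)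
    have hc : s'.arr 5 C₁.length = c := by
      rw [ha 5 (by norm_num)]
      exact hC₂ _ _ (by simp [hCC])
    have u₁ := hr₁.sublist.1
    have u₂ := hr₂.sublist.1
    refine Run.cons (Run.assign (by simp; omega) (Run.cons (Run.assign
      (by simp [h₂₂, hc]; omega) (Run.cons ?_))))
    simp only [RExpr.val_arr, RExpr.val_reg, RExpr.val_sub, RExpr.val_num, MState.setReg_reg,
      MState.setReg_arr, h₂₂, if_true, Nat.add_sub_cancel, hc]
    refine (run_load (by simp; omega) (by simp [h₁₄]; omega) (by simp [h₁₄]; omega)).mono ?_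
    rintro s₁ t₁ ⟨ha₁, hf₁, h₁₆, h₁₇, ht₁⟩
    simp [h₁₄] at ha₁ h₁₆ h₁₇
    have f₀ := hf₁ 0 (by norm_num) (by norm_num)
    have f₁₄ := hf₁ 14 (by norm_num) (by norm_num)
    have f₁₈ := hf₁ 18 (by norm_num) (by norm_num)
    simp at f₀ f₁₄ f₁₈
    refine Run.cons ((run_try (hi.congr f₀ (by simp [ha₁])) (by rwa [f₁₈]) (by omega)
      (by omega)).mono ?_)
    rintro s₂ t₂ ⟨ha₂, hf₂, p₁, p₂, ht₂⟩
    rw [f₁₈] at p₁ p₂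
    have g₁₄ := hf₂ 14 (by norm_num) (by norm_num) (by norm_num)
    have l₁ := p₁.le
    have l₂ := p₂.le
    have lt₁ := p₁.lt_iff.2 (h₁₆ ▸ m₁)
    have lt₂ := p₂.lt_iff.2 (h₁₇ ▸ m₂)
    have o₁ := p₁.prevOcc lt₁
    have o₂ := p₂.prevOcc lt₂
    refine Run.cons ((run_push (by omega) (by omega) (by omega)).mono ?_)
    rintro s₃ t₃ ⟨hf₃, k₁₄, hlow, c₆, c₇, k₆, k₇, ht₃⟩
    have e₁₄ : s₂.reg 14 = C₂.length := by rw [g₁₄, f₁₄, h₁₄]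
    rw [e₁₄] at k₁₄ c₆ c₇ k₆ k₇
    rw [ha₂, ha₁] at c₆ c₇
    rw [h₁₆, ← k₆] at o₁
    rw [h₁₇, ← k₇] at o₂
    have low : ∀ y < 14, s₃.reg y = s'.reg y := by
      intro y hy
      have e₁ := hf₁ y (by omega) (by omega)
      simp [show y ≠ 22 by omega, show y ≠ 18 by omega] at e₁
      rw [hf₃ y (by omega), hf₂ y (by omega) (by omega) (by omega), e₁]
    refine Run.nil ⟨260 * lg S.length * C₁.length + 4, ⟨fun y hy => ?_, fun a ha' => ?_, ?_, C₁,
      c :: C₂, by simp [hCC], ?_, k₁₄, hr₁.push c₆ o₁, hr₂.push c₇ o₂, ?_, ?_, rfl⟩, ?_⟩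
    · rw [low y (by omega), hf y hy]
    · rw [hlow a ha', ha₂, ha₁, ha a ha']
    · rw [low 13 (by norm_num), h₁₃]
    · have e₁ := hf₁ 22 (by norm_num) (by norm_num)
      simp at e₁
      rw [hf₃ 22 (by norm_num), hf₂ 22 (by norm_num) (by norm_num) (by norm_num), e₁]
    · rw [List.length_cons, k₆]
      omega
    · rw [List.length_cons, k₇]
      omega
    · simp only [RExpr.cost_reg, RExpr.cost_num, RExpr.cost_sub, RExpr.cost_arr, RExpr.cost_lt,
        Nat.mul_add]
      omega
  · rintro s' k ⟨-, -, -, C₁, C₂, -, -, -, -, -, -, -, rfl⟩ -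
    simp
  · rintro s' t k ⟨hf, ha, h₁₃, C₁, C₂, hCC, h₂₂, h₁₄, hr₁, hr₂, hl₁, hl₂, -⟩ hb ht
    have hb : s'.reg 22 = 0 := by simpa using hb
    obtain rfl : C₁ = [] := List.length_eq_zero_iff.1 (by omega)
    obtain rfl : C = C₂ := by simpa using hCC
    refine Run.nil ⟨hf, ha, h₁₃, h₁₄, hr₁, hr₂, hl₁, hl₂, ?_⟩
    have : 260 * lg S.length * C.length ≤ 260 * lg S.length * S.length :=
      Nat.mul_le_mul_left _ hCn
    simp
    nlinarith

theorem run_mcs (h : Indexed W S s) (hlo : lo ≤ mid) (hmid : mid ≤ S.length)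
    (h₁₀ : s.reg 10 = lo) (h₁₁ : s.reg 11 = mid) (hC : Holds s C)
    (h₁ : C.Sublist (seg S lo mid)) (h₂ : C.Sublist (seg S mid S.length)) :
    Run W mcsProg s fun s' t => (∀ y < 10, s'.reg y = s.reg y) ∧
      (∀ a < 5, s'.arr a = s.arr a) ∧
      (∃ R, IsMCSContaining (seg S lo mid) (seg S mid S.length) C R ∧ Holds s' R) ∧
      t ≤ 3000 * (S.length + 1) * lg S.length := by
  have hlg := one_le_lg S.length
  refine Run.cons ((run_embed h hlo hmid h₁₁ hC h₁ h₂).mono ?_)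
  rintro s₁ t₁ ⟨hf₁, ha₁, h₁₃, h₁₄, hr₁, hr₂, hl₁, hl₂, ht₁⟩
  have g₁₀ := hf₁ 10 (by norm_num)
  refine Run.cons (Run.assign (by simp) (Run.cons (Run.assign (by simp) (Run.cons
    (Run.assign (by simp; have := h.bound; omega) (Run.cons ?_))))))
  -- Initially `mcsRank` is at most 3n, hence at most 3n + 1 rounds including the one that stops. A
  -- round with its test takes at most 610 lg n steps; the final test takes 2.
  refine Run.loop (k := (3 * S.length + 1) * (610 * lg S.length) + 2) (fun s' k => ∃ P R,
    MCSInv W S lo mid C s s' P R ∧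
    (s'.reg 21 = 1 ∧ (mcsRank S P R s' + 1) * (610 * lg S.length) + 2 ≤ k ∨
      s'.reg 21 = 0 ∧ IsMCSContaining (seg S lo mid) (seg S mid S.length) C P ∧ 2 ≤ k))
    ?_ ?_ ?_ ?_ ?_
  · refine ⟨[], C, ⟨h.congr ?_ fun a ha => ?_, hmid, fun y hy => ?_, fun a ha => ?_, by simpa,
      ⟨by simp, by simp⟩, ?_⟩, ?_⟩
    · simpa using hf₁ 0 (by norm_num)
    · simpa using ha₁ a (by omega)
    · simpa [show y ≠ 21 by omega, show y ≠ 15 by omega, show y ≠ 12 by omega] using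
        hf₁ y (by omega)
    · simpa using ha₁ a (by omega)
    · simp [g₁₀, h₁₀, h₁₃]
      exact MCSState.init hr₁ hr₂ hl₁ hl₂
    · refine Or.inl ⟨by simp, Nat.add_le_add_right (Nat.mul_le_mul_right _ ?_) 2⟩
      unfold mcsRank
      omega
  · rintro s' k ⟨P, R, hI, hk⟩
    have := h.bound
    simp
    omega
  · rintro s' k ⟨P, R, hI, hk⟩ hb
    have hb : s'.reg 21 ≠ 0 := by simpa using hb
    obtain ⟨hgo, hk⟩ : s'.reg 21 = 1 ∧ _ := hk.resolve_right fun hk => hb hk.1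
    refine (run_round hI hgo).mono ?_
    rintro s₂ t₂ ⟨ht₂, P', R', hI', h' | h'⟩
    · refine ⟨_, ⟨P', R', hI', Or.inl ⟨h'.1, le_rfl⟩⟩, ?_⟩
      have : (mcsRank S P' R' s₂ + 1) * (610 * lg S.length) + 610 * lg S.length ≤
          (mcsRank S P R s' + 1) * (610 * lg S.length) := by
        rw [← Nat.succ_mul]
        exact Nat.mul_le_mul_right _ (by omega)
      simp
      omega
    · refine ⟨2, ⟨P', R', hI', Or.inr ⟨h'.1, h'.2, le_rfl⟩⟩, ?_⟩
      rw [Nat.add_mul] at hk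
      simp
      omega
  · rintro s' k ⟨P, R, hI, hk⟩ hb
    have hb : s'.reg 21 = 0 := by simpa using hb
    simp
    omega
  · rintro s' t k ⟨P, R, hI, hk⟩ hb ht
    have hb : s'.reg 21 = 0 := by simpa using hb
    have hk := hk.resolve_left (by omega)
    refine Run.nil ⟨hI.frame, hI.frame_arr, ⟨P, hk.2.1, hI.holds⟩, ?_⟩
    simp
    nlinarith

/-- Compute in register `30` the end of the leftmost embedding of the string in array `5` into the
part of `S` that starts at the position in register `30`; the result is `n + 1` if there is none. -/
def matchProg : RStmt := .block [
  .assign 22 (.num 0),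
  .loop (.lt (.reg 22) (.reg 12)) (.block [
    .assign 50 (.arr 5 (.reg 22)),
    .assign 51 (.reg 30),
    nextProg,
    .assign 30 (.reg 52),
    .assign 22 (.reg 22 + .num 1)])]

/-- The last letter pins the end down. For the empty string the least end is 0, not the start `f` of
the embedding; hence the condition `Y ≠ []` in `MatchResult`. -/
theorem LeftEnd.isAnchor_snoc {f a y : ℕ} {P : List ℕ} {c : ℕ} (h : LeftEnd S f P a)
    (hy : NextOcc S c a y) : IsAnchor S f (P ++ [c]) (y + 1) :=
  ⟨(h.snoc hy).sublist, fun j hj => (hy.of_cons_sublist (h.of_append [c] j hj)).1⟩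

/-- The result of `matchProg`. -/
def MatchResult (S : List ℕ) (x : ℕ) (Y : List ℕ) (r : ℕ) : Prop :=
  LeftEnd S x Y r ∧ (Y ≠ [] → IsAnchor S x Y r) ∧ r ≤ S.length ∨
    r = S.length + 1 ∧ ¬ Y.Sublist (seg S x S.length)

theorem MatchResult.le_iff {x r : ℕ} {Y : List ℕ} (h : MatchResult S x Y r) :
    r ≤ S.length ↔ Y.Sublist (seg S x S.length) := by
  rcases h with ⟨h₁, -, h₂⟩ | ⟨rfl, h⟩
  · exact iff_of_true h₂ (h₁.sublist.trans (seg_mono S le_rfl h₂))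
  · exact iff_of_false (by omega) h

theorem MatchResult.eq_of_isAnchor {x r j : ℕ} {Y : List ℕ} (h : MatchResult S x Y r)
    (hY : Y ≠ []) (hj : IsAnchor S x Y j) : r = j := by
  rcases h with ⟨-, h₁, -⟩ | ⟨-, h⟩
  · exact le_antisymm ((h₁ hY).2 _ hj.1) (hj.2 _ (h₁ hY).1)
  · exact absurd (hj.1.trans (seg_mono S le_rfl hj.le_length)) h

theorem run_match {Y : List ℕ} (h : Indexed W S s) (hY : Holds s Y) (hYS : ∀ c ∈ Y, c ∈ S)
    (hYn : Y.length ≤ S.length) (hx : s.reg 30 ≤ S.length) :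
    Run W matchProg s fun s' t => (∀ y < 22, s'.reg y = s.reg y) ∧ s'.arr = s.arr ∧
      MatchResult S (s.reg 30) Y (s'.reg 30) ∧ t ≤ 200 * (S.length + 1) * lg S.length := by
  have hW := h.bound
  have hlg := one_le_lg S.length
  obtain ⟨hY₁, hY₂⟩ := hY
  refine Run.cons (Run.assign (by simp) (Run.cons ?_))
  refine Run.loop (k := Y.length * (110 * lg S.length) + 4) (fun s' k =>
    (∀ y < 22, s'.reg y = s.reg y) ∧ s'.arr = s.arr ∧ ∃ P Q, Y = P ++ Q ∧
      s'.reg 22 = P.length ∧ (LeftEnd S (s.reg 30) P (s'.reg 30) ∧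
        (P ≠ [] → IsAnchor S (s.reg 30) P (s'.reg 30)) ∧ s'.reg 30 ≤ S.length ∨
        s'.reg 30 = S.length + 1 ∧ ¬ Y.Sublist (seg S (s.reg 30) S.length)) ∧
      k = Q.length * (110 * lg S.length) + 4) ?_ ?_ ?_ ?_ ?_
  · refine ⟨fun y hy => ?_, rfl, [], Y, rfl, by simp, Or.inl ⟨?_, by simp, by simpa⟩, rfl⟩
    · simp [show y ≠ 22 by omega]
    · simpa using LeftEnd.nil S (s.reg 30)
  · rintro s' k ⟨hf, ha, P, Q, rfl, h₂₂, -⟩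
    rw [List.length_append] at hYn hY₁
    simp [hf]
    omega
  · rintro s' k ⟨hf, ha, P, Q, rfl, h₂₂, hres, rfl⟩ hb
    have hb : s'.reg 22 < s'.reg 12 := by simpa using hb
    have f₁₂ := hf 12 (by norm_num)
    rw [List.length_append] at hYn hY₁
    obtain _ | ⟨c, Q⟩ := Q
    · simp at hY₁
      omega
    have hcS := hYS c (by simp)
    have hcW := h.letters c hcS
    have hc : s.arr 5 P.length = c := hY₂ _ _ (by simp)
    have h₃₀ : s'.reg 30 ≤ S.length + 1 := by
      rcases hres with hres | hres <;> omega
    refine Run.cons (Run.assign (by simp [ha, h₂₂, hc]; omega) (Run.cons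
      (Run.assign (by simp; omega) (Run.cons ?_))))
    refine (run_next (h.congr (by simpa using hf 0 (by norm_num)) (by simp [ha]))
      (by simpa [ha, h₂₂, hc]) (by simp; omega)).mono ?_
    rintro s₁ t₁ ⟨ha₁, hf₁, hr, ht₁⟩
    simp [ha, h₂₂, hc] at ha₁ hr
    have f₂₂ := hf₁ 22 (by norm_num)
    simp at f₂₂
    have h₅₂ : s₁.reg 52 ≤ S.length + 1 := by
      rcases hr with ⟨e, -⟩ | ⟨y, e, hy⟩
      · exact e.le
      · have := (List.getElem?_eq_some_iff.1 hy.2.1).1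
        omega
    rw [List.length_cons] at hYn
    refine Run.cons (Run.assign (by simp; omega) (Run.cons (Run.assign (by simp; omega)
      (Run.nil ⟨Q.length * (110 * lg S.length) + 4, ⟨fun y hy => ?_, by simp [ha₁],
        P ++ [c], Q, by simp, ?_, ?_, rfl⟩, ?_⟩))))
    · have e := hf₁ y (by omega)
      simp [show y ≠ 50 by omega, show y ≠ 51 by omega] at e
      simp [show y ≠ 22 by omega, show y ≠ 30 by omega, e, hf y hy]
    · simp [f₂₂, h₂₂]
    · simp only [MState.setReg_reg, Nat.reduceEqDiff, if_true, if_false, RExpr.val_reg]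
      rcases hres with ⟨hl, -, -⟩ | ⟨e₃₀, hno⟩
      · rcases hr with ⟨e, hno⟩ | ⟨y, e, hy⟩
        · refine Or.inr ⟨e, fun hs => hno ((hl.of_append _ _ hs).subset List.mem_cons_self)⟩
        · have := (List.getElem?_eq_some_iff.1 hy.2.1).1
          rw [e]
          exact Or.inl ⟨hl.snoc hy, fun _ => hl.isAnchor_snoc hy, this⟩
      -- A failure persists: from n + 1 on no letter occurs, so every later query returns n + 1
      -- again.
      · rcases hr with ⟨e, -⟩ | ⟨y, e, hy⟩
        · exact Or.inr ⟨e, hno⟩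
        · have := (List.getElem?_eq_some_iff.1 hy.2.1).1
          have := hy.1
          omega
    · rw [List.length_cons, Nat.add_one_mul Q.length]
      simp
      omega
  · rintro s' k ⟨-, -, P, Q, -, -, -, rfl⟩ -
    simp
  · rintro s' t k ⟨hf, ha, P, Q, rfl, h₂₂, hres, -⟩ hb ht
    have hb : s'.reg 12 ≤ s'.reg 22 := by simpa using hb
    have f₁₂ := hf 12 (by norm_num)
    have : (P ++ Q).length * (110 * lg S.length) ≤ S.length * (110 * lg S.length) :=
      Nat.mul_le_mul_right _ hYn
    rw [List.length_append] at hY₁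
    obtain rfl : Q = [] := List.length_eq_zero_iff.1 (by omega)
    simp only [List.append_nil] at *
    refine Run.nil ⟨hf, ha, hres, ?_⟩
    simp
    nlinarith

/-- Replace the string `C` in array `5` by a maximal common subsequence `Y` of `S[lo, mid)` and
`S[mid, n)` that contains it, for the bounds `lo` and `mid` in the registers `8` and `9`. If the
register `7` is not `0`, and if `Y` is a subsequence of `S[mid', n)` for the bound `mid'` in the
register `6`, do the same with `Y` and `mid'` instead of `C` and `mid`. -/
def stageProg : RStmt := .block [
  .assign 10 (.reg 8),
  .assign 11 (.reg 9),
  mcsProg,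
  .ite (.reg 7)
    (.block [
      .assign 30 (.reg 6),
      matchProg,
      .ite (.lt (.reg 0) (.reg 30)) .skip (.block [
        .assign 10 (.reg 8),
        .assign 11 (.reg 6),
        mcsProg])])
    .skip]

/-- Both algorithms have this shape, with (lo, mid, mid') equal to (q₁, qa, qb) and (0, j₁, j₂). The
postcondition is phrased so that it unfolds to `FirstResult` and to `SecondResult`. -/
theorem run_stage {odd : Prop} [Decidable odd] {mid' : ℕ} (h : Indexed W S s) (h₈ : s.reg 8 = lo)
    (h₉ : s.reg 9 = mid) (h₆ : odd → s.reg 6 = mid') (h₇ : s.reg 7 ≠ 0 ↔ odd) (h₇' : s.reg 7 ≤ 1)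
    (hlo : lo ≤ mid) (hmid : mid ≤ S.length) (hmid' : odd → mid ≤ mid' ∧ mid' ≤ S.length)
    (hC : Holds s C) (h₁ : C.Sublist (seg S lo mid)) (h₂ : C.Sublist (seg S mid S.length)) :
    Run W stageProg s fun s' t => (∀ y < 10, s'.reg y = s.reg y) ∧
      (∀ a < 5, s'.arr a = s.arr a) ∧
      (∃ Y₀ Y, IsMCSContaining (seg S lo mid) (seg S mid S.length) C Y₀ ∧
        (if odd ∧ Y₀.Sublist (seg S mid' S.length) then
          IsMCSContaining (seg S lo mid') (seg S mid' S.length) Y₀ Y else Y = Y₀) ∧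
        Holds s' Y) ∧
      t ≤ 7000 * (S.length + 1) * lg S.length := by
  have hW := h.bound
  have hn := h.length
  have hX : 1 ≤ (S.length + 1) * lg S.length := Nat.mul_pos (Nat.succ_pos _) (one_le_lg _)
  simp only [Nat.mul_assoc]
  refine Run.cons (Run.assign (by simp; omega) (Run.cons (Run.assign (by simp; omega)
    (Run.cons ?_))))
  refine (run_mcs (lo := lo) (mid := mid) (C := C) (h.congr (by simp) (by simp)) hlo hmid
    (by simpa) (by simpa) (by simpa [Holds] using hC) h₁ h₂).mono ?_
  rintro s₁ t₁ ⟨hf₁, ha₁, ⟨Y₀, hY₀, hH₀⟩, ht₁⟩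
  simp only [Nat.mul_assoc] at ht₁
  have low : ∀ y < 10, s₁.reg y = s.reg y := by
    intro y hy
    simpa [show y ≠ 10 by omega, show y ≠ 11 by omega] using hf₁ y hy
  have e₇ := low 7 (by norm_num)
  have e₆ := low 6 (by norm_num)
  have e₈ := low 8 (by norm_num)
  have e₀ := low 0 (by norm_num)
  refine Run.cons (Run.ite (by simp; omega) ?_ ?_)
  · intro hb
    have hodd : odd := h₇.1 (by rw [← e₇]; exact hb)
    obtain ⟨m₁, m₂⟩ := hmid' hodd
    have h₆ := h₆ hodd
    have hi : Indexed W S s₁ := h.congr e₀ fun a ha => by simpa using ha₁ a (by omega)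
    refine Run.cons (Run.assign (by simp; omega) (Run.cons ?_))
    refine (run_match (Y := Y₀) (hi.congr (by simp) (by simp)) (by simpa [Holds] using hH₀)
      (fun c hc => mem_of_mem_seg (hY₀.1.subset hc))
      ((hY₀.1.length_le.trans (length_seg_le S lo mid)).trans (by omega))
      (by simp; omega)).mono ?_
    rintro s₂ t₂ ⟨hf₂, ha₂, hr, ht₂⟩
    simp [e₆, h₆] at hr ha₂
    simp only [Nat.mul_assoc] at ht₂
    have low₂ : ∀ y < 22, s₂.reg y = s₁.reg y := by
      intro y hy
      simpa [show y ≠ 30 by omega] using hf₂ y hy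
    have g₀ := low₂ 0 (by norm_num)
    have g₆ := low₂ 6 (by norm_num)
    have g₈ := low₂ 8 (by norm_num)
    have g₁₂ := low₂ 12 (by norm_num)
    have h₃₀ : s₂.reg 30 ≤ S.length + 1 := by
      rcases hr with hr | hr <;> omega
    have hH₂ : Holds s₂ Y₀ := ⟨g₁₂.trans hH₀.1, by rw [ha₂]; exact hH₀.2⟩
    refine Run.cons (Run.ite (by simp; omega) ?_ ?_)
    · intro hb'
      have hb' : ¬ s₂.reg 30 ≤ s₂.reg 0 := by simpa using hb'
      rw [g₀, e₀, hn, hr.le_iff] at hb'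
      refine Run.skip (Run.nil (Run.nil ⟨fun y hy => ?_, fun a ha => ?_, ⟨Y₀, Y₀, hY₀, ?_, hH₂⟩,
        ?_⟩))
      · rw [low₂ y (by omega), low y hy]
      · rw [ha₂]
        simpa using ha₁ a ha
      · rw [if_neg fun hc => hb' hc.2]
      · simp
        omega
    · intro hb'
      have hb' : s₂.reg 30 ≤ s₂.reg 0 := by simpa using hb'
      rw [g₀, e₀, hn, hr.le_iff] at hb'
      refine Run.cons (Run.assign (by simp; omega) (Run.cons (Run.assign (by simp; omega)
        (Run.cons ?_))))
      refine (run_mcs (lo := lo) (mid := mid') (C := Y₀) (hi.congr (by simpa) (by simp [ha₂]))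
        (by omega) m₂ (by simp; omega) (by simp; omega) (by simpa [Holds] using hH₂)
        (hY₀.1.trans (seg_mono S le_rfl m₁)) hb').mono ?_
      rintro s₃ t₃ ⟨hf₃, ha₃, ⟨Y, hY, hH⟩, ht₃⟩
      simp only [Nat.mul_assoc] at ht₃
      refine Run.nil (Run.nil (Run.nil ⟨fun y hy => ?_, fun a ha => ?_, ⟨Y₀, Y, hY₀, ?_, hH⟩,
        ?_⟩))
      · rw [hf₃ y hy]
        simp [show y ≠ 10 by omega, show y ≠ 11 by omega]
        rw [low₂ y (by omega), low y hy]
      · rw [ha₃ a ha]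
        simp only [MState.setReg_arr, ha₂]
        simpa using ha₁ a ha
      · rwa [if_pos ⟨hodd, hb'⟩]
      · simp
        omega
  · intro hb
    have hodd : ¬ odd := fun ho => h₇.2 ho (by rw [← e₇]; exact hb)
    refine Run.skip (Run.nil ⟨low, fun a ha => by simpa using ha₁ a ha, ⟨Y₀, Y₀, hY₀, ?_, hH₀⟩,
      ?_⟩)
    · rw [if_neg fun hc => hodd hc.1]
    · simp
      omega

end Stages

/-! ### Building the occurrence lists in linear time and choosing a letter -/

section Indexing

/-- Count the occurrences of each letter. -/
def countProg : RStmt := .block [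
  .assign 40 (.num 0),
  .loop (.lt (.reg 40) (.reg 0)) (.block [
    .store 1 (.arr 0 (.reg 40)) (.arr 1 (.arr 0 (.reg 40)) + .num 1),
    .assign 40 (.reg 40 + .num 1)])]

/-- List the positions of each letter, in one block for each letter. -/
def listProg : RStmt := .block [
  .assign 40 (.num 0),
  .assign 41 (.num 0),
  .loop (.lt (.reg 40) (.reg 0)) (.block [
    .assign 42 (.arr 0 (.reg 40)),
    .ite (.arr 4 (.reg 42)) .skip (.block [
      .store 2 (.reg 42) (.reg 41),
      .assign 41 (.reg 41 + .arr 1 (.reg 42))]),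
    .store 3 (.arr 2 (.reg 42) + .arr 4 (.reg 42)) (.reg 40),
    .store 4 (.reg 42) (.arr 4 (.reg 42) + .num 1),
    .assign 40 (.reg 40 + .num 1)])]

/-- If the letter in register `1` occurs less than twice, replace it by one that occurs at least
twice, if there is one. -/
def selectProg : RStmt :=
  .ite (.lt (.arr 1 (.reg 1)) (.num 2))
    (.block [
      .assign 40 (.num 0),
      .loop (.lt (.reg 40) (.reg 0)) (.block [
        .assign 42 (.arr 0 (.reg 40)),
        .ite (.lt (.arr 1 (.reg 42)) (.num 2)) .skip (.assign 1 (.reg 42)),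
        .assign 40 (.reg 40 + .num 1)])])
    .skip

/-- The number of positions whose letter occurs for the first time before position `i`. -/
def blockStart (S : List ℕ) (i : ℕ) : ℕ := S.countP fun x => S.idxOf x < i

theorem countP_add_countP_le {α : Type*} {p q r : α → Bool} {l : List α}
    (hp : ∀ x, p x → r x) (hq : ∀ x, q x → r x) (hpq : ∀ x, p x → ¬ q x) :
    l.countP p + l.countP q ≤ l.countP r := by
  induction l with
  | nil => simp
  | cons a l ih =>
    have h : (if p a then 1 else 0) + (if q a then 1 else 0) ≤ if r a then 1 else 0 := by
      have h₁ := hp a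
      have h₂ := hq a
      have h₃ := hpq a
      revert h₁ h₂ h₃
      cases p a <;> cases q a <;> cases r a <;> simp
    simp only [List.countP_cons]
    omega

theorem countP_le_countP_add {α : Type*} {p q r : α → Bool} {l : List α}
    (h : ∀ x ∈ l, r x → p x ∨ q x) : l.countP r ≤ l.countP p + l.countP q := by
  induction l with
  | nil => simp
  | cons a l ih =>
    have h' : (if r a then 1 else 0) ≤ (if p a then 1 else 0) + if q a then 1 else 0 := by
      have h₁ := h a List.mem_cons_self
      revert h₁
      cases p a <;> cases q a <;> cases r a <;> simp
    have ih := ih fun x hx => h x (List.mem_cons_of_mem a hx)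
    simp only [List.countP_cons]
    omega

/-- Blocks are ordered by the first occurrence of their letters and do not overlap: the positions
counted on the left carry letters that start earlier than `c`, or `c` itself. -/
theorem blockStart_add_count_le (S : List ℕ) (c : ℕ) {i : ℕ} (h : S.idxOf c < i) :
    blockStart S (S.idxOf c) + S.count c ≤ blockStart S i := by
  refine countP_add_countP_le (fun x hx => ?_) (fun x hx => ?_) fun x hx hx' => ?_
  · simp only [decide_eq_true_eq] at hx ⊢
    omega
  · rw [beq_iff_eq.1 hx]
    simpa
  · rw [beq_iff_eq.1 hx'] at hx
    simp at hx

theorem blockStart_le_length (S : List ℕ) (i : ℕ) : blockStart S i ≤ S.length :=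
  List.countP_le_length

theorem blockStart_idxOf_add_count_le (S : List ℕ) (c : ℕ) :
    blockStart S (S.idxOf c) + S.count c ≤ S.length :=
  (blockStart_add_count_le S c (Nat.lt_succ_self _)).trans (blockStart_le_length S _)

variable {S : List ℕ}

theorem idxOf_lt_iff {c i : ℕ} (hi : i ≤ S.length) :
    S.idxOf c < i ↔ 0 < (S.take i).count c := by
  rw [List.count_pos_iff]
  constructor
  · intro h
    have hlt := h.trans_le hi
    rw [← List.getElem_idxOf hlt]
    rw [List.mem_iff_getElem]
    exact ⟨S.idxOf c, by simp; omega, by simp⟩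
  · intro h
    have := List.idxOf_lt_length_of_mem h
    rw [← List.idxOf_append_of_mem (l₂ := S.drop i) h, List.take_append_drop,
      List.length_take] at this
    omega

/-- Justifies the running counter of `listProg`: it grows only at the first occurrence of a letter,
and then by the length of the new block. -/
theorem blockStart_succ {i c : ℕ} (h : S[i]? = some c) :
    blockStart S (i + 1) =
      blockStart S i + if (S.take i).count c = 0 then S.count c else 0 := by
  have hi : i < S.length := (List.getElem?_eq_some_iff.1 h).1
  have hc : S.idxOf c < i + 1 := by
    rw [idxOf_lt_iff hi, count_take_succ S i h]
    simp
  have key : ∀ x ∈ S, S.idxOf x = i → x = c := by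
    intro x hx hxi
    have := List.getElem?_eq_getElem (List.idxOf_lt_length_of_mem hx)
    rw [List.getElem_idxOf, hxi, h] at this
    exact (Option.some_injective _ this).symm
  split_ifs with h₀
  · have hci : S.idxOf c = i := by
      have : ¬ S.idxOf c < i := by rw [idxOf_lt_iff hi.le]; omega
      omega
    refine le_antisymm ?_ ?_
    · refine countP_le_countP_add fun x hx hlt => ?_
      simp only [decide_eq_true_eq, beq_iff_eq] at hlt ⊢
      rcases Nat.lt_succ_iff_lt_or_eq.1 hlt with hlt | heq
      · exact Or.inl hlt
      · exact Or.inr (key x hx heq)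
    · have := blockStart_add_count_le S c hc
      rwa [hci] at this
  · unfold blockStart
    rw [Nat.add_zero]
    refine List.countP_congr fun x hx => ?_
    have hlt : S.idxOf c < i := by rw [idxOf_lt_iff hi.le]; omega
    simp only [decide_eq_true_eq]
    constructor
    · intro hx'
      rcases Nat.lt_succ_iff_lt_or_eq.1 hx' with h' | h'
      · exact h'
      · rw [key x hx h'] at h'
        omega
    · omega

/-- Different positions of `S` get different cells, so no entry of the list is overwritten later. -/
theorem eq_of_blockStart_add_eq {c c' k k' y y' : ℕ} (h : IsOcc S c k y) (h' : IsOcc S c' k' y')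
    (he : blockStart S (S.idxOf c) + k = blockStart S (S.idxOf c') + k') : y = y' := by
  have hk := h.lt_count
  have hk' := h'.lt_count
  rcases lt_trichotomy (S.idxOf c) (S.idxOf c') with hlt | heq | hlt
  · have := blockStart_add_count_le S c hlt
    omega
  · obtain rfl : c = c' := by
      have h₁ := List.getElem?_eq_getElem
        (List.idxOf_lt_length_of_mem (List.mem_of_getElem? h.1))
      have h₂ := List.getElem?_eq_getElem
        (List.idxOf_lt_length_of_mem (List.mem_of_getElem? h'.1))
      rw [List.getElem_idxOf] at h₁ h₂
      rw [heq, h₂] at h₁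
      exact (Option.some_injective _ h₁).symm
    obtain rfl : k = k' := by omega
    exact h.unique h'
  · have := blockStart_add_count_le S c' hlt
    omega

variable {W : ℕ} {s : MState}

theorem run_count (hn : s.reg 0 = S.length) (hW : 4 * S.length + 10 ≤ W)
    (hS : ∀ c ∈ S, c ≤ W) (hstr : ∀ i c, S[i]? = some c → s.arr 0 i = c)
    (h₁ : ∀ c, s.arr 1 c = 0) :
    Run W countProg s fun s' t => (∀ y < 40, s'.reg y = s.reg y) ∧
      (∀ a, a ≠ 1 → s'.arr a = s.arr a) ∧ (∀ c, s'.arr 1 c = S.count c) ∧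
      t ≤ 40 * (S.length + 1) := by
  refine Run.cons (Run.assign (by simp) (Run.cons ?_))
  refine Run.loop (k := 30 * S.length + 4) (fun s' k => (∀ y < 40, s'.reg y = s.reg y) ∧
      (∀ a, a ≠ 1 → s'.arr a = s.arr a) ∧ ∃ i ≤ S.length, s'.reg 40 = i ∧
      (∀ c, s'.arr 1 c = (S.take i).count c) ∧ k = 30 * (S.length - i) + 4) ?_ ?_ ?_ ?_ ?_
  · refine ⟨fun y hy => ?_, fun a ha => rfl, 0, Nat.zero_le _, by simp, by simpa, rfl⟩
    simp [show y ≠ 40 by omega]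
  · rintro s' k ⟨hf, ha, i, hi, h₄₀, hc, rfl⟩
    have f₀ := hf 0 (by norm_num)
    simp
    omega
  · rintro s' k ⟨hf, ha, i, hi, h₄₀, hc, rfl⟩ hb
    have hb : s'.reg 40 < s'.reg 0 := by simpa using hb
    have f₀ := hf 0 (by norm_num)
    have hin : i < S.length := by omega
    have hi' := List.getElem?_eq_getElem hin
    have e := hstr i _ hi'
    have hcW := hS _ (List.getElem_mem hin)
    have a₀ := ha 0 (by norm_num)
    have hcn : (S.take i).count S[i] ≤ S.length := (count_take_le S _ i).trans List.count_le_length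
    refine Run.cons (Run.store (by simp [h₄₀, a₀, e]; omega) (by simp [h₄₀, a₀, e, hc]; omega)
      (Run.cons (Run.assign (by simp; omega) (Run.nil ⟨30 * (S.length - (i + 1)) + 4,
        ⟨fun y hy => ?_, fun a ha' => ?_, i + 1, hin, ?_, fun c => ?_, rfl⟩, ?_⟩))))
    · simpa [show y ≠ 40 by omega] using hf y hy
    · simpa [MState.setArr_arr_of_ne _ _ _ ha'] using ha a ha'
    · simp [h₄₀]
    · rw [count_take_succ S i hi']
      simp [h₄₀, a₀, e, hc]
      split_ifs with h₁ h₂ h₂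
      · rw [h₁]
      · exact absurd h₁.symm h₂
      · exact absurd h₂.symm h₁
      · rfl
    · simp
      omega
  · rintro s' k ⟨hf, ha, i, hi, h₄₀, hc, rfl⟩ -
    simp
  · rintro s' t k ⟨hf, ha, i, hi, h₄₀, hc, -⟩ hb ht
    have hb : s'.reg 0 ≤ s'.reg 40 := by simpa using hb
    have f₀ := hf 0 (by norm_num)
    obtain rfl : i = S.length := by omega
    refine Run.nil ⟨hf, ha, by simpa using hc, ?_⟩
    simp
    omega

theorem run_list (hn : s.reg 0 = S.length) (hW : 4 * S.length + 10 ≤ W)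
    (hS : ∀ c ∈ S, c ≤ W) (hstr : ∀ i c, S[i]? = some c → s.arr 0 i = c)
    (hcnt : ∀ c, s.arr 1 c = S.count c) (h₄ : ∀ c, s.arr 4 c = 0) :
    Run W listProg s fun s' t => (∀ y < 40, s'.reg y = s.reg y) ∧ Indexed W S s' ∧
      t ≤ 80 * (S.length + 1) := by
  refine Run.cons (Run.assign (by simp) (Run.cons (Run.assign (by simp) (Run.cons ?_))))
  refine Run.loop (k := 60 * S.length + 4) (fun s' k => (∀ y < 40, s'.reg y = s.reg y) ∧
      s'.arr 0 = s.arr 0 ∧ s'.arr 1 = s.arr 1 ∧ ∃ i ≤ S.length, s'.reg 40 = i ∧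
      s'.reg 41 = blockStart S i ∧ (∀ c, s'.arr 4 c = (S.take i).count c) ∧
      (∀ c, 0 < (S.take i).count c → s'.arr 2 c = blockStart S (S.idxOf c)) ∧
      (∀ c k j, IsOcc S c k j → j < i → s'.arr 3 (blockStart S (S.idxOf c) + k) = j) ∧
      k = 60 * (S.length - i) + 4) ?_ ?_ ?_ ?_ ?_
  · refine ⟨fun y hy => ?_, rfl, rfl, 0, Nat.zero_le _, by simp, by simp [blockStart],
      by simpa, by simp, fun c k j _ hj => absurd hj (Nat.not_lt_zero j), rfl⟩
    simp [show y ≠ 40 by omega, show y ≠ 41 by omega]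
  · rintro s' k ⟨hf, ha₀, ha₁, i, hi, h₄₀, -⟩
    have f₀ := hf 0 (by norm_num)
    simp
    omega
  · rintro s' k ⟨hf, ha₀, ha₁, i, hi, h₄₀, h₄₁, hfill, hst, hocc, rfl⟩ hb
    have hb : s'.reg 40 < s'.reg 0 := by simpa using hb
    have f₀ := hf 0 (by norm_num)
    have hin : i < S.length := by omega
    have hi' := List.getElem?_eq_getElem hin
    set c := S[i]
    have e := hstr i _ hi'
    have hcW := hS c (List.getElem_mem hin)
    have hcn : (S.take i).count c ≤ S.count c := count_take_le S c i
    have hcn' : S.count c ≤ S.length := List.count_le_length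
    have hbs := blockStart_le_length S i
    have hbs' := blockStart_idxOf_add_count_le S c
    have hsucc := blockStart_succ hi'
    have o : IsOcc S c ((S.take i).count c) i := ⟨hi', rfl⟩
    refine Run.cons (Run.assign (by simp [h₄₀, ha₀, e]; omega) (Run.cons ?_))
    simp only [RExpr.val_arr, RExpr.val_reg, h₄₀, ha₀, e]
    -- Whether or not a block has just been opened, the same three instructions follow. They are
    -- treated once, from any state in which the blocks of all letters seen so far are known; `t₁`
    -- is what the branch has cost.
    suffices hmid : ∀ s₁ t₁, t₁ ≤ 20 → (∀ y < 41, s₁.reg y = s'.reg y) →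
        s₁.reg 41 = blockStart S (i + 1) → s₁.reg 42 = c →
        (∀ a, a ≠ 2 → s₁.arr a = s'.arr a) →
        (∀ c', 0 < (S.take (i + 1)).count c' → s₁.arr 2 c' = blockStart S (S.idxOf c')) →
        Run W (.block [
          .store 3 (.arr 2 (.reg 42) + .arr 4 (.reg 42)) (.reg 40),
          .store 4 (.reg 42) (.arr 4 (.reg 42) + .num 1),
          .assign 40 (.reg 40 + .num 1)]) s₁ fun s'' t' => ∃ k',
            ((∀ y < 40, s''.reg y = s.reg y) ∧
            s''.arr 0 = s.arr 0 ∧ s''.arr 1 = s.arr 1 ∧ ∃ i ≤ S.length, s''.reg 40 = i ∧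
            s''.reg 41 = blockStart S i ∧ (∀ c, s''.arr 4 c = (S.take i).count c) ∧
            (∀ c, 0 < (S.take i).count c → s''.arr 2 c = blockStart S (S.idxOf c)) ∧
            (∀ c k j, IsOcc S c k j → j < i → s''.arr 3 (blockStart S (S.idxOf c) + k) = j) ∧
            k' = 60 * (S.length - i) + 4) ∧ k' + (t₁ + t') + 10 ≤ 60 * (S.length - i) + 4 by
      refine Run.ite ?_ (fun hb' => Run.skip ?_) fun hb' => ?_
      · simp [hfill]
        omega
      · have hb' : (S.take i).count c ≠ 0 := by simpa [hfill] using hb'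
        refine (hmid _ 4 (by norm_num) ?_ ?_ ?_ ?_ ?_).mono ?_
        · intro y hy
          simp [show y ≠ 42 by omega]
        · rw [hsucc, if_neg hb']
          simpa using h₄₁
        · simp
        · intro a ha
          simp
        · intro c' hc'
          refine hst c' ?_
          rw [count_take_succ S i hi'] at hc'
          split_ifs at hc' with hcc
          · rw [← hcc]
            omega
          · simpa using hc'
        · rintro s'' t' ⟨k', hI, hle⟩
          refine ⟨k', hI, ?_⟩
          simp
          omega
      · have hb' : (S.take i).count c = 0 := by simpa [hfill] using hb'
        have a₁ : s'.arr 1 c = S.count c := by rw [ha₁, hcnt]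
        have hidx : S.idxOf c = i := by
          have h₁ : ¬ S.idxOf c < i := by rw [idxOf_lt_iff hin.le]; omega
          have h₂ : S.idxOf c < i + 1 := by
            rw [idxOf_lt_iff hin, count_take_succ S i hi']
            simp
          omega
        rw [hidx] at hbs'
        refine Run.cons (Run.store (by simp; omega) (by simp; omega) (Run.cons (Run.assign ?_
          (Run.nil ((hmid _ 20 (by norm_num) ?_ ?_ ?_ ?_ ?_).mono ?_)))))
        · have := MState.setArr_arr_of_ne (s'.setReg 42 c) (a := 2) (b := 1) c (s'.reg 41)
            (by norm_num)
          simp [h₄₁, a₁]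
          omega
        · intro y hy
          simp [show y ≠ 42 by omega, show y ≠ 41 by omega]
        · rw [hsucc, if_pos hb']
          simp [h₄₁, a₁]
        · simp
        · intro a ha
          simp [MState.setArr_arr_of_ne _ _ _ ha]
        · intro c' hc'
          simp only [MState.setReg_arr, MState.setArr_arr, true_and, RExpr.val_reg,
            MState.setReg_reg]
          rw [count_take_succ S i hi'] at hc'
          by_cases hcc : c' = c
          · simp [hcc, h₄₁, hidx]
          · rw [if_neg (fun he => hcc he.symm)] at hc'
            simpa [hcc] using hst c' hc'
        · rintro s'' t' ⟨k', hI, hle⟩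
          refine ⟨k', hI, ?_⟩
          simp
          omega
    intro s₁ t₁ ht₁ hf₁ k₄₁ k₄₂ ha hst₁
    have e₂ := hst₁ c (by rw [count_take_succ S i hi']; simp)
    have e₄ : s₁.arr 4 = s'.arr 4 := ha 4 (by norm_num)
    have e₃ : s₁.arr 3 = s'.arr 3 := ha 3 (by norm_num)
    have e₄₀ := hf₁ 40 (by norm_num)
    have e₄' := hfill c
    rw [h₄₀] at e₄₀
    refine Run.cons (Run.store (by simp [k₄₂, e₂, e₄, e₄']; omega) (by simp; omega)
      (Run.cons (Run.store (by simp; omega) (by simp [k₄₂, e₄, e₄']; omega)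
      (Run.cons (Run.assign (by simp; omega) (Run.nil ⟨60 * (S.length - (i + 1)) + 4,
        ⟨fun y hy => ?_, ?_, ?_, i + 1, hin, ?_, ?_, ?_, ?_, ?_, rfl⟩, ?_⟩))))))
    · simp [show y ≠ 40 by omega, hf₁ y (by omega), hf y hy]
    · rw [MState.setReg_arr, MState.setArr_arr_of_ne _ _ _ (by norm_num),
        MState.setArr_arr_of_ne _ _ _ (by norm_num), ha 0 (by norm_num), ha₀]
    · rw [MState.setReg_arr, MState.setArr_arr_of_ne _ _ _ (by norm_num),
        MState.setArr_arr_of_ne _ _ _ (by norm_num), ha 1 (by norm_num), ha₁]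
    · simp [e₄₀]
    · simpa using k₄₁
    · intro c'
      rw [count_take_succ S i hi']
      by_cases hcc : c' = c
      · simp [hcc, k₄₂, e₄, e₄']
      · rw [if_neg (fun he => hcc he.symm)]
        simp [k₄₂, hcc, e₄, hfill]
    · intro c' hc'
      simpa using hst₁ c' hc'
    · intro c' k j hj hji
      simp only [MState.setReg_arr, MState.setArr_arr, RExpr.val_add, RExpr.val_arr,
        RExpr.val_reg, k₄₂, e₂, e₄, e₄', e₄₀, e₃]
      simp only [Nat.reduceEqDiff, false_and, if_false, true_and]
      split_ifs with he
      · exact (eq_of_blockStart_add_eq hj o he).symm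
      · refine hocc c' k j hj (lt_of_le_of_ne (Nat.lt_succ_iff.1 hji) ?_)
        rintro rfl
        obtain rfl := Option.some_injective _ (hj.1.symm.trans hi')
        exact he (by rw [hj.2])
    · simp
      omega
  · rintro s' k ⟨hf, ha₀, ha₁, i, hi, h₄₀, h₄₁, hfill, hst, hocc, rfl⟩ -
    simp
  · rintro s' t k ⟨hf, ha₀, ha₁, i, hi, h₄₀, h₄₁, hfill, hst, hocc, -⟩ hb ht
    have hb : s'.reg 0 ≤ s'.reg 40 := by simpa using hb
    have f₀ := hf 0 (by norm_num)
    obtain rfl : i = S.length := by omega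
    rw [List.take_length] at hst
    refine Run.nil ⟨hf, ⟨f₀.trans hn, hW, hS, by rwa [ha₀], by rwa [ha₁], fun c hc => ?_,
      fun c k x hx => ?_⟩, ?_⟩
    · rw [hst c (List.count_pos_iff.2 hc)]
      exact blockStart_idxOf_add_count_le S c
    · rw [hst c (by have := hx.lt_count; omega)]
      exact hocc c k x hx hx.lt_length
    · simp
      omega

/-- The program must output a maximal square even if the given letter occurs less than twice. Any
repeated letter will do then, and if there is none, the empty square is the only one. -/
theorem run_select (h : Indexed W S s) (hσ : s.reg 1 ≤ W) :
    Run W selectProg s fun s' t => s'.arr = s.arr ∧ s'.reg 0 = s.reg 0 ∧ s'.reg 1 ≤ W ∧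
      (2 ≤ S.count (s.reg 1) → s'.reg 1 = s.reg 1) ∧
      (S.count (s'.reg 1) < 2 → ∀ c, S.count c < 2) ∧ t ≤ 60 * (S.length + 1) := by
  have hW := h.bound
  have hn := h.length
  have hcnt := h.count
  have hcn : ∀ c, S.count c ≤ S.length := fun c => List.count_le_length
  have hcn₁ := hcn (s.reg 1)
  refine Run.ite (by simp [hcnt]; omega) (fun hb => ?_) fun hb => ?_
  · have hb : S.count (s.reg 1) < 2 := by simpa [hcnt] using hb
    refine Run.cons (Run.assign (by simp) (Run.cons ?_))
    refine Run.loop (k := 40 * S.length + 4) (fun s' k => s'.arr = s.arr ∧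
      s'.reg 0 = s.reg 0 ∧ s'.reg 1 ≤ W ∧ ∃ i ≤ S.length, s'.reg 40 = i ∧
      (S.count (s'.reg 1) < 2 → ∀ c ∈ S.take i, S.count c < 2) ∧
      k = 40 * (S.length - i) + 4) ?_ ?_ ?_ ?_ ?_
    · exact ⟨rfl, by simp, by simpa, 0, Nat.zero_le _, by simp, by simp, rfl⟩
    · rintro s' k ⟨ha, h₀, h₁, i, hi, h₄₀, hc, rfl⟩
      simp
      omega
    · rintro s' k ⟨ha, h₀, h₁, i, hi, h₄₀, hc, rfl⟩ hb'
      have hb' : s'.reg 40 < s'.reg 0 := by simpa using hb'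
      have hin : i < S.length := by omega
      have hi' := List.getElem?_eq_getElem hin
      have e := h.str i _ hi'
      have hcW := h.letters _ (List.getElem_mem hin)
      have hcn₂ := hcn S[i]
      have htake : S.take (i + 1) = S.take i ++ [S[i]] := by simp
      refine Run.cons (Run.assign (by simp [ha, h₄₀, e]; omega) (Run.cons
        (Run.ite (by simp [ha, h₄₀, e, hcnt]; omega) (fun hb₂ => ?_) fun hb₂ => ?_)))
      · have hb₂ : S.count S[i] < 2 := by simpa [ha, h₄₀, e, hcnt] using hb₂
        refine Run.skip (Run.cons (Run.assign (by simp; omega) (Run.nil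
          ⟨40 * (S.length - (i + 1)) + 4,
            ⟨by simpa, by simpa, by simpa, i + 1, hin, by simp [h₄₀], ?_, rfl⟩, ?_⟩)))
        · simp only [MState.setReg_reg, Nat.reduceEqDiff, if_false, htake]
          intro hlt c hmem
          rcases List.mem_append.1 hmem with hmem | hmem
          · exact hc hlt c hmem
          · rwa [List.mem_singleton.1 hmem]
        · simp
          omega
      · have hb₂ : 2 ≤ S.count S[i] := by simpa [ha, h₄₀, e, hcnt] using hb₂
        refine Run.assign (by simp [ha, h₄₀, e]; omega) (Run.cons (Run.assign (by simp; omega)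
          (Run.nil ⟨40 * (S.length - (i + 1)) + 4,
            ⟨by simpa, by simpa, by simp [ha, h₄₀, e]; omega, i + 1, hin, by simp [h₄₀],
              ?_, rfl⟩, ?_⟩)))
        · simp [ha, h₄₀, e]
          omega
        · simp
          omega
    · rintro s' k ⟨-, -, -, i, -, -, -, rfl⟩ -
      simp
    · rintro s' t k ⟨ha, h₀, h₁, i, hi, h₄₀, hc, -⟩ hb' ht
      have hb' : s'.reg 0 ≤ s'.reg 40 := by simpa using hb'
      obtain rfl : i = S.length := by omega
      rw [List.take_length] at hc
      refine Run.nil ⟨ha, h₀, h₁, fun h₂ => by omega, fun hlt c => ?_, ?_⟩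
      · by_cases hmem : c ∈ S
        · exact hc hlt c hmem
        · rw [List.count_eq_zero_of_not_mem hmem]
          norm_num
      · simp
        omega
  · have hb : 2 ≤ S.count (s.reg 1) := by simpa [hcnt] using hb
    refine Run.skip ⟨rfl, rfl, hσ, fun _ => rfl, fun h' => by omega, ?_⟩
    simp
    omega

end Indexing

/-! ### Assembling the program and its time bound -/

section Main

/-- Write `σ ^ e` into array `5`. -/
def fillProg : RStmt := .block [
  .assign 12 (.num 0),
  .loop (.lt (.reg 12) (.reg 3)) (.block [
    .store 5 (.reg 12) (.reg 1),
    .assign 12 (.reg 12 + .num 1)])]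

/-- For the letter `σ` in register `1`, look up the positions that the first algorithm needs. -/
def lookupProg : RStmt := .block [
  .assign 2 (.arr 1 (.reg 1)),
  .assign 3 (.reg 2 / .num 2),
  .assign 4 (.arr 2 (.reg 1)),
  .assign 7 (.reg 2 - (.reg 3 + .reg 3)),
  .assign 8 (.arr 3 (.reg 4)),
  .assign 9 (.arr 3 (.reg 4 + .reg 3)),
  .ite (.reg 7) (.assign 6 (.arr 3 (.reg 4 + (.reg 3 + .num 1)))) .skip,
  fillProg]

/-- Compute the anchors that the second algorithm needs. -/
def anchorProg : RStmt := .block [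
  .assign 30 (.reg 8),
  matchProg,
  .assign 9 (.reg 30),
  .assign 30 (.arr 3 (.reg 4 + .num 1)),
  matchProg,
  .assign 6 (.reg 30),
  .assign 8 (.num 0)]

/-- Output `Z Z` for the string `Z` in array `5`. -/
def outputProg : RStmt := .block [
  .assign 22 (.num 0),
  .loop (.lt (.reg 22) (.reg 12)) (.block [
    .store 0 (.reg 22) (.arr 5 (.reg 22)),
    .store 0 (.reg 22 + .reg 12) (.arr 5 (.reg 22)),
    .assign 22 (.reg 22 + .num 1)]),
  .assign 0 (.reg 12 + .reg 12)]

/-- Both algorithms for a letter that occurs at least twice. -/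
def squareProg : RStmt := .block [lookupProg, stageProg, anchorProg, stageProg, outputProg]

/-- The whole program. -/
def maximalSquareProg : RStmt := .block [
  countProg,
  listProg,
  selectProg,
  .ite (.lt (.arr 1 (.reg 1)) (.num 2)) (.assign 0 (.num 0)) squareProg]

variable {W : ℕ} {S : List ℕ} {s : MState} {σ q₁ q₂ qa qb : ℕ}

theorem run_fill {n : ℕ} (h₃ : s.reg 3 ≤ n) (h₁ : s.reg 1 ≤ W) (hW : n + 1 ≤ W) :
    Run W fillProg s fun s' t => (∀ y < 10, s'.reg y = s.reg y) ∧
      (∀ a < 5, s'.arr a = s.arr a) ∧ Holds s' (List.replicate (s.reg 3) (s.reg 1)) ∧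
      t ≤ 20 * n + 20 := by
  refine Run.cons (Run.assign (by simp) (Run.cons ?_))
  refine Run.loop (k := 20 * s.reg 3 + 4) (fun s' k => (∀ y < 10, s'.reg y = s.reg y) ∧
    (∀ a < 5, s'.arr a = s.arr a) ∧ s'.reg 12 ≤ s.reg 3 ∧
    (∀ i < s'.reg 12, s'.arr 5 i = s.reg 1) ∧ k = 20 * (s.reg 3 - s'.reg 12) + 4) ?_ ?_ ?_ ?_ ?_
  · refine ⟨fun y hy => ?_, fun a ha => rfl, by simp, by simp, by simp⟩
    simp [show y ≠ 12 by omega]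
  · rintro s' k ⟨hf, ha, hle, -⟩
    have := hf 3 (by norm_num)
    simp
    omega
  · rintro s' k ⟨hf, ha, hle, hc, rfl⟩ hb
    have hb : s'.reg 12 < s'.reg 3 := by simpa using hb
    have f₃ := hf 3 (by norm_num)
    have f₁ := hf 1 (by norm_num)
    refine Run.cons (Run.store (by simp; omega) (by simp; omega) (Run.cons (Run.assign
      (by simp; omega) (Run.nil ⟨20 * (s.reg 3 - (s'.reg 12 + 1)) + 4,
        ⟨fun y hy => ?_, fun a ha' => ?_, ?_, fun i hi => ?_, ?_⟩, ?_⟩))))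
    · simpa [show y ≠ 12 by omega] using hf y hy
    · rw [MState.setReg_arr, MState.setArr_arr_of_ne _ _ _ (by omega), ha a ha']
    · simp
      omega
    · simp only [MState.setReg_reg, if_true, RExpr.val_add, RExpr.val_reg, RExpr.val_num,
        MState.setArr_reg] at hi
      simp only [MState.setReg_arr, MState.setArr_arr, true_and, RExpr.val_reg]
      split_ifs with h
      · exact f₁
      · exact hc i (by omega)
    · simp
    · simp
      omega
  · rintro s' k ⟨-, -, -, -, rfl⟩ -
    simp
  · rintro s' t k ⟨hf, ha, hle, hc, -⟩ hb ht
    have hb : s'.reg 3 ≤ s'.reg 12 := by simpa using hb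
    have f₃ := hf 3 (by norm_num)
    refine Run.nil ⟨hf, ha, ⟨by simp; omega, fun i c hi => ?_⟩, ?_⟩
    · rw [List.getElem?_replicate] at hi
      split_ifs at hi with h
      rw [hc i (by omega)]
      exact Option.some_injective _ hi
    · simp
      omega

theorem run_lookup (h : Indexed W S s) (hm : Marks S (s.reg 1) q₁ q₂ qa qb) :
    Run W lookupProg s fun s' t => Indexed W S s' ∧
      Holds s' (List.replicate (S.count (s.reg 1) / 2) (s.reg 1)) ∧
      s'.reg 4 = s.arr 2 (s.reg 1) ∧ s'.reg 8 = q₁ ∧ s'.reg 9 = qa ∧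
      (Odd (S.count (s.reg 1)) → s'.reg 6 = qb) ∧
      (s'.reg 7 ≠ 0 ↔ Odd (S.count (s.reg 1))) ∧ s'.reg 7 ≤ 1 ∧
      (∀ a < 4, s'.arr a = s.arr a) ∧ t ≤ 100 * (S.length + 1) := by
  have hW := h.bound
  have hcnt := h.count (s.reg 1)
  have hcn : S.count (s.reg 1) ≤ S.length := List.count_le_length
  have hσS := List.mem_of_getElem? hm.first.1
  have hσW := h.letters _ hσS
  have hst := h.start _ hσS
  have o₁ := h.occ _ _ _ hm.first
  have oa := h.occ _ _ _ hm.middle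
  have l₁ := hm.first.lt_length
  have la := hm.middle.lt_length
  have htwo := hm.two_le
  rw [Nat.add_zero] at o₁
  refine Run.cons (Run.assign (by simp [hcnt]; omega) (Run.cons (Run.assign
    (by simp [hcnt]; omega) (Run.cons (Run.assign (by simp; omega) (Run.cons (Run.assign
    (by simp [hcnt]; omega) (Run.cons (Run.assign (by simp [o₁]; omega) (Run.cons (Run.assign
    (by simp [oa, hcnt]; omega) (Run.cons ?_))))))))))))
  simp only [RExpr.val_arr, RExpr.val_reg, RExpr.val_sub, RExpr.val_num, RExpr.val_add,
    RExpr.val_div, MState.setReg_reg, MState.setReg_arr, hcnt]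
  simp only [Nat.reduceEqDiff, if_true, if_false, o₁, oa]
  set s₁ := (((((s.setReg 2 (S.count (s.reg 1))).setReg 3 (S.count (s.reg 1) / 2)).setReg 4
    (s.arr 2 (s.reg 1))).setReg 7 (S.count (s.reg 1) - (S.count (s.reg 1) / 2 +
      S.count (s.reg 1) / 2))).setReg 8 q₁).setReg 9 qa with hs₁
  have main : ∀ s₂ t₂, t₂ ≤ 20 → s₂.arr = s.arr → (∀ y < 10, y ≠ 6 → s₂.reg y = s₁.reg y) →
      (Odd (S.count (s.reg 1)) → s₂.reg 6 = qb) →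
      Run W (.block [fillProg]) s₂ fun s' t => Indexed W S s' ∧
        Holds s' (List.replicate (S.count (s.reg 1) / 2) (s.reg 1)) ∧
        s'.reg 4 = s.arr 2 (s.reg 1) ∧ s'.reg 8 = q₁ ∧ s'.reg 9 = qa ∧
        (Odd (S.count (s.reg 1)) → s'.reg 6 = qb) ∧
        (s'.reg 7 ≠ 0 ↔ Odd (S.count (s.reg 1))) ∧ s'.reg 7 ≤ 1 ∧
        (∀ a < 4, s'.arr a = s.arr a) ∧ t₂ + t ≤ 20 * S.length + 50 := by
    intro s₂ t₂ ht₂ ha₂ hf₂ h₆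
    have f₁ := hf₂ 1 (by norm_num) (by norm_num)
    have f₃ := hf₂ 3 (by norm_num) (by norm_num)
    simp [hs₁] at f₁ f₃
    refine Run.cons ((run_fill (n := S.length) (by omega) (by omega) (by omega)).mono ?_)
    rintro s₃ t₃ ⟨hf₃, ha₃, hH, ht₃⟩
    rw [f₁, f₃] at hH
    have low : ∀ y < 10, y ≠ 6 → s₃.reg y = s₁.reg y := fun y hy hy' =>
      (hf₃ y hy).trans (hf₂ y hy hy')
    have e₀ := low 0 (by norm_num) (by norm_num)
    have e₄ := low 4 (by norm_num) (by norm_num)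
    have e₇ := low 7 (by norm_num) (by norm_num)
    have e₈ := low 8 (by norm_num) (by norm_num)
    have e₉ := low 9 (by norm_num) (by norm_num)
    simp [hs₁] at e₀ e₄ e₇ e₈ e₉
    have harr : ∀ a < 4, s₃.arr a = s.arr a := fun a ha => by rw [ha₃ a (by omega), ha₂]
    refine Run.nil ⟨h.congr e₀ harr, hH, e₄, e₈, e₉,
      fun ho => (hf₃ 6 (by norm_num)).trans (h₆ ho), ?_, ?_, harr, ?_⟩
    -- Register 7 holds ℓ - 2⌊ℓ/2⌋, the parity of ℓ.
    · rw [e₇, Nat.odd_iff]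
      omega
    · omega
    · omega
  have h₇ : s₁.reg 7 = S.count (s.reg 1) - (S.count (s.reg 1) / 2 + S.count (s.reg 1) / 2) := by
    simp [hs₁]
  have h₄ : s₁.reg 4 = s.arr 2 (s.reg 1) := by simp [hs₁]
  have h₃ : s₁.reg 3 = S.count (s.reg 1) / 2 := by simp [hs₁]
  have ha₁ : s₁.arr = s.arr := by simp [hs₁]
  clear_value s₁
  refine Run.ite (by simp; omega) (fun hb => ?_) fun hb => ?_
  · have hb : s₁.reg 7 ≠ 0 := hb
    have ho : Odd (S.count (s.reg 1)) := by
      rw [Nat.odd_iff]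
      omega
    have ob := h.occ _ _ _ (hm.next ho)
    have lb := (hm.next ho).lt_length
    refine Run.assign (by simp [h₃, h₄, ha₁, ob]; omega) ((main _ 20 le_rfl ?_ ?_ ?_).mono ?_)
    · simpa
    · intro y _ hy
      simp [hy]
    · intro _
      simp [h₃, h₄, ha₁, ob]
    · rintro s' t ⟨a₁, a₂, a₃, a₄, a₅, a₆, a₇, a₈, a₉, a₁₀⟩
      refine ⟨a₁, a₂, a₃, a₄, a₅, a₆, a₇, a₈, a₉, ?_⟩
      simp
      omega
  · have hb : s₁.reg 7 = 0 := hb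
    have ho : ¬ Odd (S.count (s.reg 1)) := by
      rw [Nat.odd_iff]
      omega
    refine Run.skip ((main _ 2 (by norm_num) ha₁ (fun _ _ _ => rfl) fun h => absurd h ho).mono ?_)
    rintro s' t ⟨a₁, a₂, a₃, a₄, a₅, a₆, a₇, a₈, a₉, a₁₀⟩
    refine ⟨a₁, a₂, a₃, a₄, a₅, a₆, a₇, a₈, a₉, ?_⟩
    simp
    omega

/-- Both anchors are computed for either parity, which saves a branch; for even ℓ the second one is
not used later. -/
theorem run_anchor {Y : List ℕ} {j₁ j₂ : ℕ} (h : Indexed W S s) (hY : Holds s Y)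
    (hne : Y ≠ []) (hj₁ : IsAnchor S q₁ Y j₁) (hj₂ : IsAnchor S q₂ Y j₂) (h₈ : s.reg 8 = q₁)
    (hq₁ : q₁ ≤ S.length) (hq₂ : q₂ ≤ S.length) (h₄ : s.reg 4 + 1 ≤ W)
    (hocc : s.arr 3 (s.reg 4 + 1) = q₂) :
    Run W anchorProg s fun s' t => Indexed W S s' ∧ Holds s' Y ∧ s'.reg 8 = 0 ∧
      s'.reg 9 = j₁ ∧ s'.reg 6 = j₂ ∧ s'.reg 7 = s.reg 7 ∧
      t ≤ 500 * (S.length + 1) * lg S.length := by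
  have hW := h.bound
  have hX : 1 ≤ (S.length + 1) * lg S.length := Nat.mul_pos (Nat.succ_pos _) (one_le_lg _)
  have hYS : ∀ c ∈ Y, c ∈ S := fun c hc => mem_of_mem_seg (hj₁.1.subset hc)
  have hYn : Y.length ≤ S.length := (hj₁.1.length_le.trans (length_seg_le S q₁ j₁)).trans (by omega)
  simp only [Nat.mul_assoc]
  refine Run.cons (Run.assign (by simp; omega) (Run.cons ?_))
  refine (run_match (Y := Y) (h.congr (by simp) (by simp)) (by simpa [Holds] using hY) hYS hYn
    (by simp; omega)).mono ?_
  rintro s₁ t₁ ⟨hf₁, ha₁, hr₁, ht₁⟩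
  simp [h₈] at hr₁ ha₁
  simp only [Nat.mul_assoc] at ht₁
  have e₁ := hr₁.eq_of_isAnchor hne hj₁
  have n₁ := hj₁.le_length
  have n₂ := hj₂.le_length
  have low₁ : ∀ y < 22, s₁.reg y = s.reg y := by
    intro y hy
    simpa [show y ≠ 30 by omega] using hf₁ y hy
  have f₀ := low₁ 0 (by norm_num)
  have f₄ := low₁ 4 (by norm_num)
  have f₁₂ := low₁ 12 (by norm_num)
  refine Run.cons (Run.assign (by simp; omega) (Run.cons (Run.assign
    (by simp [f₄, ha₁, hocc]; omega) (Run.cons ?_))))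
  refine (run_match (Y := Y) (h.congr (by simpa) (by simp [ha₁]))
    ⟨by simpa [f₁₂] using hY.1, by simpa [ha₁] using hY.2⟩ hYS hYn
    (by simp [f₄, ha₁, hocc]; omega)).mono ?_
  rintro s₂ t₂ ⟨hf₂, ha₂, hr₂, ht₂⟩
  simp [f₄, ha₁, hocc] at hr₂ ha₂
  simp only [Nat.mul_assoc] at ht₂
  have e₂ := hr₂.eq_of_isAnchor hne hj₂
  have low₂ : ∀ y < 22, y ≠ 9 → s₂.reg y = s.reg y := by
    intro y hy hy'
    have := hf₂ y hy
    simp [show y ≠ 30 by omega, hy'] at this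
    rw [this, low₁ y hy]
  have g₉ := hf₂ 9 (by norm_num)
  simp [e₁] at g₉
  refine Run.cons (Run.assign (by simp; omega) (Run.cons (Run.assign (by simp) (Run.nil
    ⟨h.congr ?_ (by simp [ha₂]), ⟨?_, ?_⟩, by simp, ?_, ?_, ?_, ?_⟩))))
  · simpa using low₂ 0 (by norm_num) (by norm_num)
  · simpa [low₂] using hY.1
  · simpa [ha₂] using hY.2
  · simpa using g₉
  · simpa using e₂
  · simpa using low₂ 7 (by norm_num) (by norm_num)
  · simp
    omega

/-- The output overwrites the array that held `S`; the letters of `Z` are read from array 5, so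
nothing needed is lost. -/
theorem run_output {Z : List ℕ} (hZ : Holds s Z) (hZW : ∀ c ∈ Z, c ≤ W)
    (hlen : 2 * Z.length + 1 ≤ W) :
    Run W outputProg s fun s' t => outputOf s' = Z ++ Z ∧ t ≤ 40 * Z.length + 40 := by
  obtain ⟨hZ₁, hZ₂⟩ := hZ
  refine Run.cons (Run.assign (by simp) (Run.cons ?_))
  refine Run.loop (k := 30 * Z.length + 4) (fun s' k => s'.reg 12 = Z.length ∧
    s'.arr 5 = s.arr 5 ∧ s'.reg 22 ≤ Z.length ∧
    (∀ j c, j < s'.reg 22 → Z[j]? = some c → s'.arr 0 j = c ∧ s'.arr 0 (j + Z.length) = c) ∧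
    k = 30 * (Z.length - s'.reg 22) + 4) ?_ ?_ ?_ ?_ ?_
  · exact ⟨by simpa, rfl, by simp, by simp, by simp⟩
  · rintro s' k ⟨h₁₂, ha, hle, -⟩
    simp
    omega
  · rintro s' k ⟨h₁₂, ha, hle, hc, rfl⟩ hb
    have hb : s'.reg 22 < s'.reg 12 := by simpa using hb
    have hlt : s'.reg 22 < Z.length := by omega
    have hi := List.getElem?_eq_getElem hlt
    have e := hZ₂ _ _ hi
    have hcW := hZW _ (List.getElem_mem hlt)
    refine Run.cons (Run.store (by simp; omega) (by simp [ha, e]; omega) (Run.cons (Run.store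
      (by simp; omega) (by simp [ha, e]; omega) (Run.cons (Run.assign (by simp; omega) (Run.nil
        ⟨30 * (Z.length - (s'.reg 22 + 1)) + 4, ⟨by simpa, ?_, ?_, fun j c hj hjc => ?_, ?_⟩,
          ?_⟩))))))
    · rw [MState.setReg_arr, MState.setArr_arr_of_ne _ _ _ (by norm_num),
        MState.setArr_arr_of_ne _ _ _ (by norm_num), ha]
    · simp
      omega
    · have hj' : j < s'.reg 22 + 1 := by simpa using hj
      simp only [MState.setReg_arr, MState.setArr_arr, MState.setArr_reg, RExpr.val_reg,
        RExpr.val_add, RExpr.val_arr, true_and, ha, e, h₁₂]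
      simp only [Nat.reduceEqDiff, false_and, if_false]
      rcases Nat.lt_succ_iff_lt_or_eq.1 hj' with hlt' | rfl
      · have := hc j c hlt' hjc
        rw [if_neg (by omega), if_neg (by omega), if_neg (by omega), if_neg (by omega)]
        exact this
      · obtain rfl := Option.some_injective _ (hi.symm.trans hjc)
        simp
    · simp
    · simp
      omega
  · rintro s' k ⟨-, -, -, -, rfl⟩ -
    simp
  · rintro s' t k ⟨h₁₂, ha, hle, hc, -⟩ hb ht
    have hb : s'.reg 12 ≤ s'.reg 22 := by simpa using hb
    refine Run.cons (Run.assign (by simp; omega) (Run.nil ⟨?_, ?_⟩))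
    · refine List.ext_getElem? fun i => ?_
      simp only [outputOf, MState.setReg_reg, MState.setReg_arr, if_true, RExpr.val_add,
        RExpr.val_reg, h₁₂, List.getElem?_map]
      rcases Nat.lt_or_ge i Z.length with hi | hi
      · have e := List.getElem?_eq_getElem hi
        rw [List.getElem?_append_left hi, List.getElem?_range (by omega), e, Option.map_some,
          (hc i _ (by omega) e).1]
      · rcases Nat.lt_or_ge i (Z.length + Z.length) with hi' | hi'
        · have e := List.getElem?_eq_getElem (l := Z) (i := i - Z.length) (by omega)
          have := (hc (i - Z.length) _ (by omega) e).2
          rw [Nat.sub_add_cancel hi] at this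
          rw [List.getElem?_append_right hi, List.getElem?_range hi', e, Option.map_some, this]
        · rw [List.getElem?_eq_none (by simpa), List.getElem?_eq_none (by simpa)]
          rfl
    · simp
      omega

theorem run_square (h : Indexed W S s) (htwo : 2 ≤ S.count (s.reg 1)) :
    Run W squareProg s fun s' t =>
      (∃ m, (maximalSquareAlg S (s.reg 1)).Returns (outputOf s') m) ∧
      t ≤ 20000 * (S.length + 1) * lg S.length := by
  have hW := h.bound
  have hlg := one_le_lg S.length
  have hX : 1 ≤ (S.length + 1) * lg S.length := Nat.mul_pos (Nat.succ_pos _) hlg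
  have hX' : S.length + 1 ≤ (S.length + 1) * lg S.length := Nat.le_mul_of_pos_right _ hlg
  obtain ⟨q₁, q₂, qa, qb, hm⟩ := exists_marks htwo
  have hσS := List.mem_of_getElem? hm.first.1
  have hst := h.start _ hσS
  have o₂ := h.occ _ _ _ hm.second
  simp only [Nat.mul_assoc]
  refine Run.cons ((run_lookup h hm).mono ?_)
  rintro s₁ t₁ ⟨i₁, H₁, h₄, h₈, h₉, h₆, h₇, h₇', ha₁, ht₁⟩
  refine Run.cons ((run_stage i₁ h₈ h₉ h₆ h₇ h₇' hm.q₁_lt_qa.le hm.middle.lt_length.le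
    (fun ho => ⟨(hm.qa_lt_qb ho).le, (hm.next ho).lt_length.le⟩) H₁ hm.replicate_sublist_left
    hm.replicate_sublist_right).mono ?_)
  rintro s₂ t₂ ⟨hf₂, ha₂, ⟨Y₀, Y, hY₀, hY, H₂⟩, ht₂⟩
  simp only [Nat.mul_assoc] at ht₂
  have hFirst : FirstResult S (s.reg 1) q₁ qa qb Y := ⟨Y₀, hY₀, hY⟩
  obtain ⟨j₁, j₂, hj₁, hj₂, hle, hs₁, hs₂⟩ := hFirst.calls hm
  have hne : Y ≠ [] := by
    obtain ⟨Y', rfl⟩ := hFirst.exists_cons hm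
    exact List.cons_ne_nil _ _
  have g₄ := hf₂ 4 (by norm_num)
  have g₈ := hf₂ 8 (by norm_num)
  have g₇ := hf₂ 7 (by norm_num)
  refine Run.cons ((run_anchor (q₁ := q₁) (q₂ := q₂) (i₁.congr (hf₂ 0 (by norm_num))
    fun a ha => ha₂ a (by omega)) H₂ hne hj₁ hj₂ (by omega) hm.first.lt_length.le
    hm.second.lt_length.le (by omega) ?_).mono ?_)
  · rw [ha₂ 3 (by norm_num), ha₁ 3 (by norm_num), g₄, h₄, o₂]
  rintro s₃ t₃ ⟨i₃, H₃, k₈, k₉, k₆, k₇, ht₃⟩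
  simp only [Nat.mul_assoc] at ht₃
  refine Run.cons ((run_stage (odd := Odd (S.count (s.reg 1))) i₃ k₈ k₉ (fun _ => k₆)
    (by rw [k₇, g₇]; exact h₇) (by omega) (Nat.zero_le _) hj₁.le_length
    (fun _ => ⟨hle, hj₂.le_length⟩) H₃ hs₁ hs₂).mono ?_)
  rintro s₄ t₄ ⟨hf₄, ha₄, ⟨Z₀, Z, hZ₀, hZ, H₄⟩, ht₄⟩
  simp only [Nat.mul_assoc] at ht₄
  have hSecond : SecondResult S (s.reg 1) j₁ j₂ Y Z := ⟨Z₀, hZ₀, hZ⟩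
  have hZZ := hSecond.sublist.2
  have hlen := hZZ.length_le
  rw [List.length_append] at hlen
  refine Run.cons ((run_output H₄ (fun c hc => h.letters c
    (hZZ.subset (List.mem_append_left _ hc))) (by omega)).mono ?_)
  rintro s₅ t₅ ⟨hout, ht₅⟩
  refine Run.nil ⟨?_, by omega⟩
  rw [hout]
  exact exists_returns_of_results hm hFirst hj₁ (fun _ => hj₂) hSecond

theorem run_maximalSquare {M : ℕ} (hS : ∀ c ∈ S, c ≤ M) (hσ : σ ≤ M)
    (hW : W = 10 * (S.length + M + 1)) :
    Run W maximalSquareProg (inputState S σ) fun s' t =>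
      t ≤ 21000 * (S.length + 1) * lg S.length ∧ IsMaximalSquareSubseq S (outputOf s') ∧
      (2 ≤ S.count σ → ∃ m, (maximalSquareAlg S σ).Returns (outputOf s') m) := by
  have hlg := one_le_lg S.length
  have hX : S.length + 1 ≤ (S.length + 1) * lg S.length := Nat.le_mul_of_pos_right _ hlg
  simp only [Nat.mul_assoc]
  have hSW : ∀ c ∈ S, c ≤ W := fun c hc => (hS c hc).trans (by omega)
  have hstr : ∀ i c, S[i]? = some c → (inputState S σ).arr 0 i = c := by
    intro i c hi
    simp [inputState, List.getD, hi]
  refine Run.cons ((run_count (S := S) (s := inputState S σ) rfl (by omega) hSW hstr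
    fun c => by simp [inputState]).mono ?_)
  rintro s₁ t₁ ⟨hf₁, ha₁, hc₁, ht₁⟩
  refine Run.cons ((run_list (S := S) ((hf₁ 0 (by norm_num)).trans rfl) (by omega) hSW
    (by rwa [ha₁ 0 (by norm_num)]) hc₁ fun c => by simp [ha₁, inputState]).mono ?_)
  rintro s₂ t₂ ⟨hf₂, hi₂, ht₂⟩
  have hσ₂ : s₂.reg 1 = σ := by
    rw [hf₂ 1 (by norm_num), hf₁ 1 (by norm_num)]
    rfl
  refine Run.cons ((run_select hi₂ (by omega)).mono ?_)
  rintro s₃ t₃ ⟨ha₃, h₀, h₁, hsame, hnone, ht₃⟩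
  rw [hσ₂] at hsame
  have hi₃ : Indexed W S s₃ := hi₂.congr h₀ fun a _ => by rw [ha₃]
  have hcnt := hi₃.count (s₃.reg 1)
  have hcn : S.count (s₃.reg 1) ≤ S.length := List.count_le_length
  refine Run.cons (Run.ite (by simp [hcnt]; omega) (fun hb => ?_) fun hb => ?_)
  · have hb : S.count (s₃.reg 1) < 2 := by simpa [hcnt] using hb
    refine Run.assign (by simp) (Run.nil ⟨?_, ?_, fun htwo => ?_⟩)
    · simp
      omega
    · have hout : outputOf (s₃.setReg 0 (RExpr.val s₃ (.num 0))) = [] ++ [] := by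
        simp [outputOf]
      rw [hout]
      refine isMaximalSquareSubseq_of_forall (List.nil_sublist S) fun V hV _ => ?_
      -- A letter of `V` would occur twice in VV and hence at least twice in `S`.
      refine List.eq_nil_iff_forall_not_mem.2 fun c hc => ?_
      have h₂ := hV.count_le c
      rw [List.count_append] at h₂
      have := List.count_pos_iff.2 hc
      have := hnone hb c
      omega
    · have := hnone hb σ
      omega
  · have hb : 2 ≤ S.count (s₃.reg 1) := by simpa [hcnt] using hb
    refine (run_square hi₃ hb).mono ?_
    rintro s₄ t₄ ⟨⟨m, hm⟩, ht₄⟩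
    simp only [Nat.mul_assoc] at ht₄
    refine Run.nil ⟨?_, ((wp_maximalSquareAlg hb).of_returns hm).2.2, fun htwo => ⟨m, ?_⟩⟩
    · simp
      omega
    · rwa [hsame htwo] at hm

theorem isBigO_mul_lg (K : ℕ) :
    (fun n : ℕ => ((K * (n + 1) * lg n : ℕ) : ℝ)) =O[Filter.atTop]
      fun n : ℕ => (n : ℝ) * Real.log n := by
  -- For n ≥ 2 one has n + 1 ≤ 2n and lg n ≤ 2 log n / log 2 ≤ 4 log n, which gives the factor 8.
  refine Asymptotics.IsBigO.of_bound (K * 8) ?_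
  filter_upwards [Filter.eventually_ge_atTop 2] with n hn
  have hn' : (2 : ℝ) ≤ n := by exact_mod_cast hn
  have hlog2 := Real.log_two_gt_d9
  have hlog : Real.log 2 ≤ Real.log n := Real.log_le_log (by norm_num) hn'
  have hle : (Nat.log 2 n : ℝ) * Real.log 2 ≤ Real.log n := by
    have := Real.natLog_le_logb n 2
    rw [Real.logb, le_div_iff₀ (by push_cast; linarith)] at this
    exact_mod_cast this
  have hpos : (0 : ℝ) ≤ Nat.log 2 n := Nat.cast_nonneg _
  have hlg : (lg n : ℝ) ≤ 4 * Real.log n := by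
    unfold lg
    push_cast
    nlinarith
  have hmul : ((n : ℝ) + 1) * lg n ≤ (2 * n) * (4 * Real.log n) :=
    mul_le_mul (by linarith) hlg (Nat.cast_nonneg _) (by linarith)
  rw [Real.norm_of_nonneg (Nat.cast_nonneg _),
    Real.norm_of_nonneg (mul_nonneg (by linarith) (by linarith))]
  push_cast
  calc (K : ℝ) * (n + 1) * lg n = K * ((n + 1) * lg n) := by ring
    _ ≤ K * ((2 * n) * (4 * Real.log n)) := mul_le_mul_of_nonneg_left hmul (Nat.cast_nonneg _)
    _ = K * 8 * (n * Real.log n) := by ring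

end Main

end MaxSq

theorem mainTheorem2 :
    (∀ (α : Type*) [DecidableEq α] (S : List α) (σ : α), 2 ≤ S.count σ →
      (MaxSq.maximalSquareAlg S σ).Safe ∧
      (∃ (X : List α) (m : ℕ), (MaxSq.maximalSquareAlg S σ).Returns X m) ∧
      ∀ (X : List α) (m : ℕ), (MaxSq.maximalSquareAlg S σ).Returns X m →
        m ≤ 4 ∧
        (List.replicate (2 * (S.count σ / 2)) σ).Sublist X ∧
        MaxSq.IsMaximalSquareSubseq S X ∧
        ¬ MaxSq.RightExtendable S X ∧
        ¬ MaxSq.LeftExtendable S X ∧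
        ¬ MaxSq.InnerExtendable S X) ∧
    (∃ (P : MaxSq.RStmt) (C : ℕ) (T : ℕ → ℕ),
      (fun n : ℕ => (T n : ℝ)) =O[Filter.atTop] (fun n : ℕ => (n : ℝ) * Real.log n) ∧
      ∀ (S : List ℕ) (σ M : ℕ), (∀ c ∈ S, c ≤ M) → σ ≤ M →
        ∃ (s : MaxSq.MState) (t : ℕ),
          MaxSq.Exec (C * (S.length + M + 1)) P (MaxSq.inputState S σ) s t ∧
          t ≤ T S.length ∧
          MaxSq.IsMaximalSquareSubseq S (MaxSq.outputOf s) ∧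
          (2 ≤ S.count σ →
            ∃ m : ℕ, (MaxSq.maximalSquareAlg S σ).Returns (MaxSq.outputOf s) m)) := by
  refine ⟨fun α _ S σ h => ?_, MaxSq.maximalSquareProg, 10,
    fun n => 21000 * (n + 1) * MaxSq.lg n, MaxSq.isBigO_mul_lg 21000, fun S σ M hS hσ => ?_⟩
  · have hwp := MaxSq.wp_maximalSquareAlg h
    refine ⟨hwp.safe, hwp.safe.exists_returns, fun X m hX => ?_⟩
    obtain ⟨h₁, h₂, h₃⟩ := hwp.of_returns hX
    exact ⟨h₁, h₂, h₃, h₃.not_rightExtendable, h₃.not_leftExtendable, h₃.not_innerExtendable⟩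
  · obtain ⟨s, t, he, ht, hmax, hret⟩ := MaxSq.run_maximalSquare hS hσ rfl
    exact ⟨s, t, he, ht, hmax, hret⟩
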